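/- Let $K=\mathbb R$ or $\mathbb C$; "smooth" means $C^\infty$ if $K=\mathbb R$ and holomorphic if $K=\mathbb C$. Consider the two parametrized curves, written with $r=s^{1/3}$, $$\text{(1)}\quad (t,H)=\Big(\frac{2s^{1/3}}{s+2},-\frac{4s^{2/3}}{s+2}\Big),\quad p_{11}=\frac{4}{3(s-1)};\qquad \text{(2)}\quad (t,H)=\Big(\frac{2s^{2/3}}{1+2s},-\frac{4s^{1/3}}{1+2s}\Big),\quad p_{11}=-\frac{4}{3(s-1)}.$$ Fix one of them. Let $W\subseteq K$ be a connected nonempty open set of parameters $r$ avoiding $s=1$ and the zeros of the denominator $s+2$, respectively $1+2s$ (and $r=0$ in case (2)), whose image $T\subseteq K$ under $r\mapsto t$ is open and on which $H$ is a function $H(t)$, $t\in T$. Let $F=\int H\,dt$ be the antiderivative of $H$ on $T$ normalized by $t^2H_t-2tH+2F=p_{11}$. Put $p_{12}=H-tH_t$ and $p_{22}=H_t$. On $R_T=\{(x,y,z,p,q,t): t\in T\}$ let $\tilde D_2$ be the distribution annihilated by $$\varpi=dz-p\,dx-q\,dy,\quad \omega_2=dp+p_{11}dx+p_{12}dy,\quad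 \omega_3=dq+p_{12}dx+p_{22}dy,\quad \omega_4=dy-t\,dx.$$ With $t=-\tfrac12X$ and $H$ viewed as a function of $X$, let $D_1$ be the distribution on $M_T=\{(X,Y,Z,P,Q): -\tfrac12X\in T\}$ annihilated by $$dY-P\,dX,\qquad dP-Q\,dX,\qquad dZ-\frac{Q^2}{H_{XX}}dX,$$ and let $\tilde D_1$ be the distribution on $R'_T=\{(X,Y,Z,P,Q,L): -\tfrac12X\in T\}$ annihilated by these three forms and $dQ-L\,dX$. Let $\Phi:(x,y,z,p,q,t)\mapsto(X,Y,Z,P,Q,L)$ be given by $$\begin{aligned}X&=-2t,\qquad Y=p+tq+(2F-tH)x+Hy,\\ Z&=z-px-qy-(\tfrac12t^2H_t-tH+F)x^2-(H-tH_t)xy-\tfrac12H_ty^2,\\ P&=-\tfrac12q-\tfrac12(H-tH_t)x-\tfrac12H_ty,\qquad Q=\tfrac14H_{tt}(y-tx),\qquad L=\tfrac18\big(H_{ttt}(tx-y)+H_{tt}x\big).\end{aligned}$$ Let $\mathfrak g$ be the Lie algebra of vector fields on $J=K^5$, with coordinates $(x,y,z,p,q)$, generated by the following fourteen vector fields $S^1,L^2,S^3,\dots,L^{12},h_1,h_2$,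 where $(a,b,c,d,e)$ stands for $a\partial_x+b\partial_y+c\partial_z+d\partial_p+e\partial_q$. In case (1): $$\begin{aligned} S^1&=\big(3qx+6y^2-\tfrac94pq,\ -3z+3px+4qy-\tfrac98p^2,\ 8xy^2+3pqx+2q^2y-\tfrac94p^2q,\ 8y^2,\ -12py+q^2+16xy\big),\\ L^2&=\big(\tfrac92px-\tfrac{27}{16}p^2-\tfrac32z-2x^2,\ -\tfrac14q^2,\ \tfrac94p^2x-\tfrac98p^3-\tfrac16q^3-2xz,\ -2z+2px-\tfrac34p^2,\ \tfrac32pq-2qx\big),\\ S^3&=\big(-\tfrac32y,\ -\tfrac12q,\ -2xy-\tfrac14q^2,\ -2y,\ \tfrac32p-2x\big),\\ L^4&=(\tfrac34,0,x,1,0),\quad S^5=(0,1,0,0,0),\quad L^6=(0,0,1,0,0),\quad S^7=(0,0,y,0,1),\quad L^8=(1,0,0,0,0),\\ S^9&=\big(\tfrac34q,\ \tfrac34p,\ \tfrac34pq+2y^2,\ 0,\ 4y\big),\\ L^{10}&=\big(\tfrac34qy+\tfrac{27}{32}p^2-\tfrac34z,\ \tfrac34py,\ \tfrac34pqy+\tfrac9{16}p^3+\tfrac23y^3,\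 \tfrac34p^2,\ 2y^2\big),\\ S^{11}&=\big(\tfrac38q^2+\tfrac94py,\ \tfrac34pq+y^2,\ \tfrac34pq^2+\tfrac98p^2y+3yz,\ 3py,\ 3z-\tfrac98p^2+qy\big),\\ L^{12}&=\big(3zx+\tfrac18q^3-3qxy-2y^3-\tfrac{27}8p^2x+\tfrac{27}{16}p^3+\tfrac94pqy,\ 3yz-3pxy+\tfrac38pq^2-2qy^2+\tfrac98p^2y,\\ &\quad -\tfrac94p^3x-\tfrac83xy^3+3z^2+\tfrac38q^3p-q^2y^2+\tfrac94qyp^2+\tfrac{81}{64}p^4-3xpqy,\\ &\quad 3pz-3p^2x-\tfrac83y^3+\tfrac98p^3,\ 3qz-\tfrac98p^2q+6py^2-q^2y-8xy^2\big),\\ h_1&=\big(-\tfrac94p+\tfrac32x,\ -\tfrac12y,\ -\tfrac98p^2,\ -\tfrac32p,\ \tfrac12q\big),\qquad h_2=\tfrac{\sqrt3}2(x,y,2z,p,q). \end{aligned}$$ In case (2): $$\begin{aligned} S^1&=\big(-\tfrac3{16}q^2-\tfrac32xy-\tfrac98py,\ -\tfrac38pq-\tfrac12y^2-\tfrac12qx,\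 -\tfrac9{16}p^2y-\tfrac14q^2x-\tfrac38q^2p-\tfrac32yz,\ \tfrac14q^2,\ -\tfrac32z+\tfrac32px-\tfrac12qy+\tfrac9{16}p^2\big),\\ L^2&=\big(-\tfrac94px-\tfrac{27}{32}p^2+\tfrac34z-x^2-\tfrac34qy,\ -\tfrac34py-xy,\ -\tfrac98p^2x-\tfrac9{16}p^3-xz-\tfrac34pqy-\tfrac23y^3,\\ &\quad -z+px+qy+\tfrac38p^2,\ -2y^2\big),\\ S^3&=\big(-\tfrac38q,\ -\tfrac38p-\tfrac12x,\ -\tfrac38pq-y^2,\ \tfrac12q,\ -2y\big),\\ L^4&=(-\tfrac34,0,x,1,0),\quad S^5=(0,0,y,0,1),\quad L^6=(0,0,1,0,0),\quad S^7=(0,1,0,0,0),\quad L^8=(1,0,0,0,0),\\ S^9&=\big(3y,\ q,\ \tfrac12q^2,\ 0,\ -3p\big),\\ L^{10}&=\big(3z+\tfrac{27}8p^2,\ \tfrac12q^2,\ \tfrac94p^3+\tfrac13q^3,\ -3p^2,\ -3pq\big),\\ S^{11}&=\big(-6y^2+\tfrac94qp,\ 3z+\tfrac98p^2-4qy,\ \tfrac94p^2q-2yq^2,\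 -3pq,\ 12py-q^2\big),\\ L^{12}&=\big(-3zx-\tfrac18q^3-\tfrac94pqy+2y^3-\tfrac{27}8p^2x-\tfrac{27}{16}p^3,\ -3yz-\tfrac12q^2x-\tfrac38pq^2+2qy^2-\tfrac98p^2y,\\ &\quad -\tfrac94p^3x-\tfrac13xq^3-3z^2-\tfrac38q^3p+q^2y^2-\tfrac94qyp^2-\tfrac{81}{64}p^4,\\ &\quad -3pz+3p^2x+3pqy+\tfrac16q^3+\tfrac98p^3,\ -3qz+3pqx+\tfrac98p^2q-6py^2+q^2y\big),\\ h_1&=\big(\tfrac94p+\tfrac32x,\ \tfrac12y,\ \tfrac98p^2,\ -\tfrac32p,\ -\tfrac12q\big),\qquad h_2=\tfrac{\sqrt3}2(x,y,2z,p,q). \end{aligned}$$ Then, in each of the two cases: 1. $\Phi$ is a smooth bijection $R_T\to R'_T$ with smooth inverse, and $\Phi_*\tilde D_2=\tilde D_1$. 2. The fourteen vector fields form a basis of $\mathfrak g$, and $\mathfrak g$ is isomorphic to the split simple Lie algebra $\mathfrak g_2$ over $K$. 3. There is an isomorphism $e$ of Lie algebras from $\mathfrak g$ onto the Lie algebra of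 all smooth infinitesimal symmetries of the distribution $D_1$ on $M_T$ such that, for every $\xi\in\mathfrak g$: there is a unique smooth infinitesimal symmetry $\zeta$ of $\tilde D_2$ on $R_T$ which projects to $\xi$ under $(x,y,z,p,q,t)\mapsto(x,y,z,p,q)$; there is a unique smooth infinitesimal symmetry $\zeta'$ of $\tilde D_1$ on $R'_T$ which projects to $e(\xi)$ under $(X,Y,Z,P,Q,L)\mapsto(X,Y,Z,P,Q)$; and $\Phi_*\zeta=\zeta'$. (An infinitesimal symmetry of a distribution $D$ on an open set $U$ is a vector field $V$ on $U$ with $[V,\Gamma(D)]\subseteq\Gamma(D)$, where $\Gamma(D)$ is the space of smooth sections of $D$ over $U$.) -/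

import Mathlib

open TopologicalSpace Set
open scoped ContDiff

noncomputable section

/-! ### Smooth vector fields on an open set -/

section VectorFields

variable {𝕜 : Type*} [RCLike 𝕜] {E : Type*} [NormedAddCommGroup E] [NormedSpace 𝕜 E]

/-- The space of smooth vector fields on the open set `U` (real smooth for `𝕜 = ℝ`, holomorphic
for `𝕜 = ℂ`). A vector field on `U` is stored as a function on the whole space which is extended
by zero outside `U`, so that two of them are equal iff they agree on `U`. -/
def SmoothVF (𝕜 : Type*) [RCLike 𝕜] {E : Type*} [NormedAddCommGroup E] [NormedSpace 𝕜 E]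
    (U : Opens E) : Submodule 𝕜 (E → E) where
  carrier := {V | ContDiffOn 𝕜 ∞ V U ∧ ∀ x ∉ U, V x = 0}
  add_mem' := fun {V W} hV hW =>
    ⟨hV.1.add hW.1, fun x hx => by simp [hV.2 x hx, hW.2 x hx]⟩
  zero_mem' := ⟨contDiffOn_const, fun _ _ => rfl⟩
  smul_mem' := fun c V hV => ⟨hV.1.const_smul c, fun x hx => by simp [hV.2 x hx]⟩

namespace SmoothVF

variable {U : Opens E}

theorem contDiffAt (V : SmoothVF 𝕜 U) {x : E} (hx : x ∈ U) : ContDiffAt 𝕜 ∞ V.1 x :=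
  V.2.1.contDiffAt (U.isOpen.mem_nhds hx)

theorem differentiableAt (V : SmoothVF 𝕜 U) {x : E} (hx : x ∈ U) : DifferentiableAt 𝕜 V.1 x :=
  (SmoothVF.contDiffAt V hx).differentiableAt (by simp)

theorem ext_on {V W : SmoothVF 𝕜 U} (h : ∀ x ∈ U, V.1 x = W.1 x) : V = W := by
  apply Subtype.ext
  funext x
  by_cases hx : x ∈ U
  · exact h x hx
  · rw [V.2.2 x hx, W.2.2 x hx]

open Classical in
/-- The Lie bracket of vector fields, `[V, W] = DW · V - DV · W` on `U`. -/
instance : Bracket (SmoothVF 𝕜 U) (SmoothVF 𝕜 U) where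
  bracket V W :=
    ⟨fun x => if x ∈ U then VectorField.lieBracket 𝕜 V.1 W.1 x else 0, by
      refine ⟨?_, fun x hx => if_neg hx⟩
      have h : ContDiffOn 𝕜 ∞ (VectorField.lieBracket 𝕜 V.1 W.1) U := fun x hx =>
        (ContDiffAt.lieBracket_vectorField (n := ∞) (SmoothVF.contDiffAt V hx) (SmoothVF.contDiffAt W hx)
          (by simp)).contDiffWithinAt
      exact h.congr fun x hx => if_pos hx⟩

theorem bracket_apply (V W : SmoothVF 𝕜 U) {x : E} (hx : x ∈ U) :
    (⁅V, W⁆ : SmoothVF 𝕜 U).1 x = VectorField.lieBracket 𝕜 V.1 W.1 x := if_pos hx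

theorem bracket_eventuallyEq (V W : SmoothVF 𝕜 U) {x : E} (hx : x ∈ U) :
    (⁅V, W⁆ : SmoothVF 𝕜 U).1 =ᶠ[nhds x] VectorField.lieBracket 𝕜 V.1 W.1 := by
  filter_upwards [U.isOpen.mem_nhds hx] with y hy using bracket_apply V W hy

instance : LieRing (SmoothVF 𝕜 U) where
  add_lie V W Z := ext_on fun x hx => by
    have h := VectorField.lieBracket_add_left (W := Z.1) (SmoothVF.differentiableAt V hx)
      (SmoothVF.differentiableAt W hx)
    rw [bracket_apply _ _ hx]
    change _ = (⁅V, Z⁆ : SmoothVF 𝕜 U).1 x + (⁅W, Z⁆ : SmoothVF 𝕜 U).1 x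
    rw [bracket_apply _ _ hx, bracket_apply _ _ hx]
    exact h
  lie_add V W Z := ext_on fun x hx => by
    have h := VectorField.lieBracket_add_right (V := V.1) (SmoothVF.differentiableAt W hx)
      (SmoothVF.differentiableAt Z hx)
    rw [bracket_apply _ _ hx]
    change _ = (⁅V, W⁆ : SmoothVF 𝕜 U).1 x + (⁅V, Z⁆ : SmoothVF 𝕜 U).1 x
    rw [bracket_apply _ _ hx, bracket_apply _ _ hx]
    exact h
  lie_self V := ext_on fun x hx => by
    rw [bracket_apply _ _ hx, VectorField.lieBracket_self]; rfl
  leibniz_lie V W Z := ext_on fun x hx => by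
    have h := VectorField.leibniz_identity_lieBracket (𝕜 := 𝕜) (n := ∞) (x := x)
      (by rw [minSmoothness_of_isRCLikeNormedField]; exact ENat.LEInfty.out)
      (SmoothVF.contDiffAt V hx) (SmoothVF.contDiffAt W hx) (SmoothVF.contDiffAt Z hx)
    change _ = (⁅⁅V, W⁆, Z⁆ : SmoothVF 𝕜 U).1 x + (⁅W, ⁅V, Z⁆⁆ : SmoothVF 𝕜 U).1 x
    rw [bracket_apply _ _ hx, bracket_apply _ _ hx, bracket_apply _ _ hx,
      (Filter.EventuallyEq.refl _ V.1).lieBracket_vectorField_eq (bracket_eventuallyEq W Z hx),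
      (bracket_eventuallyEq V W hx).lieBracket_vectorField_eq (Filter.EventuallyEq.refl _ Z.1),
      (Filter.EventuallyEq.refl _ W.1).lieBracket_vectorField_eq (bracket_eventuallyEq V Z hx)]
    exact h

instance : LieAlgebra 𝕜 (SmoothVF 𝕜 U) where
  lie_smul c V W := ext_on fun x hx => by
    have h := VectorField.lieBracket_const_smul_right (V := V.1) (c := c) (SmoothVF.differentiableAt W hx)
    rw [bracket_apply _ _ hx]
    change _ = c • (⁅V, W⁆ : SmoothVF 𝕜 U).1 x
    rw [bracket_apply _ _ hx]
    exact h

/-- An everywhere smooth map `E → E` as a vector field on the whole space. -/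
def ofContDiff (V : E → E) (hV : ContDiff 𝕜 ∞ V) : SmoothVF 𝕜 (⊤ : Opens E) :=
  ⟨V, hV.contDiffOn, fun _ hx => absurd trivial hx⟩

end SmoothVF

/-- The smooth sections over `U` of a field of subspaces `D` of the tangent spaces. -/
def smoothSections (D : E → Submodule 𝕜 E) (U : Opens E) : Submodule 𝕜 (SmoothVF 𝕜 U) where
  carrier := {V | ∀ x ∈ U, V.1 x ∈ D x}
  add_mem' := fun {_ _} hV hW x hx => (D x).add_mem (hV x hx) (hW x hx)
  zero_mem' := fun x _ => (D x).zero_mem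
  smul_mem' := fun c _ hV x hx => (D x).smul_mem c (hV x hx)

/-- The Lie algebra of infinitesimal symmetries of the distribution `D` on `U`: the smooth vector
fields `V` on `U` with `[V, Γ(D)] ⊆ Γ(D)`. -/
def symmetryAlgebra (D : E → Submodule 𝕜 E) (U : Opens E) : LieSubalgebra 𝕜 (SmoothVF 𝕜 U) where
  carrier := {V | ∀ W ∈ smoothSections D U, ⁅V, W⁆ ∈ smoothSections D U}
  add_mem' := fun {V V'} hV hV' W hW => by
    rw [add_lie]; exact add_mem (hV W hW) (hV' W hW)
  zero_mem' := fun W _ => by rw [zero_lie]; exact zero_mem _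
  smul_mem' := fun c V hV W hW => by
    rw [smul_lie]; exact Submodule.smul_mem _ c (hV W hW)
  lie_mem' := fun {V V'} hV hV' W hW => by
    rw [lie_lie]; exact sub_mem (hV _ (hV' W hW)) (hV' _ (hV W hW))

end VectorFields

/-! ### The two parametrized solutions of Noth's equation -/

/-- A curve `r ↦ (t, H)`, together with the value along the curve of the coefficient
`p₁₁ = t² H_t - 2 t H + 2 ∫ H dt` (which fixes the constant of integration in `∫ H dt`), and the
set of admissible parameters. -/
structure NothCurve (𝕜 : Type*) where
  t : 𝕜 → 𝕜
  H : 𝕜 → 𝕜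
  p₁₁ : 𝕜 → 𝕜
  dom : Set 𝕜

/-- The two solutions of Noth's equation, parametrized by `r = s^{1/3}`, that is `s = r³`:
* `(t, H) = (2 s^{1/3} / (s + 2), -4 s^{2/3} / (s + 2))` with `p₁₁ = 4 / (3 (s - 1))`;
* `(t, H) = (2 s^{2/3} / (1 + 2 s), -4 s^{1/3} / (1 + 2 s))` with `p₁₁ = -4 / (3 (s - 1))`.
The excluded parameters are the poles of the curve and of the structural forms. -/
def nothCurve (𝕜 : Type*) [RCLike 𝕜] : Fin 2 → NothCurve 𝕜 :=
  ![{ t := fun r => 2 * r / (r ^ 3 + 2)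
      H := fun r => -(4 * r ^ 2) / (r ^ 3 + 2)
      p₁₁ := fun r => 4 / (3 * (r ^ 3 - 1))
      dom := {r | r ^ 3 + 2 ≠ 0 ∧ r ^ 3 - 1 ≠ 0} },
    { t := fun r => 2 * r ^ 2 / (1 + 2 * r ^ 3)
      H := fun r => -(4 * r) / (1 + 2 * r ^ 3)
      p₁₁ := fun r => -4 / (3 * (r ^ 3 - 1))
      dom := {r | 1 + 2 * r ^ 3 ≠ 0 ∧ r ^ 3 - 1 ≠ 0 ∧ r ≠ 0} }]

/-- `H` is, on the `t`-domain `T`, the function whose graph is the part of the curve `c` over a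
connected open set `W` of parameters, and `F = ∫ H dt` is its antiderivative with the constant of
integration prescribed by the value of `p₁₁ = t² H_t - 2 t H + 2 F`. -/
structure IsBranch {𝕜 : Type*} [RCLike 𝕜] (c : NothCurve 𝕜) (W : Set 𝕜) (T : Opens 𝕜)
    (H F : 𝕜 → 𝕜) : Prop where
  isOpen : IsOpen W
  isConnected : IsConnected W
  subset_dom : W ⊆ c.dom
  image_eq : c.t '' W = T
  apply_eq : ∀ r ∈ W, H (c.t r) = c.H r
  hasDerivAt : ∀ t ∈ T, HasDerivAt F (H t) t
  p₁₁_eq : ∀ r ∈ W, (c.t r) ^ 2 * deriv H (c.t r) - 2 * c.t r * H (c.t r) + 2 * F (c.t r) = c.p₁₁ r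

/-! ### The contact side `(x, y, z, p, q, t)` -/

/-- The vector fields `S¹, L², S³, L⁴, S⁵, L⁶, S⁷, L⁸, S⁹, L¹⁰, S¹¹, L¹², h₁, h₂` of the contact
structure of the first solution, as the coefficients of `∂_x, ∂_y, ∂_z, ∂_p, ∂_q`. -/
def contactFieldCoeff₁ {𝕜 : Type*} [RCLike 𝕜] (x y z p q : 𝕜) : Fin 14 → Fin 5 → 𝕜 :=
  let c : 𝕜 := ((√3 / 2 : ℝ) : 𝕜)
  ![![-(-3*q*x - 6*y^2 + 9/4*p*q),
      -(3*z - 3*p*x - 4*q*y + 9/8*p^2),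
      -(-8*x*y^2 - 3*p*q*x - 2*q^2*y + 9/4*p^2*q),
      8*y^2,
      -(12*p*y - q^2 - 16*x*y)],
    ![-(-9/2*p*x + 27/16*p^2 + 3/2*z + 2*x^2),
      -(1/4*q^2),
      -(-9/4*p^2*x + 9/8*p^3 + 1/6*q^3 + 2*x*z),
      -(2*z - 2*p*x + 3/4*p^2),
      3/2*p*q - 2*q*x],
    ![-(3/2*y),
      -(1/2*q),
      -(2*x*y + 1/4*q^2),
      -2*y,
      3/2*p - 2*x],
    ![3/4, 0, x, 1, 0],
    ![0, 1, 0, 0, 0],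
    ![0, 0, 1, 0, 0],
    ![0, 0, y, 0, 1],
    ![1, 0, 0, 0, 0],
    ![3/4*q,
      3/4*p,
      3/4*p*q + 2*y^2,
      0,
      4*y],
    ![3/4*q*y + 27/32*p^2 - 3/4*z,
      3/4*p*y,
      3/4*p*q*y + 9/16*p^3 + 2/3*y^3,
      3/4*p^2,
      2*y^2],
    ![3/8*q^2 + 9/4*p*y,
      3/4*p*q + y^2,
      3/4*p*q^2 + 9/8*p^2*y + 3*y*z,
      3*p*y,
      -(-3*z + 9/8*p^2 - q*y)],
    ![3*z*x + 1/8*q^3 - 3*q*x*y - 2*y^3 - 27/8*p^2*x + 27/16*p^3 + 9/4*p*q*y,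
      3*y*z - 3*p*x*y + 3/8*p*q^2 - 2*q*y^2 + 9/8*p^2*y,
      -9/4*p^3*x - 8/3*x*y^3 + 3*z^2 + 3/8*q^3*p - q^2*y^2 + 9/4*q*y*p^2 + 81/64*p^4 - 3*x*p*q*y,
      3*p*z - 3*p^2*x - 8/3*y^3 + 9/8*p^3,
      -(-3*q*z + 9/8*p^2*q - 6*p*y^2 + q^2*y + 8*x*y^2)],
    ![-(9/4*p - 3/2*x),
      -(1/2*y),
      -(9/8*p^2),
      -(3/2*p),
      1/2*q],
    ![c*x, c*y, c*(2*z), c*p, c*q]]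

/-- The vector fields `S¹, L², S³, L⁴, S⁵, L⁶, S⁷, L⁸, S⁹, L¹⁰, S¹¹, L¹², h₁, h₂` of the contact
structure of the second solution, as the coefficients of `∂_x, ∂_y, ∂_z, ∂_p, ∂_q`. -/
def contactFieldCoeff₂ {𝕜 : Type*} [RCLike 𝕜] (x y z p q : 𝕜) : Fin 14 → Fin 5 → 𝕜 :=
  let c : 𝕜 := ((√3 / 2 : ℝ) : 𝕜)
  ![![-(3/16*q^2 + 3/2*x*y + 9/8*p*y),
      -(3/8*p*q + 1/2*y^2 + 1/2*q*x),
      -(9/16*p^2*y + 1/4*q^2*x + 3/8*q^2*p + 3/2*y*z),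
      1/4*q^2,
      -3/2*z + 3/2*p*x - 1/2*q*y + 9/16*p^2],
    ![-(9/4*p*x + 27/32*p^2 - 3/4*z + x^2 + 3/4*q*y),
      -(3/4*p*y + x*y),
      -(9/8*p^2*x + 9/16*p^3 + x*z + 3/4*p*q*y + 2/3*y^3),
      -(z - p*x - q*y - 3/8*p^2),
      -2*y^2],
    ![-(3/8*q),
      -(3/8*p + 1/2*x),
      -(3/8*p*q + y^2),
      1/2*q,
      -2*y],
    ![-3/4, 0, x, 1, 0],
    ![0, 0, y, 0, 1],
    ![0, 0, 1, 0, 0],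
    ![0, 1, 0, 0, 0],
    ![1, 0, 0, 0, 0],
    ![3*y,
      q,
      1/2*q^2,
      0,
      -3*p],
    ![3*z + 27/8*p^2,
      1/2*q^2,
      9/4*p^3 + 1/3*q^3,
      -3*p^2,
      -3*p*q],
    ![-6*y^2 + 9/4*q*p,
      3*z + 9/8*p^2 - 4*q*y,
      9/4*p^2*q - 2*y*q^2,
      -3*p*q,
      12*p*y - q^2],
    ![-(3*z*x + 1/8*q^3 + 9/4*p*q*y - 2*y^3 + 27/8*p^2*x + 27/16*p^3),
      -(3*y*z + 1/2*q^2*x + 3/8*p*q^2 - 2*q*y^2 + 9/8*p^2*y),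
      -(9/4*p^3*x + 1/3*x*q^3 + 3*z^2 + 3/8*q^3*p - q^2*y^2 + 9/4*q*y*p^2 + 81/64*p^4),
      -3*p*z + 3*p^2*x + 3*p*q*y + 1/6*q^3 + 9/8*p^3,
      -3*q*z + 3*p*q*x + 9/8*p^2*q - 6*p*y^2 + q^2*y],
    ![9/4*p + 3/2*x,
      1/2*y,
      9/8*p^2,
      -(3/2*p),
      -(1/2*q)],
    ![c*x, c*y, c*(2*z), c*p, c*q]]

/-- The fourteen vector fields of the `k`-th contact structure, as functions of the point
`u = (x, y, z, p, q)`. -/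
def contactFieldFun (𝕜 : Type*) [RCLike 𝕜] (k : Fin 2) (i : Fin 14) (u : Fin 5 → 𝕜) : Fin 5 → 𝕜 :=
  ![contactFieldCoeff₁ (u 0) (u 1) (u 2) (u 3) (u 4) i,
    contactFieldCoeff₂ (u 0) (u 1) (u 2) (u 3) (u 4) i] k

theorem contDiff_vecCons {𝕜 : Type*} [RCLike 𝕜] {E G : Type*} [NormedAddCommGroup E]
    [NormedSpace 𝕜 E] [NormedAddCommGroup G] [NormedSpace 𝕜 G] {n : ℕ} {f : E → G}
    {g : E → Fin n → G} (hf : ContDiff 𝕜 ∞ f) (hg : ∀ i, ContDiff 𝕜 ∞ fun u => g u i) :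
    ∀ i, ContDiff 𝕜 ∞ fun u => Matrix.vecCons (f u) (g u) i :=
  Fin.cases hf hg

theorem contDiff_contactFieldCoeff₁ (𝕜 : Type*) [RCLike 𝕜] : ∀ i, ContDiff 𝕜 ∞
    fun u : Fin 5 → 𝕜 => contactFieldCoeff₁ (u 0) (u 1) (u 2) (u 3) (u 4) i := by
  dsimp only [contactFieldCoeff₁]
  iterate 14
    refine contDiff_vecCons (contDiff_pi.2 ?_) ?_
    · iterate 5 refine contDiff_vecCons (by fun_prop) ?_
      exact fun i => i.elim0
  exact fun i => i.elim0

theorem contDiff_contactFieldCoeff₂ (𝕜 : Type*) [RCLike 𝕜] : ∀ i, ContDiff 𝕜 ∞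
    fun u : Fin 5 → 𝕜 => contactFieldCoeff₂ (u 0) (u 1) (u 2) (u 3) (u 4) i := by
  dsimp only [contactFieldCoeff₂]
  iterate 14
    refine contDiff_vecCons (contDiff_pi.2 ?_) ?_
    · iterate 5 refine contDiff_vecCons (by fun_prop) ?_
      exact fun i => i.elim0
  exact fun i => i.elim0

theorem contDiff_contactFieldFun (𝕜 : Type*) [RCLike 𝕜] (k : Fin 2) (i : Fin 14) :
    ContDiff 𝕜 ∞ (contactFieldFun 𝕜 k i) :=
  contDiff_vecCons (contDiff_contactFieldCoeff₁ 𝕜 i)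
    (contDiff_vecCons (contDiff_contactFieldCoeff₂ 𝕜 i) fun j => j.elim0) k

/-- The fourteen vector fields of the `k`-th contact structure, on the contact manifold `J` with
coordinates `(x, y, z, p, q)`. -/
def contactField (𝕜 : Type*) [RCLike 𝕜] (k : Fin 2) (i : Fin 14) :
    SmoothVF 𝕜 (⊤ : Opens (Fin 5 → 𝕜)) :=
  SmoothVF.ofContDiff (contactFieldFun 𝕜 k i) (contDiff_contactFieldFun 𝕜 k i)

/-- The Lie algebra of vector fields generated by the fourteen vector fields. -/
def contactAlgebra (𝕜 : Type*) [RCLike 𝕜] (k : Fin 2) :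
    LieSubalgebra 𝕜 (SmoothVF 𝕜 (⊤ : Opens (Fin 5 → 𝕜))) :=
  LieSubalgebra.lieSpan 𝕜 _ (range (contactField 𝕜 k))

/-- The distribution `D̃₂` on the space with coordinates `u = (x, y, z, p, q, t)`. The rows are the
coefficients of `dx, dy, dz, dp, dq, dt` in the forms
`ϖ = dz - p dx - q dy`, `ω₂ = dp + p₁₁ dx + p₁₂ dy`, `ω₃ = dq + p₁₂ dx + p₂₂ dy`,
`ω₄ = dy - t dx`, where `p₁₁ = t² H_t - 2 t H + 2 F`, `p₁₂ = H - t H_t`, `p₂₂ = H_t`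
and `F = ∫ H dt`. -/
def contactSystem {𝕜 : Type*} [RCLike 𝕜] (H F : 𝕜 → 𝕜) (u : Fin 6 → 𝕜) :
    Submodule 𝕜 (Fin 6 → 𝕜) :=
  let p := u 3
  let q := u 4
  let t := u 5
  let p₁₁ := t ^ 2 * deriv H t - 2 * t * H t + 2 * F t
  let p₁₂ := H t - t * deriv H t
  let p₂₂ := deriv H t
  LinearMap.ker (Matrix.mulVecLin
    !![ -p,  -q, 1, 0, 0, 0;
       p₁₁, p₁₂, 0, 1, 0, 0;
       p₁₂, p₂₂, 0, 0, 1, 0;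
        -t,   1, 0, 0, 0, 0])

/-- The points `(x, y, z, p, q, t)` with `t ∈ T`. -/
def contactDomain {𝕜 : Type*} [RCLike 𝕜] (T : Opens 𝕜) : Opens (Fin 6 → 𝕜) :=
  ⟨{u | u 5 ∈ T}, T.isOpen.preimage (continuous_apply 5)⟩

/-! ### The side `(X, Y, Z, P, Q, L)` of the (2,3,5)-distribution -/

/-- `H` as a function of `X`, where `t = -X/2`. -/
def inX {𝕜 : Type*} [RCLike 𝕜] (H : 𝕜 → 𝕜) (X : 𝕜) : 𝕜 := H (-X / 2)

/-- The distribution `D₁` given by `dY - P dX`, `dP - Q dX`, `dZ - (Q² / H_XX) dX` at the point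
`m = (X, Y, Z, P, Q)`. The rows are the coefficients of `dX, dY, dZ, dP, dQ`. -/
def distribution235 {𝕜 : Type*} [RCLike 𝕜] (H : 𝕜 → 𝕜) (m : Fin 5 → 𝕜) :
    Submodule 𝕜 (Fin 5 → 𝕜) :=
  let X := m 0
  let P := m 3
  let Q := m 4
  LinearMap.ker (Matrix.mulVecLin
    !![-P, 1, 0, 0, 0;
       -Q, 0, 0, 1, 0;
       -(Q ^ 2 / deriv (deriv (inX H)) X), 0, 1, 0, 0])

/-- The distribution `D̃₁` given by the same three forms together with `dQ - L dX` at the point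
`w = (X, Y, Z, P, Q, L)`. The rows are the coefficients of `dX, dY, dZ, dP, dQ, dL`. -/
def prolongedDistribution235 {𝕜 : Type*} [RCLike 𝕜] (H : 𝕜 → 𝕜) (w : Fin 6 → 𝕜) :
    Submodule 𝕜 (Fin 6 → 𝕜) :=
  let X := w 0
  let P := w 3
  let Q := w 4
  let L := w 5
  LinearMap.ker (Matrix.mulVecLin
    !![-P, 1, 0, 0, 0, 0;
       -Q, 0, 0, 1, 0, 0;
       -(Q ^ 2 / deriv (deriv (inX H)) X), 0, 1, 0, 0, 0;
       -L, 0, 0, 0, 1, 0])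

/-- The points `(X, Y, Z, P, Q)` with `-X/2 ∈ T`. -/
def domain235 {𝕜 : Type*} [RCLike 𝕜] (T : Opens 𝕜) : Opens (Fin 5 → 𝕜) :=
  ⟨{m | -(m 0) / 2 ∈ T}, T.isOpen.preimage (by fun_prop)⟩

/-- The points `(X, Y, Z, P, Q, L)` with `-X/2 ∈ T`. -/
def prolongedDomain235 {𝕜 : Type*} [RCLike 𝕜] (T : Opens 𝕜) : Opens (Fin 6 → 𝕜) :=
  ⟨{w | -(w 0) / 2 ∈ T}, T.isOpen.preimage (by fun_prop)⟩

/-! ### The double fibration -/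

/-- The coordinate change `(x, y, z, p, q, t) ↦ (X, Y, Z, P, Q, L)`, with `F = ∫ H dt`. -/
def doubleFibrationMap {𝕜 : Type*} [RCLike 𝕜] (H F : 𝕜 → 𝕜) (u : Fin 6 → 𝕜) : Fin 6 → 𝕜 :=
  let x := u 0
  let y := u 1
  let z := u 2
  let p := u 3
  let q := u 4
  let t := u 5
  let H₀ := H t
  let H₁ := deriv H t
  let H₂ := deriv (deriv H) t
  let H₃ := deriv (deriv (deriv H)) t
  ![-2 * t,
    p + t * q + (2 * F t - t * H₀) * x + H₀ * y,
    z - p * x - q * y - (1 / 2 * t ^ 2 * H₁ - t * H₀ + F t) * x ^ 2 - (H₀ - t * H₁) * x * y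
      - 1 / 2 * H₁ * y ^ 2,
    -(1 / 2) * q - 1 / 2 * (H₀ - t * H₁) * x - 1 / 2 * H₁ * y,
    1 / 4 * H₂ * (y - t * x),
    1 / 8 * (H₃ * (t * x - y) + H₂ * x)]

/-- Forgetting the last (fibre) coordinate: `(x, y, z, p, q, t) ↦ (x, y, z, p, q)`, which is the
projection `π₂`, and `(X, Y, Z, P, Q, L) ↦ (X, Y, Z, P, Q)`, which is the projection `π₁`. -/
def forgetFibre {𝕜 : Type*} (u : Fin 6 → 𝕜) : Fin 5 → 𝕜 := fun i => u i.castSucc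

/-- The vector field `ζ` on `U ⊆ 𝕜⁶` is a prolongation of the vector field `V` on `U' ⊆ 𝕜⁵`: it is
an infinitesimal symmetry of the distribution `D` on `U`, and it projects to `V`. -/
def IsProlongation {𝕜 : Type*} [RCLike 𝕜] (D : (Fin 6 → 𝕜) → Submodule 𝕜 (Fin 6 → 𝕜))
    {U : Opens (Fin 6 → 𝕜)} {U' : Opens (Fin 5 → 𝕜)} (V : SmoothVF 𝕜 U') (ζ : SmoothVF 𝕜 U) :
    Prop :=
  ζ ∈ symmetryAlgebra D U ∧ ∀ u ∈ U, forgetFibre (ζ.1 u) = V.1 (forgetFibre u)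

end

/-! The space R_T fibres over J by forgetting t and over M_T by (X, Y, Z, P, Q). The distribution
D̃₂ is spanned by ∂_t and `lineField`, which are tangent to the fibres of these two projections. The
map Φ sends `lineField` to (H_tt / 8) ∂_L and ∂_t to -2 times the prolonged total derivative plus a
multiple of ∂_L. As H_tt does not vanish, Φ carries D̃₂ onto D̃₁, and its inverse comes from a
triangular system of equations.

The integral curves of `lineField` project to J as integral curves of horizontal fields with
constant coefficients `lineDirection`, namely (1, t, tH - 2F, -H). After multiplication by r³ + 2,
respectively 1 + 2r³, these directions run through a twisted cubic in r, and in its frame dϖ is a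
multiple of the invariant symplectic form on binary cubics (`isCubicBranch_first`,
`isCubicBranch_second`, `isCubicFrame_nothFrame`). This is the flat contact model of G₂.

Existence of symmetries: a contact field with suitable affine behaviour along the lines
(`IsLineCompatible`) lifts to a symmetry of D̃₂. Its image under Φ is a symmetry of D̃₁ which is
constant along the fibres over M_T and descends to a symmetry of D₁
(`IsTransform.exists_of_isLineCompatible`). For the fourteen fields the conditions are polynomial
identities along the cubic. The correspondence `IsTransform` is linear, compatible with brackets,
and each side determines the other.

Upper bound: for a symmetry V of D₁ the value of ϖ on its lift can be written in terms of V alone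
(`transformedGenerator`). It does not depend on t, so by connectedness of T it is a function f on J.
It is affine along every line, hence killed by the squares of all derivations along the cubic. The
seven coefficients in r give a linear system over the Heisenberg algebra which closes up, and f is
determined by fourteen derivatives at the origin (`eq_zero_of_heisenberg_jet`). Hence there are at
most fourteen independent symmetries. Since the fourteen fields are independent and transformable,
they account for all of them, and their span is closed under the bracket because the symmetries are
(`exists_lieEquiv_of_isTransform`).

Type: brackets of contact fields reduce to Lagrange brackets of generating functions, which give the
Serre relations for the simple root vectors S³ (short) and L¹⁰ (long). The algebra presented by
these relations is spanned by fourteen words (`IsG2System.span_g2Words_eq_top`), and their images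
are independent. -/

noncomputable section

/-! ### Related vector fields and symmetries of a framed rank-two distribution. -/

section General

variable {𝕜 : Type*} [RCLike 𝕜] {E : Type*} [NormedAddCommGroup E] [NormedSpace 𝕜 E]
  {G : Type*} [NormedAddCommGroup G] [NormedSpace 𝕜 G]

/-- The Lie bracket is natural for `f`-related vector fields. -/
theorem fderiv_apply_lieBracket_of_related {f : E → G} {V W : E → E} {V' W' : G → G} {x : E}
    (hf : ContDiffAt 𝕜 ∞ f x) (hV : DifferentiableAt 𝕜 V x) (hW : DifferentiableAt 𝕜 W x)
    (hV' : DifferentiableAt 𝕜 V' (f x)) (hW' : DifferentiableAt 𝕜 W' (f x))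
    (rV : ∀ᶠ y in nhds x, fderiv 𝕜 f y (V y) = V' (f y))
    (rW : ∀ᶠ y in nhds x, fderiv 𝕜 f y (W y) = W' (f y)) :
    fderiv 𝕜 f x (VectorField.lieBracket 𝕜 V W x) = VectorField.lieBracket 𝕜 V' W' (f x) := by
  have hfd : DifferentiableAt 𝕜 f x := hf.differentiableAt (by simp)
  rw [VectorField.fderiv_apply_lieBracket hf
    (by rw [minSmoothness_of_isRCLikeNormedField]; exact ENat.LEInfty.out) hW hV,
    Filter.EventuallyEq.fderiv_eq (f := W' ∘ f) rW,
    Filter.EventuallyEq.fderiv_eq (f := V' ∘ f) rV,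
    fderiv_comp _ hW' hfd, fderiv_comp _ hV' hfd]
  simp [VectorField.lieBracket, rV.self_of_nhds, rW.self_of_nhds]

/-- The vector fields `V` and `V'` are `f`-related. -/
def SmoothVF.Related {U : Opens E} {U' : Opens G} (f : E → G) (V : SmoothVF 𝕜 U)
    (V' : SmoothVF 𝕜 U') : Prop :=
  ∀ u ∈ U, fderiv 𝕜 f u (V.1 u) = V'.1 (f u)

theorem SmoothVF.Related.lie {U : Opens E} {U' : Opens G} {f : E → G} {V W : SmoothVF 𝕜 U}
    {V' W' : SmoothVF 𝕜 U'} (hf : ContDiffOn 𝕜 ∞ f U) (hm : MapsTo f U U')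
    (hV : SmoothVF.Related f V V') (hW : SmoothVF.Related f W W') :
    SmoothVF.Related f ⁅V, W⁆ ⁅V', W'⁆ := by
  intro u hu
  rw [SmoothVF.bracket_apply _ _ hu, SmoothVF.bracket_apply _ _ (hm hu)]
  have hU := U.isOpen.mem_nhds hu
  refine fderiv_apply_lieBracket_of_related (hf.contDiffAt hU) (SmoothVF.differentiableAt V hu)
    (SmoothVF.differentiableAt W hu) (SmoothVF.differentiableAt V' (hm hu)) (SmoothVF.differentiableAt W' (hm hu)) ?_ ?_
  · filter_upwards [hU] with y hy using hV y hy
  · filter_upwards [hU] with y hy using hW y hy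

theorem SmoothVF.Related.add {U : Opens E} {U' : Opens G} {f : E → G} {V W : SmoothVF 𝕜 U}
    {V' W' : SmoothVF 𝕜 U'} (hV : SmoothVF.Related f V V') (hW : SmoothVF.Related f W W') :
    SmoothVF.Related f (V + W) (V' + W') := fun u hu => by
  change fderiv 𝕜 f u (V.1 u + W.1 u) = V'.1 (f u) + W'.1 (f u)
  rw [map_add, hV u hu, hW u hu]

theorem SmoothVF.Related.smul {U : Opens E} {U' : Opens G} {f : E → G} {V : SmoothVF 𝕜 U}
    {V' : SmoothVF 𝕜 U'} (c : 𝕜) (hV : SmoothVF.Related f V V') :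
    SmoothVF.Related f (c • V) (c • V') := fun u hu => by
  change fderiv 𝕜 f u (c • V.1 u) = c • V'.1 (f u)
  rw [map_smul, hV u hu]

open Classical in
/-- A vector field which is smooth on `U`, as an element of `SmoothVF 𝕜 U`. -/
def SmoothVF.ofContDiffOn {U : Opens E} (V : E → E) (hV : ContDiffOn 𝕜 ∞ V U) : SmoothVF 𝕜 U :=
  ⟨fun x => if x ∈ U then V x else 0, hV.congr fun _ hx => if_pos hx, fun _ hx => if_neg hx⟩

theorem SmoothVF.ofContDiffOn_apply {U : Opens E} {V : E → E} (hV : ContDiffOn 𝕜 ∞ V U) {x : E}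
    (hx : x ∈ U) : (SmoothVF.ofContDiffOn V hV).1 x = V x := if_pos hx

theorem SmoothVF.ofContDiffOn_eventuallyEq {U : Opens E} {V : E → E} (hV : ContDiffOn 𝕜 ∞ V U)
    {x : E} (hx : x ∈ U) : (SmoothVF.ofContDiffOn V hV).1 =ᶠ[nhds x] V := by
  filter_upwards [U.isOpen.mem_nhds hx] with y hy using SmoothVF.ofContDiffOn_apply hV hy

/-- For a rank-two distribution with a smooth frame `A`, `B` whose dual coframe is constant, a
vector field is a symmetry iff its brackets with `A` and `B` are sections. -/
theorem mem_symmetryAlgebra_iff_frame {D : E → Submodule 𝕜 E} {U : Opens E} {A B : E → E}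
    (hA : ContDiffOn 𝕜 ∞ A U) (hB : ContDiffOn 𝕜 ∞ B U) (α β : E →L[𝕜] 𝕜)
    (hD : ∀ u ∈ U, ∀ w, w ∈ D u ↔ w = α w • A u + β w • B u)
    (hAm : ∀ u ∈ U, A u ∈ D u) (hBm : ∀ u ∈ U, B u ∈ D u) (V : SmoothVF 𝕜 U) :
    V ∈ symmetryAlgebra D U ↔ ∀ u ∈ U, VectorField.lieBracket 𝕜 V.1 A u ∈ D u ∧
      VectorField.lieBracket 𝕜 V.1 B u ∈ D u := by
  constructor
  · intro hV u hu
    have key : ∀ (C : E → E) (hC : ContDiffOn 𝕜 ∞ C U), (∀ u ∈ U, C u ∈ D u) →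
        VectorField.lieBracket 𝕜 V.1 C u ∈ D u := by
      intro C hC hCm
      have h := hV (SmoothVF.ofContDiffOn C hC) (fun x hx => by
        rw [SmoothVF.ofContDiffOn_apply hC hx]; exact hCm x hx) u hu
      rwa [SmoothVF.bracket_apply _ _ hu,
        (Filter.EventuallyEq.refl _ V.1).lieBracket_vectorField_eq
          (SmoothVF.ofContDiffOn_eventuallyEq hC hu)] at h
    exact ⟨key A hA hAm, key B hB hBm⟩
  · intro h W hW u hu
    have hU := U.isOpen.mem_nhds hu
    -- The frame coefficients of W are constant functionals applied to W, so they are as smooth as W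
    -- and the Leibniz rule applies.
    have hWe : W.1 =ᶠ[nhds u] (fun x => α (W.1 x) • A x) + (fun x => β (W.1 x) • B x) := by
      filter_upwards [hU] with y hy using (hD y hy _).1 (hW y hy)
    have dA : DifferentiableAt 𝕜 A u := (hA.contDiffAt hU).differentiableAt (by simp)
    have dB : DifferentiableAt 𝕜 B u := (hB.contDiffAt hU).differentiableAt (by simp)
    have dW := SmoothVF.differentiableAt W hu
    have dα : DifferentiableAt 𝕜 (fun x => α (W.1 x)) u := α.differentiableAt.comp u dW
    have dβ : DifferentiableAt 𝕜 (fun x => β (W.1 x)) u := β.differentiableAt.comp u dW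
    rw [SmoothVF.bracket_apply _ _ hu,
      (Filter.EventuallyEq.refl _ V.1).lieBracket_vectorField_eq hWe,
      VectorField.lieBracket_add_right (dα.fun_smul dA) (dβ.fun_smul dB),
      VectorField.lieBracket_smul_right dα dA, VectorField.lieBracket_smul_right dβ dB]
    exact add_mem (add_mem (Submodule.smul_mem _ _ (hAm u hu)) (Submodule.smul_mem _ _ (h u hu).1))
      (add_mem (Submodule.smul_mem _ _ (hBm u hu)) (Submodule.smul_mem _ _ (h u hu).2))

/-- The derivative of a map into a coordinate space, computed along lines. -/
theorem fderiv_apply_eq_of_hasDerivAt {n : ℕ} {f : E → Fin n → 𝕜} {u v : E} {c : Fin n → 𝕜}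
    (hf : DifferentiableAt 𝕜 f u)
    (h : ∀ i, HasDerivAt (fun s : 𝕜 => f (u + s • v) i) (c i) 0) : fderiv 𝕜 f u v = c := by
  have h1 : HasDerivAt (fun s : 𝕜 => f (u + s • v)) c 0 := hasDerivAt_pi.2 h
  have h2 : HasLineDerivAt 𝕜 f c u v := h1
  rw [← hf.lineDeriv_eq_fderiv, h2.lineDeriv]

end General

end

noncomputable section

/-! ### Smoothness and derivative of the double fibration transform. -/

section Transform

variable {𝕜 : Type*} [RCLike 𝕜]

/-- The conditions on `H` and `F = ∫ H dt` under which the double fibration transform is a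
coordinate change. -/
structure IsAdmissible (T : Opens 𝕜) (H F : 𝕜 → 𝕜) : Prop where
  contDiffOn : ContDiffOn 𝕜 ∞ H T
  hasDerivAt : ∀ t ∈ T, HasDerivAt F (H t) t
  ne_zero : ∀ t ∈ T, deriv (deriv H) t ≠ 0

namespace IsAdmissible

variable {T : Opens 𝕜} {H F : 𝕜 → 𝕜}

theorem contDiffOn_deriv (h : IsAdmissible T H F) : ContDiffOn 𝕜 ∞ (deriv H) T :=
  ((contDiffOn_infty_iff_deriv_of_isOpen T.isOpen).1 h.contDiffOn).2

theorem contDiffOn_deriv₂ (h : IsAdmissible T H F) : ContDiffOn 𝕜 ∞ (deriv (deriv H)) T :=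
  ((contDiffOn_infty_iff_deriv_of_isOpen T.isOpen).1 h.contDiffOn_deriv).2

theorem contDiffOn_deriv₃ (h : IsAdmissible T H F) :
    ContDiffOn 𝕜 ∞ (deriv (deriv (deriv H))) T :=
  ((contDiffOn_infty_iff_deriv_of_isOpen T.isOpen).1 h.contDiffOn_deriv₂).2

theorem contDiffOn_primitive (h : IsAdmissible T H F) : ContDiffOn 𝕜 ∞ F T := by
  refine (contDiffOn_infty_iff_deriv_of_isOpen T.isOpen).2 ⟨fun t ht =>
    (h.hasDerivAt t ht).differentiableAt.differentiableWithinAt, ?_⟩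
  exact h.contDiffOn.congr fun t ht => (h.hasDerivAt t ht).deriv

theorem hasDerivAt_of_contDiffOn {G : 𝕜 → 𝕜} (hG : ContDiffOn 𝕜 ∞ G T) {t : 𝕜} (ht : t ∈ T) :
    HasDerivAt G (deriv G t) t :=
  ((hG.contDiffAt (T.isOpen.mem_nhds ht)).differentiableAt (by simp)).hasDerivAt

end IsAdmissible

theorem contDiffOn_comp_coord {T : Opens 𝕜} {G : 𝕜 → 𝕜} (hG : ContDiffOn 𝕜 ∞ G T) :
    ContDiffOn 𝕜 ∞ (fun u : Fin 6 → 𝕜 => G (u 5)) (contactDomain T) :=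
  hG.comp (t := (T : Set 𝕜)) (contDiff_apply 𝕜 𝕜 5).contDiffOn fun _ hu => hu

theorem contDiffOn_doubleFibrationMap {T : Opens 𝕜} {H F : 𝕜 → 𝕜} (h : IsAdmissible T H F) :
    ContDiffOn 𝕜 ∞ (doubleFibrationMap H F) (contactDomain T) := by
  have h0 := contDiffOn_comp_coord h.contDiffOn
  have h1 := contDiffOn_comp_coord h.contDiffOn_deriv
  have h2 := contDiffOn_comp_coord h.contDiffOn_deriv₂
  have h3 := contDiffOn_comp_coord h.contDiffOn_deriv₃
  have hF := contDiffOn_comp_coord h.contDiffOn_primitive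
  unfold doubleFibrationMap
  -- The coefficients depending on t become opaque functions of known smoothness, so that `fun_prop`
  -- only meets polynomials in them.
  obtain ⟨g0, e0⟩ : ∃ g : (Fin 6 → 𝕜) → 𝕜, ∀ u, H (u 5) = g u := ⟨_, fun _ => rfl⟩
  obtain ⟨g1, e1⟩ : ∃ g : (Fin 6 → 𝕜) → 𝕜, ∀ u, deriv H (u 5) = g u := ⟨_, fun _ => rfl⟩
  obtain ⟨g2, e2⟩ : ∃ g : (Fin 6 → 𝕜) → 𝕜, ∀ u, deriv (deriv H) (u 5) = g u :=
    ⟨_, fun _ => rfl⟩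
  obtain ⟨g3, e3⟩ : ∃ g : (Fin 6 → 𝕜) → 𝕜, ∀ u, deriv (deriv (deriv H)) (u 5) = g u :=
    ⟨_, fun _ => rfl⟩
  obtain ⟨gF, eF⟩ : ∃ g : (Fin 6 → 𝕜) → 𝕜, ∀ u, F (u 5) = g u := ⟨_, fun _ => rfl⟩
  simp only [e0, e1, e2, e3, eF] at *
  rw [contDiffOn_pi]
  intro i
  fin_cases i <;> simp <;> fun_prop

theorem hasDerivAt_line {n : ℕ} (u v : Fin n → 𝕜) (i : Fin n) :
    HasDerivAt (fun s : 𝕜 => u i + s * v i) (v i) 0 := by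
  simpa using ((hasDerivAt_id (0 : 𝕜)).mul_const (v i)).const_add (u i)

theorem hasDerivAt_comp_line {n : ℕ} {G : 𝕜 → 𝕜} {g : 𝕜} (u v : Fin n → 𝕜) (i : Fin n)
    (hG : HasDerivAt G g (u i)) :
    HasDerivAt (fun s : 𝕜 => G (u i + s * v i)) (g * v i) 0 := by
  have h : HasDerivAt G g (u i + 0 * v i) := by simpa using hG
  exact h.comp (0 : 𝕜) (hasDerivAt_line u v i)

/-- Because F_t = H, the t-derivatives collapse: that of Y is -2P, and that of Z is a perfect square
times H_tt, equal to -2Q²/H_XX. -/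
theorem fderiv_doubleFibrationMap {T : Opens 𝕜} {H F : 𝕜 → 𝕜} (h : IsAdmissible T H F)
    {u : Fin 6 → 𝕜} (hu : u 5 ∈ T) (v : Fin 6 → 𝕜) :
    fderiv 𝕜 (doubleFibrationMap H F) u v =
      ![-2 * v 5,
        v 3 + u 5 * v 4 + (2 * F (u 5) - u 5 * H (u 5)) * v 0 + H (u 5) * v 1 +
          (u 4 + (H (u 5) - u 5 * deriv H (u 5)) * u 0 + deriv H (u 5) * u 1) * v 5,
        v 2 - u 3 * v 0 - u 4 * v 1 - u 0 * v 3 - u 1 * v 4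
          - 2 * (1 / 2 * u 5 ^ 2 * deriv H (u 5) - u 5 * H (u 5) + F (u 5)) * u 0 * v 0
          - (H (u 5) - u 5 * deriv H (u 5)) * (u 0 * v 1 + u 1 * v 0)
          - deriv H (u 5) * u 1 * v 1
          - 1 / 2 * deriv (deriv H) (u 5) * (u 5 * u 0 - u 1) ^ 2 * v 5,
        -(1 / 2) * v 4 - 1 / 2 * (H (u 5) - u 5 * deriv H (u 5)) * v 0 -
          1 / 2 * deriv H (u 5) * v 1 +
          1 / 2 * deriv (deriv H) (u 5) * (u 5 * u 0 - u 1) * v 5,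
        1 / 4 * deriv (deriv H) (u 5) * (v 1 - u 5 * v 0) +
          (1 / 4 * deriv (deriv (deriv H)) (u 5) * (u 1 - u 5 * u 0) -
            1 / 4 * deriv (deriv H) (u 5) * u 0) * v 5,
        1 / 8 * (deriv (deriv (deriv H)) (u 5) * (u 5 * v 0 - v 1) +
            deriv (deriv H) (u 5) * v 0) +
          1 / 8 * (deriv (deriv (deriv (deriv H))) (u 5) * (u 5 * u 0 - u 1) +
            2 * deriv (deriv (deriv H)) (u 5) * u 0) * v 5] := by
  have dF := hasDerivAt_comp_line u v 5 (h.hasDerivAt _ hu)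
  have d0 := hasDerivAt_comp_line u v 5
    (IsAdmissible.hasDerivAt_of_contDiffOn h.contDiffOn hu)
  have d1 := hasDerivAt_comp_line u v 5
    (IsAdmissible.hasDerivAt_of_contDiffOn h.contDiffOn_deriv hu)
  have d2 := hasDerivAt_comp_line u v 5
    (IsAdmissible.hasDerivAt_of_contDiffOn h.contDiffOn_deriv₂ hu)
  have d3 := hasDerivAt_comp_line u v 5
    (IsAdmissible.hasDerivAt_of_contDiffOn h.contDiffOn_deriv₃ hu)
  have c := hasDerivAt_line u v
  refine fderiv_apply_eq_of_hasDerivAt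
    (((contDiffOn_doubleFibrationMap h).contDiffAt
      ((contactDomain T).isOpen.mem_nhds hu)).differentiableAt (by simp)) ?_
  intro i
  fin_cases i
  · exact (c 5).const_mul (-2)
  · refine HasDerivAt.congr_deriv ((((c 3).fun_add ((c 5).fun_mul (c 4))).fun_add
      (((dF.const_mul 2).fun_sub ((c 5).fun_mul d0)).fun_mul (c 0))).fun_add
      (d0.fun_mul (c 1))) ?_
    simp
    ring
  · refine HasDerivAt.congr_deriv ((((((c 2).fun_sub ((c 3).fun_mul (c 0))).fun_sub
      ((c 4).fun_mul (c 1))).fun_sub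
      ((((((c 5).fun_pow 2).const_mul (1 / 2)).fun_mul d1).fun_sub ((c 5).fun_mul d0)).fun_add
        dF |>.fun_mul ((c 0).fun_pow 2))).fun_sub
      (((d0.fun_sub ((c 5).fun_mul d1)).fun_mul (c 0)).fun_mul (c 1))).fun_sub
      ((d1.const_mul (1 / 2)).fun_mul ((c 1).fun_pow 2))) ?_
    simp
    ring
  · refine HasDerivAt.congr_deriv ((((c 4).const_mul (-(1 / 2))).fun_sub
      (((d0.fun_sub ((c 5).fun_mul d1)).const_mul (1 / 2)).fun_mul (c 0))).fun_sub
      ((d1.const_mul (1 / 2)).fun_mul (c 1))) ?_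
    simp
    ring
  · refine HasDerivAt.congr_deriv ((d2.const_mul (1 / 4)).fun_mul
      ((c 1).fun_sub ((c 5).fun_mul (c 0)))) ?_
    simp
    ring
  · refine HasDerivAt.congr_deriv (((d3.fun_mul (((c 5).fun_mul (c 0)).fun_sub (c 1))).fun_add
      (d2.fun_mul (c 0))).const_mul (1 / 8)) ?_
    simp
    ring

end Transform

end

noncomputable section

/-! ### Frames of the three distributions; Φ is a diffeomorphism matching D̃₂ with D̃₁. -/

section Frames

variable {𝕜 : Type*} [RCLike 𝕜]

/-- The generator of `D̃₂` which is tangent to the fibres over the `(2,3,5)` side. -/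
def lineField (H F : 𝕜 → 𝕜) (u : Fin 6 → 𝕜) : Fin 6 → 𝕜 :=
  ![1, u 5, u 3 + u 5 * u 4, u 5 * H (u 5) - 2 * F (u 5), -H (u 5), 0]

/-- The constant vector field along the fibre coordinate of `𝕜⁶`. -/
def fibreField (𝕜 : Type*) [RCLike 𝕜] (_ : Fin 6 → 𝕜) : Fin 6 → 𝕜 := ![0, 0, 0, 0, 0, 1]

/-- The total derivative field `∂_X + P ∂_Y + (Q² / H_XX) ∂_Z + Q ∂_P`. -/
def mongeField (H : 𝕜 → 𝕜) (m : Fin 5 → 𝕜) : Fin 5 → 𝕜 :=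
  ![1, m 3, m 4 ^ 2 / deriv (deriv (inX H)) (m 0), m 4, 0]

/-- The constant vector field `∂_Q`. -/
def topField (𝕜 : Type*) [RCLike 𝕜] (_ : Fin 5 → 𝕜) : Fin 5 → 𝕜 := ![0, 0, 0, 0, 1]

/-- The prolonged total derivative field. -/
def prolongedMongeField (H : 𝕜 → 𝕜) (w : Fin 6 → 𝕜) : Fin 6 → 𝕜 :=
  ![1, w 3, w 4 ^ 2 / deriv (deriv (inX H)) (w 0), w 4, w 5, 0]

theorem mem_contactSystem_iff (H F : 𝕜 → 𝕜) (u w : Fin 6 → 𝕜) :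
    w ∈ contactSystem H F u ↔ w = w 0 • lineField H F u + w 5 • fibreField 𝕜 u := by
  simp only [contactSystem, LinearMap.mem_ker, Matrix.mulVecLin_apply, funext_iff,
    Fin.forall_fin_succ, lineField, fibreField, Matrix.mulVec,
    dotProduct, Fin.sum_univ_six]
  simp
  constructor
  · rintro ⟨h1, h2, h3, h4⟩
    refine ⟨?_, ?_, ?_, ?_⟩
    · linear_combination h4
    · linear_combination h1 + u 4 * h4
    · linear_combination h2 - (H (u 5) - u 5 * deriv H (u 5)) * h4
    · linear_combination h3 - deriv H (u 5) * h4
  · rintro ⟨h1, h2, h3, h4⟩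
    refine ⟨?_, ?_, ?_, ?_⟩
    · linear_combination h2 - u 4 * h1
    · linear_combination h3 + (H (u 5) - u 5 * deriv H (u 5)) * h1
    · linear_combination h4 + deriv H (u 5) * h1
    · linear_combination h1

theorem mem_distribution235_iff (H : 𝕜 → 𝕜) (m w : Fin 5 → 𝕜) :
    w ∈ distribution235 H m ↔ w = w 0 • mongeField H m + w 4 • topField 𝕜 m := by
  simp only [distribution235, LinearMap.mem_ker, Matrix.mulVecLin_apply, funext_iff,
    Fin.forall_fin_succ, mongeField, topField, Matrix.mulVec,
    dotProduct, Fin.sum_univ_five]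
  simp
  constructor
  · rintro ⟨h1, h2, h3⟩
    refine ⟨?_, ?_, ?_⟩
    · linear_combination h1
    · linear_combination h3
    · linear_combination h2
  · rintro ⟨h1, h2, h3⟩
    refine ⟨?_, ?_, ?_⟩
    · linear_combination h1
    · linear_combination h3
    · linear_combination h2

theorem mem_prolongedDistribution235_iff (H : 𝕜 → 𝕜) (m w : Fin 6 → 𝕜) :
    w ∈ prolongedDistribution235 H m ↔
      w = w 0 • prolongedMongeField H m + w 5 • fibreField 𝕜 m := by
  simp only [prolongedDistribution235, LinearMap.mem_ker, Matrix.mulVecLin_apply, funext_iff,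
    Fin.forall_fin_succ, prolongedMongeField, fibreField, Matrix.mulVec,
    dotProduct, Fin.sum_univ_six]
  simp
  constructor
  · rintro ⟨h1, h2, h3, h4⟩
    refine ⟨?_, ?_, ?_, ?_⟩
    · linear_combination h1
    · linear_combination h3
    · linear_combination h2
    · linear_combination h4
  · rintro ⟨h1, h2, h3, h4⟩
    refine ⟨?_, ?_, ?_, ?_⟩
    · linear_combination h1
    · linear_combination h3
    · linear_combination h2
    · linear_combination h4

theorem deriv_inX (H : 𝕜 → 𝕜) : deriv (inX H) = fun X => (-1 / 2) * inX (deriv H) X := by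
  funext X
  have h : inX H = fun X => H ((-1 / 2) * X) := by
    funext X
    simp only [inX]
    congr 1
    ring
  rw [h, deriv_comp_mul_left, smul_eq_mul]
  simp only [inX]
  congr 2
  ring

theorem deriv_deriv_inX (H : 𝕜 → 𝕜) (X : 𝕜) :
    deriv (deriv (inX H)) X = 1 / 4 * deriv (deriv H) (-X / 2) := by
  rw [deriv_inX, deriv_const_mul_field, deriv_inX]
  simp only [inX]
  ring

variable {T : Opens 𝕜} {H F : 𝕜 → 𝕜}

/-- The inverse of the double fibration transform. -/
def doubleFibrationInv (H F : 𝕜 → 𝕜) (w : Fin 6 → 𝕜) : Fin 6 → 𝕜 :=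
  let t := -(w 0) / 2
  let H₀ := H t
  let H₁ := deriv H t
  let H₂ := deriv (deriv H) t
  let H₃ := deriv (deriv (deriv H)) t
  -- The system is triangular: Q gives d = y - t x, then L gives x, and P, Y, Z give q, p, z in
  -- turn.
  let d := 4 * w 4 / H₂
  let x := (8 * w 5 + H₃ * d) / H₂
  let y := d + t * x
  let q := -2 * w 3 - (H₀ - t * H₁) * x - H₁ * y
  let p := w 1 - t * q - (2 * F t - t * H₀) * x - H₀ * y
  ![x, y,
    w 2 + p * x + q * y + (1 / 2 * t ^ 2 * H₁ - t * H₀ + F t) * x ^ 2 + (H₀ - t * H₁) * x * y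
      + 1 / 2 * H₁ * y ^ 2,
    p, q, t]

theorem contDiffOn_doubleFibrationInv (h : IsAdmissible T H F) :
    ContDiffOn 𝕜 ∞ (doubleFibrationInv H F) (prolongedDomain235 T) := by
  have key : ∀ {G : 𝕜 → 𝕜}, ContDiffOn 𝕜 ∞ G T →
      ContDiffOn 𝕜 ∞ (fun w : Fin 6 → 𝕜 => G (-(w 0) / 2)) (prolongedDomain235 T) :=
    fun hG => hG.comp (t := (T : Set 𝕜)) (g := fun t => _)
      (((contDiff_apply 𝕜 𝕜 0).neg.div_const 2).contDiffOn) fun _ hu => hu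
  have h0 := key h.contDiffOn
  have h1 := key h.contDiffOn_deriv
  have h2 := key h.contDiffOn_deriv₂
  have h3 := key h.contDiffOn_deriv₃
  have hF := key h.contDiffOn_primitive
  have hn : ∀ w ∈ prolongedDomain235 T, deriv (deriv H) (-(w 0) / 2) ≠ 0 :=
    fun w hw => h.ne_zero _ hw
  have hi : ContDiffOn 𝕜 ∞ (fun w : Fin 6 → 𝕜 => (deriv (deriv H) (-(w 0) / 2))⁻¹)
    (prolongedDomain235 T) := h2.inv hn
  unfold doubleFibrationInv
  obtain ⟨g0, e0⟩ : ∃ g : (Fin 6 → 𝕜) → 𝕜, ∀ w, H (-(w 0) / 2) = g w := ⟨_, fun _ => rfl⟩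
  obtain ⟨g1, e1⟩ : ∃ g : (Fin 6 → 𝕜) → 𝕜, ∀ w, deriv H (-(w 0) / 2) = g w := ⟨_, fun _ => rfl⟩
  obtain ⟨g2, e2⟩ : ∃ g : (Fin 6 → 𝕜) → 𝕜, ∀ w, (deriv (deriv H) (-(w 0) / 2))⁻¹ = g w :=
    ⟨_, fun _ => rfl⟩
  obtain ⟨g3, e3⟩ : ∃ g : (Fin 6 → 𝕜) → 𝕜, ∀ w, deriv (deriv (deriv H)) (-(w 0) / 2) = g w :=
    ⟨_, fun _ => rfl⟩
  obtain ⟨gF, eF⟩ : ∃ g : (Fin 6 → 𝕜) → 𝕜, ∀ w, F (-(w 0) / 2) = g w := ⟨_, fun _ => rfl⟩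
  clear h2 hn
  simp only [div_eq_mul_inv _ (deriv (deriv H) _), e0, e1, e2, e3, eF] at *
  clear e0 e1 e2 e3 eF key
  have hx : ContDiffOn 𝕜 ∞ (fun w : Fin 6 → 𝕜 => (8 * w 5 + g3 w * (4 * w 4 * g2 w)) * g2 w)
    (prolongedDomain235 T) := by fun_prop
  have hy : ContDiffOn 𝕜 ∞ (fun w : Fin 6 → 𝕜 => 4 * w 4 * g2 w + -(w 0) / 2 *
    ((8 * w 5 + g3 w * (4 * w 4 * g2 w)) * g2 w)) (prolongedDomain235 T) := by fun_prop
  obtain ⟨x, ex⟩ : ∃ g : (Fin 6 → 𝕜) → 𝕜, ∀ w,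
    (8 * w 5 + g3 w * (4 * w 4 * g2 w)) * g2 w = g w := ⟨_, fun _ => rfl⟩
  simp only [ex] at *
  obtain ⟨y, ey⟩ : ∃ g : (Fin 6 → 𝕜) → 𝕜, ∀ w,
    4 * w 4 * g2 w + -(w 0) / 2 * x w = g w := ⟨_, fun _ => rfl⟩
  simp only [ey] at *
  rw [contDiffOn_pi]
  intro i
  fin_cases i <;> simp <;> fun_prop

theorem mapsTo_doubleFibrationMap :
    MapsTo (doubleFibrationMap H F) (contactDomain T) (prolongedDomain235 T) := by
  intro u hu
  change -(-2 * u 5) / 2 ∈ T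
  have ht : -(-2 * u 5) / 2 = u 5 := by ring
  rw [ht]
  exact hu

theorem mapsTo_doubleFibrationInv :
    MapsTo (doubleFibrationInv H F) (prolongedDomain235 T) (contactDomain T) := fun _ hw => hw

theorem doubleFibrationInv_left (h : IsAdmissible T H F) {u : Fin 6 → 𝕜} (hu : u 5 ∈ T) :
    doubleFibrationInv H F (doubleFibrationMap H F u) = u := by
  have h2 := h.ne_zero _ hu
  have ht : -(-2 * u 5) / 2 = u 5 := by ring
  have hd : 4 * (1 / 4 * deriv (deriv H) (u 5) * (u 1 - u 5 * u 0)) / deriv (deriv H) (u 5) =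
      u 1 - u 5 * u 0 := by field_simp
  have hx : (8 * (1 / 8 * (deriv (deriv (deriv H)) (u 5) * (u 5 * u 0 - u 1) +
      deriv (deriv H) (u 5) * u 0)) + deriv (deriv (deriv H)) (u 5) * (u 1 - u 5 * u 0)) /
      deriv (deriv H) (u 5) = u 0 := by field_simp; ring
  funext i
  fin_cases i <;>
    simp only [doubleFibrationInv, doubleFibrationMap, Fin.zero_eta, Fin.mk_one, Fin.reduceFinMk,
      Matrix.cons_val] <;> simp only [ht, hd, hx] <;> ring

theorem doubleFibrationInv_right (h : IsAdmissible T H F) {w : Fin 6 → 𝕜}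
    (hw : w ∈ prolongedDomain235 T) :
    doubleFibrationMap H F (doubleFibrationInv H F w) = w := by
  have h2 := h.ne_zero _ hw
  funext i
  fin_cases i <;>
    simp only [doubleFibrationInv, doubleFibrationMap, Fin.zero_eta, Fin.mk_one, Fin.reduceFinMk,
      Matrix.cons_val]
  · ring
  all_goals
    generalize -(w 0) / 2 = t at h2 ⊢
    field_simp
    ring

theorem fderiv_doubleFibrationMap_lineField (h : IsAdmissible T H F) {u : Fin 6 → 𝕜}
    (hu : u 5 ∈ T) : fderiv 𝕜 (doubleFibrationMap H F) u (lineField H F u) =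
      (1 / 8 * deriv (deriv H) (u 5)) • fibreField 𝕜 (doubleFibrationMap H F u) := by
  rw [fderiv_doubleFibrationMap h hu]
  funext i
  fin_cases i <;> simp [lineField, fibreField] <;> ring

/-- The factor -2 is dX/dt. Divided by it, the t-derivatives of Y, P, Q are P, Q, L; this is what
dictates the formulas for P, Q and L. -/
theorem fderiv_doubleFibrationMap_fibreField (h : IsAdmissible T H F) {u : Fin 6 → 𝕜}
    (hu : u 5 ∈ T) : fderiv 𝕜 (doubleFibrationMap H F) u (fibreField 𝕜 u) =
      (-2 : 𝕜) • prolongedMongeField H (doubleFibrationMap H F u) +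
      (1 / 8 * (deriv (deriv (deriv (deriv H))) (u 5) * (u 5 * u 0 - u 1) +
            2 * deriv (deriv (deriv H)) (u 5) * u 0)) •
        fibreField 𝕜 (doubleFibrationMap H F u) := by
  have h2 := h.ne_zero _ hu
  have ht : -(-2 * u 5) / 2 = u 5 := by ring
  rw [fderiv_doubleFibrationMap h hu]
  simp only [prolongedMongeField, deriv_deriv_inX]
  simp only [doubleFibrationMap, fibreField, Matrix.cons_val, ht]
  funext i
  fin_cases i <;> simp <;> field_simp <;> ring

theorem map_contactSystem (h : IsAdmissible T H F) {u : Fin 6 → 𝕜} (hu : u 5 ∈ T) :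
    (contactSystem H F u).map
        (fderiv 𝕜 (doubleFibrationMap H F) u : (Fin 6 → 𝕜) →ₗ[𝕜] (Fin 6 → 𝕜)) =
      prolongedDistribution235 H (doubleFibrationMap H F u) := by
  have h2 := h.ne_zero _ hu
  have hm : ∀ a b : 𝕜, a • prolongedMongeField H (doubleFibrationMap H F u) +
      b • fibreField 𝕜 (doubleFibrationMap H F u) ∈
      prolongedDistribution235 H (doubleFibrationMap H F u) := fun a b => by
    rw [mem_prolongedDistribution235_iff]
    simp [prolongedMongeField, fibreField]
  ext w
  constructor
  · rintro ⟨v, hv, rfl⟩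
    rw [SetLike.mem_coe, mem_contactSystem_iff] at hv
    rw [hv, ContinuousLinearMap.coe_coe, map_add, map_smul, map_smul,
      fderiv_doubleFibrationMap_lineField h hu, fderiv_doubleFibrationMap_fibreField h hu,
      smul_add, smul_smul, smul_smul, smul_smul, add_left_comm, ← add_smul]
    exact hm _ _
  · intro hw
    rw [mem_prolongedDistribution235_iff] at hw
    set c := 1 / 8 * (deriv (deriv (deriv (deriv H))) (u 5) * (u 5 * u 0 - u 1) +
            2 * deriv (deriv (deriv H)) (u 5) * u 0) with hc
    -- The combination a `lineField` + b ∂_t maps to -2b times the prolonged total derivative plus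
    -- (a H_tt / 8 + b c) ∂_L; the witness solves for a and b.
    refine ⟨(8 * (w 5 + c * w 0 / 2) / deriv (deriv H) (u 5)) • lineField H F u +
      (-(w 0) / 2) • fibreField 𝕜 u, ?_, ?_⟩
    · rw [SetLike.mem_coe, mem_contactSystem_iff]
      simp [lineField, fibreField]
    · rw [ContinuousLinearMap.coe_coe, map_add, map_smul, map_smul,
        fderiv_doubleFibrationMap_lineField h hu, fderiv_doubleFibrationMap_fibreField h hu,
        ← hc, smul_add, smul_smul, smul_smul, smul_smul, add_left_comm, ← add_smul]
      rw [hw]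
      congr 2
      · simp [prolongedMongeField, fibreField]
      · simp [prolongedMongeField, fibreField]
        field_simp
        ring

end Frames

end

noncomputable section

/-! ### Push-forward of vector fields and of symmetries. -/

section Push

variable {𝕜 : Type*} [RCLike 𝕜] {E : Type*} [NormedAddCommGroup E] [NormedSpace 𝕜 E]
  {G : Type*} [NormedAddCommGroup G] [NormedSpace 𝕜 G]

theorem fderiv_apply_coord {n : ℕ} {f : E → Fin n → 𝕜} {u : E} (hf : DifferentiableAt 𝕜 f u)
    (v : E) (i : Fin n) : fderiv 𝕜 f u v i = fderiv 𝕜 (fun x => f x i) u v := by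
  rw [((hasFDerivAt_pi'.1 hf.hasFDerivAt) i).fderiv]
  rfl

/-- The push-forward of a vector field under a diffeomorphism `f` with inverse `g`. -/
def SmoothVF.push {U : Opens E} {U' : Opens G} {f : E → G} {g : G → E}
    (hf : ContDiffOn 𝕜 ∞ f U) (hg : ContDiffOn 𝕜 ∞ g U') (hgm : MapsTo g U' U)
    (V : SmoothVF 𝕜 U) : SmoothVF 𝕜 U' :=
  SmoothVF.ofContDiffOn (fun w => fderiv 𝕜 f (g w) (V.1 (g w))) (by
    have h1 : ContDiffOn 𝕜 ∞ (fderiv 𝕜 f) U :=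
      ((contDiffOn_infty_iff_fderiv_of_isOpen U.isOpen).1 hf).2
    exact (h1.comp hg hgm).clm_apply (V.2.1.comp hg hgm))

theorem SmoothVF.related_push {U : Opens E} {U' : Opens G} {f : E → G} {g : G → E}
    (hf : ContDiffOn 𝕜 ∞ f U) (hg : ContDiffOn 𝕜 ∞ g U') (hfm : MapsTo f U U')
    (hgm : MapsTo g U' U) (hl : LeftInvOn g f U) (V : SmoothVF 𝕜 U) :
    SmoothVF.Related f V (SmoothVF.push hf hg hgm V) := by
  intro u hu
  rw [SmoothVF.push, SmoothVF.ofContDiffOn_apply _ (hfm hu), hl hu]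

theorem fderiv_fderiv_of_invOn {U : Opens E} {U' : Opens G} {f : E → G} {g : G → E}
    (hf : ContDiffOn 𝕜 ∞ f U) (hg : ContDiffOn 𝕜 ∞ g U') (hgm : MapsTo g U' U)
    (hr : RightInvOn g f U') {w : G} (hw : w ∈ U') (v : G) :
    fderiv 𝕜 f (g w) (fderiv 𝕜 g w v) = v := by
  have dg : DifferentiableAt 𝕜 g w :=
    (hg.contDiffAt (U'.isOpen.mem_nhds hw)).differentiableAt (by simp)
  have df : DifferentiableAt 𝕜 f (g w) :=
    (hf.contDiffAt (U.isOpen.mem_nhds (hgm hw))).differentiableAt (by simp)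
  have h : f ∘ g =ᶠ[nhds w] id := by
    filter_upwards [U'.isOpen.mem_nhds hw] with y hy using hr hy
  have h2 := h.fderiv_eq (𝕜 := 𝕜)
  rw [fderiv_comp _ df dg, fderiv_id] at h2
  exact congrArg (fun L : G →L[𝕜] G => L v) h2

/-- Symmetries are carried to symmetries by a diffeomorphism which matches the distributions. -/
theorem SmoothVF.push_mem_symmetryAlgebra {U : Opens E} {U' : Opens G} {f : E → G} {g : G → E}
    {D : E → Submodule 𝕜 E} {D' : G → Submodule 𝕜 G}
    (hf : ContDiffOn 𝕜 ∞ f U) (hg : ContDiffOn 𝕜 ∞ g U') (hfm : MapsTo f U U')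
    (hgm : MapsTo g U' U) (hl : LeftInvOn g f U) (hr : RightInvOn g f U')
    (hD : ∀ u ∈ U, (D u).map (fderiv 𝕜 f u : E →ₗ[𝕜] G) = D' (f u)) {V : SmoothVF 𝕜 U}
    (hV : V ∈ symmetryAlgebra D U) :
    SmoothVF.push hf hg hgm V ∈ symmetryAlgebra D' U' := by
  intro W' hW'
  -- A section W' of D' is pulled back to a section of D, where the symmetry condition on V is
  -- available, and the bracket is pushed forward again.
  set W := SmoothVF.push hg hf hfm W' with hWdef
  have rW : SmoothVF.Related f W W' := by
    intro u hu
    rw [hWdef, SmoothVF.push, SmoothVF.ofContDiffOn_apply _ hu]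
    have := fderiv_fderiv_of_invOn hf hg hgm hr (hfm hu) (W'.1 (f u))
    rwa [hl hu] at this
  have mW : W ∈ smoothSections D U := by
    intro u hu
    have h1 := hW' (f u) (hfm hu)
    rw [← hD u hu] at h1
    obtain ⟨d, hd, hd'⟩ := h1
    have h2 : fderiv 𝕜 g (f u) (fderiv 𝕜 f u d) = d := by
      have := fderiv_fderiv_of_invOn hg hf hfm hl hu d
      exact this
    rw [hWdef, SmoothVF.push, SmoothVF.ofContDiffOn_apply _ hu, ← hd']
    change fderiv 𝕜 g (f u) (fderiv 𝕜 f u d) ∈ D u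
    rw [h2]
    exact hd
  have h := SmoothVF.Related.lie hf hfm (SmoothVF.related_push hf hg hfm hgm hl V) rW
  intro w hw
  have h1 := h (g w) (hgm hw)
  rw [hr hw] at h1
  rw [← h1]
  have h2 := hV W mW (g w) (hgm hw)
  have h3 := hD (g w) (hgm hw)
  rw [hr hw] at h3
  rw [← h3]
  exact ⟨_, h2, rfl⟩

end Push

/-! ### Symmetries in terms of frames; a prolongation is determined by its projection. -/

section Prolongations

variable {𝕜 : Type*} [RCLike 𝕜] {T : Opens 𝕜} {H F : 𝕜 → 𝕜}

theorem contDiffOn_lineField (h : IsAdmissible T H F) :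
    ContDiffOn 𝕜 ∞ (lineField H F) (contactDomain T) := by
  have h0 := contDiffOn_comp_coord h.contDiffOn
  have hF := contDiffOn_comp_coord h.contDiffOn_primitive
  unfold lineField
  obtain ⟨g0, e0⟩ : ∃ g : (Fin 6 → 𝕜) → 𝕜, ∀ u, H (u 5) = g u := ⟨_, fun _ => rfl⟩
  obtain ⟨gF, eF⟩ : ∃ g : (Fin 6 → 𝕜) → 𝕜, ∀ u, F (u 5) = g u := ⟨_, fun _ => rfl⟩
  simp only [e0, eF] at *
  rw [contDiffOn_pi]
  intro i
  fin_cases i <;> simp <;> fun_prop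

theorem fderiv_lineField (h : IsAdmissible T H F) {u : Fin 6 → 𝕜} (hu : u 5 ∈ T)
    (v : Fin 6 → 𝕜) : fderiv 𝕜 (lineField H F) u v =
      ![0, v 5, v 3 + u 5 * v 4 + v 5 * u 4, (u 5 * deriv H (u 5) - H (u 5)) * v 5,
        -deriv H (u 5) * v 5, 0] := by
  have dF := hasDerivAt_comp_line u v 5 (h.hasDerivAt _ hu)
  have d0 := hasDerivAt_comp_line u v 5
    (IsAdmissible.hasDerivAt_of_contDiffOn h.contDiffOn hu)
  have c := hasDerivAt_line u v
  refine fderiv_apply_eq_of_hasDerivAt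
    (((contDiffOn_lineField h).contDiffAt
      ((contactDomain T).isOpen.mem_nhds hu)).differentiableAt (by simp)) ?_
  intro i
  fin_cases i
  · exact hasDerivAt_const _ _
  · exact c 5
  · refine HasDerivAt.congr_deriv ((c 3).fun_add ((c 5).fun_mul (c 4))) ?_
    simp
    ring
  · refine HasDerivAt.congr_deriv (((c 5).fun_mul d0).fun_sub (dF.const_mul 2)) ?_
    simp
    ring
  · refine HasDerivAt.congr_deriv d0.fun_neg ?_
    simp
  · exact hasDerivAt_const _ _

theorem contDiffOn_comp_inX {G : 𝕜 → 𝕜} (hG : ContDiffOn 𝕜 ∞ G T) :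
    ContDiffOn 𝕜 ∞ (inX G) {X | -X / 2 ∈ T} :=
  hG.comp (t := (T : Set 𝕜)) (by fun_prop) fun _ hu => hu

theorem isOpen_inX (T : Opens 𝕜) : IsOpen {X : 𝕜 | -X / 2 ∈ T} :=
  T.isOpen.preimage (by fun_prop)

theorem contDiffOn_inv_inX (h : IsAdmissible T H F) :
    ContDiffOn 𝕜 ∞ (fun X => (deriv (deriv (inX H)) X)⁻¹) {X | -X / 2 ∈ T} := by
  have h2 : ContDiffOn 𝕜 ∞ (deriv (deriv (inX H))) {X | -X / 2 ∈ T} := by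
    have : deriv (deriv (inX H)) = fun X => 1 / 4 * inX (deriv (deriv H)) X := by
      funext X
      exact deriv_deriv_inX H X
    rw [this]
    exact contDiffOn_const.mul (contDiffOn_comp_inX h.contDiffOn_deriv₂)
  refine h2.inv fun X hX => ?_
  rw [deriv_deriv_inX]
  exact mul_ne_zero (by norm_num) (h.ne_zero _ hX)

theorem contDiffOn_mongeField (h : IsAdmissible T H F) :
    ContDiffOn 𝕜 ∞ (mongeField H) (domain235 T) := by
  have hi : ContDiffOn 𝕜 ∞ (fun m : Fin 5 → 𝕜 => (deriv (deriv (inX H)) (m 0))⁻¹)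
      (domain235 T) :=
    (contDiffOn_inv_inX h).comp (contDiff_apply 𝕜 𝕜 0).contDiffOn fun _ hm => hm
  unfold mongeField
  obtain ⟨g, e⟩ : ∃ g : (Fin 5 → 𝕜) → 𝕜, ∀ m, (deriv (deriv (inX H)) (m 0))⁻¹ = g m :=
    ⟨_, fun _ => rfl⟩
  simp only [div_eq_mul_inv, e] at *
  rw [contDiffOn_pi]
  intro i
  fin_cases i <;> simp <;> fun_prop

theorem contDiffOn_prolongedMongeField (h : IsAdmissible T H F) :
    ContDiffOn 𝕜 ∞ (prolongedMongeField H) (prolongedDomain235 T) := by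
  have hi : ContDiffOn 𝕜 ∞ (fun m : Fin 6 → 𝕜 => (deriv (deriv (inX H)) (m 0))⁻¹)
      (prolongedDomain235 T) :=
    (contDiffOn_inv_inX h).comp (contDiff_apply 𝕜 𝕜 0).contDiffOn fun _ hm => hm
  unfold prolongedMongeField
  obtain ⟨g, e⟩ : ∃ g : (Fin 6 → 𝕜) → 𝕜, ∀ m, (deriv (deriv (inX H)) (m 0))⁻¹ = g m :=
    ⟨_, fun _ => rfl⟩
  simp only [div_eq_mul_inv, e] at *
  rw [contDiffOn_pi]
  intro i
  fin_cases i <;> simp <;> fun_prop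

/-- Symmetries of `D̃₂` in terms of the frame. -/
theorem mem_symmetryAlgebra_contactSystem_iff (h : IsAdmissible T H F)
    (V : SmoothVF 𝕜 (contactDomain T)) :
    V ∈ symmetryAlgebra (contactSystem H F) (contactDomain T) ↔ ∀ u ∈ contactDomain T,
      VectorField.lieBracket 𝕜 V.1 (lineField H F) u ∈ contactSystem H F u ∧
      VectorField.lieBracket 𝕜 V.1 (fibreField 𝕜) u ∈ contactSystem H F u := by
  refine mem_symmetryAlgebra_iff_frame (contDiffOn_lineField h) contDiffOn_const
    (ContinuousLinearMap.proj 0) (ContinuousLinearMap.proj 5)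
    (fun u _ w => mem_contactSystem_iff H F u w) ?_ ?_ V
  all_goals
    intro u _
    rw [mem_contactSystem_iff]
    funext j
    fin_cases j <;> simp [lineField, fibreField] <;> rfl

theorem mem_symmetryAlgebra_distribution235_iff (h : IsAdmissible T H F)
    (V : SmoothVF 𝕜 (domain235 T)) :
    V ∈ symmetryAlgebra (distribution235 H) (domain235 T) ↔ ∀ m ∈ domain235 T,
      VectorField.lieBracket 𝕜 V.1 (mongeField H) m ∈ distribution235 H m ∧
      VectorField.lieBracket 𝕜 V.1 (topField 𝕜) m ∈ distribution235 H m := by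
  refine mem_symmetryAlgebra_iff_frame (contDiffOn_mongeField h) contDiffOn_const
    (ContinuousLinearMap.proj 0) (ContinuousLinearMap.proj 4)
    (fun u _ w => mem_distribution235_iff H u w) ?_ ?_ V
  all_goals
    intro u _
    rw [mem_distribution235_iff]
    funext j
    fin_cases j <;> simp [mongeField, topField] <;> rfl

theorem mem_symmetryAlgebra_prolongedDistribution235_iff (h : IsAdmissible T H F)
    (V : SmoothVF 𝕜 (prolongedDomain235 T)) :
    V ∈ symmetryAlgebra (prolongedDistribution235 H) (prolongedDomain235 T) ↔
      ∀ w ∈ prolongedDomain235 T,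
      VectorField.lieBracket 𝕜 V.1 (prolongedMongeField H) w ∈ prolongedDistribution235 H w ∧
      VectorField.lieBracket 𝕜 V.1 (fibreField 𝕜) w ∈ prolongedDistribution235 H w := by
  refine mem_symmetryAlgebra_iff_frame (contDiffOn_prolongedMongeField h) contDiffOn_const
    (ContinuousLinearMap.proj 0) (ContinuousLinearMap.proj 5)
    (fun u _ w => mem_prolongedDistribution235_iff H u w) ?_ ?_ V
  all_goals
    intro u _
    rw [mem_prolongedDistribution235_iff]
    funext j
    fin_cases j <;> simp [prolongedMongeField, fibreField] <;> rfl

/-- The derivative of `1 / H_XX`. -/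
theorem hasDerivAt_inv_inX (h : IsAdmissible T H F) {X : 𝕜} (hX : -X / 2 ∈ T) :
    HasDerivAt (fun X => (deriv (deriv (inX H)) X)⁻¹)
      (deriv (fun X => (deriv (deriv (inX H)) X)⁻¹) X) X :=
  (((contDiffOn_inv_inX h).contDiffAt ((isOpen_inX T).mem_nhds hX)).differentiableAt
    (by simp)).hasDerivAt

theorem fderiv_mongeField (h : IsAdmissible T H F) {m : Fin 5 → 𝕜} (hm : m ∈ domain235 T)
    (v : Fin 5 → 𝕜) : fderiv 𝕜 (mongeField H) m v =
      ![0, v 3, 2 * m 4 * v 4 * (deriv (deriv (inX H)) (m 0))⁻¹ +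
          m 4 ^ 2 * deriv (fun X => (deriv (deriv (inX H)) X)⁻¹) (m 0) * v 0, v 4, 0] := by
  have c := hasDerivAt_line m v
  have d := hasDerivAt_comp_line m v 0 (hasDerivAt_inv_inX h hm)
  refine fderiv_apply_eq_of_hasDerivAt
    (((contDiffOn_mongeField h).contDiffAt
      ((domain235 T).isOpen.mem_nhds hm)).differentiableAt (by simp)) ?_
  intro i
  fin_cases i
  · exact hasDerivAt_const _ _
  · exact c 3
  · change HasDerivAt (fun s : 𝕜 => (m 4 + s * v 4) ^ 2 /
      deriv (deriv (inX H)) (m 0 + s * v 0)) _ 0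
    simp only [div_eq_mul_inv]
    refine HasDerivAt.congr_deriv (((c 4).fun_pow 2).fun_mul d) ?_
    simp
    ring
  · exact c 4
  · exact hasDerivAt_const _ _

theorem fderiv_prolongedMongeField (h : IsAdmissible T H F) {w : Fin 6 → 𝕜}
    (hw : w ∈ prolongedDomain235 T) (v : Fin 6 → 𝕜) : fderiv 𝕜 (prolongedMongeField H) w v =
      ![0, v 3, 2 * w 4 * v 4 * (deriv (deriv (inX H)) (w 0))⁻¹ +
          w 4 ^ 2 * deriv (fun X => (deriv (deriv (inX H)) X)⁻¹) (w 0) * v 0, v 4, v 5, 0] := by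
  have c := hasDerivAt_line w v
  have d := hasDerivAt_comp_line w v 0 (hasDerivAt_inv_inX h hw)
  refine fderiv_apply_eq_of_hasDerivAt
    (((contDiffOn_prolongedMongeField h).contDiffAt
      ((prolongedDomain235 T).isOpen.mem_nhds hw)).differentiableAt (by simp)) ?_
  intro i
  fin_cases i
  · exact hasDerivAt_const _ _
  · exact c 3
  · change HasDerivAt (fun s : 𝕜 => (w 4 + s * v 4) ^ 2 /
      deriv (deriv (inX H)) (w 0 + s * v 0)) _ 0
    simp only [div_eq_mul_inv]
    refine HasDerivAt.congr_deriv (((c 4).fun_pow 2).fun_mul d) ?_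
    simp
    ring
  · exact c 4
  · exact c 5
  · exact hasDerivAt_const _ _

theorem fderiv_coord_eq_zero {U : Opens (Fin 6 → 𝕜)} {δ : SmoothVF 𝕜 U}
    (hδ : ∀ u ∈ U, forgetFibre (δ.1 u) = 0) {u : Fin 6 → 𝕜} (hu : u ∈ U) (v : Fin 6 → 𝕜)
    (i : Fin 5) : fderiv 𝕜 δ.1 u v i.castSucc = 0 := by
  have he : (fun x => δ.1 x i.castSucc) =ᶠ[nhds u] fun _ => 0 := by
    filter_upwards [U.isOpen.mem_nhds hu] with y hy using congrFun (hδ y hy) i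
  rw [fderiv_apply_coord (SmoothVF.differentiableAt δ hu), he.fderiv_eq]
  simp

/-- A symmetry of `D̃₂` is determined by its projection. -/
theorem eq_zero_of_mem_symmetryAlgebra_contactSystem (h : IsAdmissible T H F)
    {δ : SmoothVF 𝕜 (contactDomain T)}
    (hs : δ ∈ symmetryAlgebra (contactSystem H F) (contactDomain T))
    (hδ : ∀ u ∈ contactDomain T, forgetFibre (δ.1 u) = 0) : δ = 0 := by
  refine SmoothVF.ext_on fun u hu => ?_
  have h1 := ((mem_symmetryAlgebra_contactSystem_iff h δ).1 hs u hu).1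
  rw [mem_contactSystem_iff] at h1
  have z0 := fderiv_coord_eq_zero hδ hu (lineField H F u) 0
  have z1 := fderiv_coord_eq_zero hδ hu (lineField H F u) 1
  -- The y-component of `lineField` is t, so the y-component of the bracket is the t-component of δ,
  -- while its x-component vanishes. Membership in D̃₂ then kills the t-component.
  have h2 := congrFun h1 1
  simp [VectorField.lieBracket, fderiv_lineField h hu, lineField, fibreField] at h2 z0 z1
  rw [z0, z1] at h2
  funext i
  refine Fin.lastCases ?_ (fun j => congrFun (hδ u hu) j) i
  simpa using h2

/-- A symmetry of `D̃₁` is determined by its projection. -/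
theorem eq_zero_of_mem_symmetryAlgebra_prolongedDistribution235 (h : IsAdmissible T H F)
    {δ : SmoothVF 𝕜 (prolongedDomain235 T)}
    (hs : δ ∈ symmetryAlgebra (prolongedDistribution235 H) (prolongedDomain235 T))
    (hδ : ∀ u ∈ prolongedDomain235 T, forgetFibre (δ.1 u) = 0) : δ = 0 := by
  refine SmoothVF.ext_on fun u hu => ?_
  have h1 := ((mem_symmetryAlgebra_prolongedDistribution235_iff h δ).1 hs u hu).1
  rw [mem_prolongedDistribution235_iff] at h1
  have z0 := fderiv_coord_eq_zero hδ hu (prolongedMongeField H u) 0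
  have z1 := fderiv_coord_eq_zero hδ hu (prolongedMongeField H u) 4
  -- The same argument with Q in place of y: the Q-component of the frame field is L.
  have h2 := congrFun h1 4
  simp [VectorField.lieBracket, fderiv_prolongedMongeField h hu, prolongedMongeField,
    fibreField] at h2 z0 z1
  rw [z0, z1] at h2
  funext i
  refine Fin.lastCases ?_ (fun j => congrFun (hδ u hu) j) i
  simpa using h2

end Prolongations

end

noncomputable section

/-! ### Lifting contact fields to symmetries of D̃₂, and descending to M_T. -/

section Lift

variable {𝕜 : Type*} [RCLike 𝕜] {T : Opens 𝕜} {H F : 𝕜 → 𝕜}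

theorem mem_contactSystem_iff' (H F : 𝕜 → 𝕜) (u w : Fin 6 → 𝕜) :
    w ∈ contactSystem H F u ↔ w 1 = w 0 * u 5 ∧ w 2 = w 0 * (u 3 + u 5 * u 4) ∧
      w 3 = w 0 * (u 5 * H (u 5) - 2 * F (u 5)) ∧ w 4 = -(w 0 * H (u 5)) := by
  rw [mem_contactSystem_iff]
  simp [funext_iff, Fin.forall_fin_succ, lineField, fibreField]

theorem mem_distribution235_iff' (H : 𝕜 → 𝕜) (m w : Fin 5 → 𝕜) :
    w ∈ distribution235 H m ↔ w 1 = w 0 * m 3 ∧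
      w 2 = w 0 * (m 4 ^ 2 / deriv (deriv (inX H)) (m 0)) ∧ w 3 = w 0 * m 4 := by
  rw [mem_distribution235_iff]
  simp [funext_iff, Fin.forall_fin_succ, mongeField, topField]

theorem mem_prolongedDistribution235_iff' (H : 𝕜 → 𝕜) (m w : Fin 6 → 𝕜) :
    w ∈ prolongedDistribution235 H m ↔ w 1 = w 0 * m 3 ∧
      w 2 = w 0 * (m 4 ^ 2 / deriv (deriv (inX H)) (m 0)) ∧ w 3 = w 0 * m 4 ∧
      w 4 = w 0 * m 5 := by
  rw [mem_prolongedDistribution235_iff]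
  simp [funext_iff, Fin.forall_fin_succ, prolongedMongeField, fibreField]

/-- Forgetting the fibre coordinate, as a continuous linear map. -/
def forgetFibreL (𝕜 : Type*) [RCLike 𝕜] : (Fin 6 → 𝕜) →L[𝕜] (Fin 5 → 𝕜) :=
  ContinuousLinearMap.pi fun i => ContinuousLinearMap.proj i.castSucc

theorem forgetFibreL_apply (u : Fin 6 → 𝕜) : forgetFibreL 𝕜 u = forgetFibre u := rfl

theorem contDiff_forgetFibre : ContDiff 𝕜 ∞ (forgetFibre : (Fin 6 → 𝕜) → Fin 5 → 𝕜) :=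
  (forgetFibreL 𝕜).contDiff

theorem hasFDerivAt_forgetFibre (u : Fin 6 → 𝕜) :
    HasFDerivAt (forgetFibre : (Fin 6 → 𝕜) → Fin 5 → 𝕜) (forgetFibreL 𝕜) u :=
  (forgetFibreL 𝕜).hasFDerivAt

/-- A vector field on `𝕜⁵` which lifts to a symmetry of `D̃₁` is a symmetry of `D₁`. -/
theorem mem_symmetryAlgebra_distribution235_of_lift (h : IsAdmissible T H F)
    {V : SmoothVF 𝕜 (domain235 T)} {ζ : SmoothVF 𝕜 (prolongedDomain235 T)}
    (hζ : ζ ∈ symmetryAlgebra (prolongedDistribution235 H) (prolongedDomain235 T))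
    (hV : ∀ w ∈ prolongedDomain235 T, forgetFibre (ζ.1 w) = V.1 (forgetFibre w)) :
    V ∈ symmetryAlgebra (distribution235 H) (domain235 T) := by
  rw [mem_symmetryAlgebra_distribution235_iff h]
  intro m hm
  have hf : ∀ l : 𝕜, forgetFibre ![m 0, m 1, m 2, m 3, m 4, l] = m := by
    intro l
    funext i
    fin_cases i <;> rfl
  -- At the point of the fibre with L = l the prolonged total derivative projects to the total
  -- derivative plus l ∂_Q. The resulting identities are affine in l: l = 0 gives the condition for
  -- the first frame field, the difference of l = 1 and l = 0 the one for ∂_Q.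
  have key : ∀ l : 𝕜,
      V.1 m 3 - fderiv 𝕜 V.1 m (mongeField H m + l • topField 𝕜 m) 1 =
        -fderiv 𝕜 V.1 m (mongeField H m + l • topField 𝕜 m) 0 * m 3 ∧
      2 * m 4 * V.1 m 4 * (deriv (deriv (inX H)) (m 0))⁻¹ +
          m 4 ^ 2 * deriv (fun X => (deriv (deriv (inX H)) X)⁻¹) (m 0) * V.1 m 0 -
          fderiv 𝕜 V.1 m (mongeField H m + l • topField 𝕜 m) 2 =
        -fderiv 𝕜 V.1 m (mongeField H m + l • topField 𝕜 m) 0 *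
          (m 4 ^ 2 / deriv (deriv (inX H)) (m 0)) ∧
      V.1 m 4 - fderiv 𝕜 V.1 m (mongeField H m + l • topField 𝕜 m) 3 =
        -fderiv 𝕜 V.1 m (mongeField H m + l • topField 𝕜 m) 0 * m 4 := by
    intro l
    set w : Fin 6 → 𝕜 := ![m 0, m 1, m 2, m 3, m 4, l] with hwdef
    have hw : w ∈ prolongedDomain235 T := hm
    have hfw : forgetFibre w = m := hf l
    have e0 : V.1 m = forgetFibre (ζ.1 w) := by rw [hV w hw, hfw]
    have ed : ∀ i : Fin 5, fderiv 𝕜 ζ.1 w (prolongedMongeField H w) i.castSucc =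
        fderiv 𝕜 V.1 m (mongeField H m + l • topField 𝕜 m) i := by
      intro i
      have dV : DifferentiableAt 𝕜 V.1 (forgetFibre w) := by
        rw [hfw]
        exact SmoothVF.differentiableAt V hm
      have he : (fun x => ζ.1 x i.castSucc) =ᶠ[nhds w] fun x => V.1 (forgetFibre x) i := by
        filter_upwards [(prolongedDomain235 T).isOpen.mem_nhds hw] with y hy
        exact congrFun (hV y hy) i
      have hd : HasFDerivAt (fun x => V.1 (forgetFibre x)) _ w :=
        dV.hasFDerivAt.comp w (hasFDerivAt_forgetFibre w)
      rw [fderiv_apply_coord (SmoothVF.differentiableAt ζ hw), he.fderiv_eq,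
        ← fderiv_apply_coord hd.differentiableAt, hd.fderiv, hfw]
      have hA : forgetFibre (prolongedMongeField H w) = mongeField H m + l • topField 𝕜 m := by
        funext j
        fin_cases j <;> simp [forgetFibre, prolongedMongeField, mongeField, topField, hwdef]
      rw [ContinuousLinearMap.comp_apply, forgetFibreL_apply, hA]
    have h1 := ((mem_symmetryAlgebra_prolongedDistribution235_iff h ζ).1 hζ w hw).1
    rw [mem_prolongedDistribution235_iff'] at h1
    simp only [VectorField.lieBracket, fderiv_prolongedMongeField h hw, Pi.sub_apply] at h1
    have d0 := ed 0
    have d1 := ed 1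
    have d2 := ed 2
    have d3 := ed 3
    simp only [Fin.castSucc_zero, Fin.castSucc_one, Fin.reduceCastSucc] at d0 d1 d2 d3
    rw [d0, d1, d2, d3] at h1
    have z0 : V.1 m 0 = ζ.1 w 0 := congrFun e0 0
    have z3 : V.1 m 3 = ζ.1 w 3 := congrFun e0 3
    have z4 : V.1 m 4 = ζ.1 w 4 := congrFun e0 4
    rw [z0, z3, z4]
    have w0 : w 0 = m 0 := rfl
    have w3 : w 3 = m 3 := rfl
    have w4 : w 4 = m 4 := rfl
    simp only [Matrix.cons_val, zero_sub, w0, w3, w4] at h1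
    exact ⟨h1.1, h1.2.1, h1.2.2.1⟩
  have k0 := key 0
  have k1 := key 1
  simp only [zero_smul, add_zero, one_smul, map_add, Pi.add_apply] at k0 k1
  obtain ⟨a1, a2, a3⟩ := k0
  obtain ⟨b1, b2, b3⟩ := k1
  constructor
  · rw [mem_distribution235_iff']
    simp only [VectorField.lieBracket, fderiv_mongeField h hm, Pi.sub_apply]
    simp only [Matrix.cons_val, zero_sub]
    exact ⟨a1, a2, a3⟩
  · rw [mem_distribution235_iff']
    have ht : fderiv 𝕜 (topField 𝕜) m = 0 := fderiv_const_apply _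
    simp only [VectorField.lieBracket, ht, zero_apply, zero_sub, Pi.neg_apply]
    refine ⟨?_, ?_, ?_⟩
    · linear_combination b1 - a1
    · linear_combination b2 - a2
    · linear_combination b3 - a3

/-- The flow of `lineField`. -/
def lineFlow (H F : 𝕜 → 𝕜) (s : 𝕜) (u : Fin 6 → 𝕜) : Fin 6 → 𝕜 :=
  -- Along the flow p + t q changes at the rate -2F, whence the quadratic term -s²F in z.
  ![u 0 + s, u 1 + s * u 5, u 2 + s * (u 3 + u 5 * u 4) - s ^ 2 * F (u 5),
    u 3 + s * (u 5 * H (u 5) - 2 * F (u 5)), u 4 - s * H (u 5), u 5]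

theorem lineFlow_zero (u : Fin 6 → 𝕜) : lineFlow H F 0 u = u := by
  funext i
  fin_cases i <;> simp [lineFlow]

theorem lineFlow_lineFlow (s s' : 𝕜) (u : Fin 6 → 𝕜) :
    lineFlow H F s' (lineFlow H F s u) = lineFlow H F (s + s') u := by
  funext i
  fin_cases i <;> simp [lineFlow] <;> ring

theorem hasDerivAt_lineFlow (u : Fin 6 → 𝕜) :
    HasDerivAt (fun s => lineFlow H F s u) (lineField H F u) 0 := by
  have c := hasDerivAt_id (0 : 𝕜)
  rw [hasDerivAt_pi]
  intro i
  fin_cases i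
  · exact c.const_add (u 0)
  · refine HasDerivAt.congr_deriv ((c.mul_const (u 5)).const_add (u 1)) ?_
    simp [lineField]
  · refine HasDerivAt.congr_deriv (((c.mul_const (u 3 + u 5 * u 4)).const_add (u 2)).fun_sub
      ((c.fun_pow 2).mul_const (F (u 5)))) ?_
    simp [lineField]
  · refine HasDerivAt.congr_deriv
      ((c.mul_const (u 5 * H (u 5) - 2 * F (u 5))).const_add (u 3)) ?_
    simp [lineField]
  · refine HasDerivAt.congr_deriv ((c.mul_const (H (u 5))).const_sub (u 4)) ?_
    simp [lineField]
  · exact hasDerivAt_const _ _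

/-- Only L moves along a line, at the constant rate H_tt / 8, so the lines lie in the fibres over
M_T. -/
theorem doubleFibrationMap_lineFlow (s : 𝕜) (u : Fin 6 → 𝕜) :
    doubleFibrationMap H F (lineFlow H F s u) =
      doubleFibrationMap H F u + (s * (1 / 8 * deriv (deriv H) (u 5))) •
        fibreField 𝕜 (doubleFibrationMap H F u) := by
  funext i
  fin_cases i <;> simp [doubleFibrationMap, lineFlow, fibreField] <;>
    first | (ring; done) | exact Or.inl (by ring)

theorem hasDerivAt_comp_lineFlow {g : (Fin 6 → 𝕜) → 𝕜} {u : Fin 6 → 𝕜}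
    (hg : DifferentiableAt 𝕜 g u) :
    HasDerivAt (fun s => g (lineFlow H F s u)) (fderiv 𝕜 g u (lineField H F u)) 0 := by
  have h1 : HasFDerivAt g (fderiv 𝕜 g u) (lineFlow H F 0 u) := by
    rw [lineFlow_zero]
    exact hg.hasFDerivAt
  exact h1.comp_hasDerivAt (0 : 𝕜) (hasDerivAt_lineFlow u)

/-- The value of the contact form `dz - p dx - q dy` on a vector field. -/
def generatingFunction (ξ : (Fin 5 → 𝕜) → Fin 5 → 𝕜) (m : Fin 5 → 𝕜) : 𝕜 :=
  ξ m 2 - m 3 * ξ m 0 - m 4 * ξ m 1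

/-- The derivative along `lineField` of the generating function of a contact vector field. -/
def lineSlope (H F : 𝕜 → 𝕜) (ξ : (Fin 5 → 𝕜) → Fin 5 → 𝕜) (u : Fin 6 → 𝕜) : 𝕜 :=
  ξ (forgetFibre u) 3 + u 5 * ξ (forgetFibre u) 4 -
    (u 5 * H (u 5) - 2 * F (u 5)) * ξ (forgetFibre u) 0 + H (u 5) * ξ (forgetFibre u) 1

/-- The derivative of `lineSlope` along the fibre coordinate. -/
def osculatingSlope (H : 𝕜 → 𝕜) (ξ : (Fin 5 → 𝕜) → Fin 5 → 𝕜) (u : Fin 6 → 𝕜) : 𝕜 :=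
  ξ (forgetFibre u) 4 - (u 5 * deriv H (u 5) - H (u 5)) * ξ (forgetFibre u) 0 +
    deriv H (u 5) * ξ (forgetFibre u) 1

/-- The value of `dy - t dx` on a vector field. -/
def transversalPart (ξ : (Fin 5 → 𝕜) → Fin 5 → 𝕜) (u : Fin 6 → 𝕜) : 𝕜 :=
  ξ (forgetFibre u) 1 - u 5 * ξ (forgetFibre u) 0

/-- The fibre component of the lift of a contact symmetry. -/
def fibreComponent (H F : 𝕜 → 𝕜) (ξ : (Fin 5 → 𝕜) → Fin 5 → 𝕜) (u : Fin 6 → 𝕜) : 𝕜 :=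
  transversalPart ξ (lineFlow H F 1 u) - transversalPart ξ u

/-- The lift of a contact symmetry to the space with coordinates `(x, y, z, p, q, t)`. -/
def contactLift (H F : 𝕜 → 𝕜) (ξ : (Fin 5 → 𝕜) → Fin 5 → 𝕜) (u : Fin 6 → 𝕜) : Fin 6 → 𝕜 :=
  ![ξ (forgetFibre u) 0, ξ (forgetFibre u) 1, ξ (forgetFibre u) 2, ξ (forgetFibre u) 3,
    ξ (forgetFibre u) 4, fibreComponent H F ξ u]

/-- Conditions along the integral curves of `lineField` under which a contact vector field is a
symmetry of the family of these curves. -/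
structure IsLineCompatible (T : Opens 𝕜) (H F : 𝕜 → 𝕜) (ξ : (Fin 5 → 𝕜) → Fin 5 → 𝕜) :
    Prop where
  generatingFunction_flow : ∀ u : Fin 6 → 𝕜, u 5 ∈ T → ∀ s,
    generatingFunction ξ (forgetFibre (lineFlow H F s u)) =
      generatingFunction ξ (forgetFibre u) + s * lineSlope H F ξ u
  osculatingSlope_flow : ∀ u : Fin 6 → 𝕜, u 5 ∈ T → ∀ s,
    osculatingSlope H ξ (lineFlow H F s u) = osculatingSlope H ξ u
  transversalPart_flow : ∀ u : Fin 6 → 𝕜, u 5 ∈ T → ∀ s,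
    transversalPart ξ (lineFlow H F s u) = transversalPart ξ u + s * fibreComponent H F ξ u

namespace IsLineCompatible

variable {ξ : (Fin 5 → 𝕜) → Fin 5 → 𝕜}

/-- A function affine along a line has constant slope there: compare time s + 1 reached directly
with time s followed by time 1. -/
theorem lineSlope_flow (hξ : IsLineCompatible T H F ξ) {u : Fin 6 → 𝕜} (hu : u 5 ∈ T) (s : 𝕜) :
    lineSlope H F ξ (lineFlow H F s u) = lineSlope H F ξ u := by
  have h1 := hξ.generatingFunction_flow u hu s
  have h2 := hξ.generatingFunction_flow u hu (s + 1)
  have h3 := hξ.generatingFunction_flow (lineFlow H F s u) hu 1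
  rw [lineFlow_lineFlow] at h3
  linear_combination h2 - h3 - h1

theorem fibreComponent_flow (hξ : IsLineCompatible T H F ξ) {u : Fin 6 → 𝕜} (hu : u 5 ∈ T)
    (s : 𝕜) : fibreComponent H F ξ (lineFlow H F s u) = fibreComponent H F ξ u := by
  have h1 := hξ.transversalPart_flow u hu s
  have h2 := hξ.transversalPart_flow u hu (s + 1)
  have h3 := hξ.transversalPart_flow (lineFlow H F s u) hu 1
  rw [lineFlow_lineFlow] at h3
  linear_combination h2 - h3 - h1

end IsLineCompatible

theorem contDiffOn_contactLift (h : IsAdmissible T H F) {ξ : (Fin 5 → 𝕜) → Fin 5 → 𝕜}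
    (hξ : ContDiff 𝕜 ∞ ξ) : ContDiffOn 𝕜 ∞ (contactLift H F ξ) (contactDomain T) := by
  have hc : ∀ j, ContDiff 𝕜 ∞ fun u : Fin 6 → 𝕜 => ξ (forgetFibre u) j := fun j =>
    contDiff_pi.1 (hξ.comp contDiff_forgetFibre) j
  have hw : ContDiff 𝕜 ∞ (transversalPart ξ) :=
    (hc 1).sub ((contDiff_apply 𝕜 𝕜 5).mul (hc 0))
  have hl : ContDiffOn 𝕜 ∞ (lineFlow H F 1) (contactDomain T) := by
    have h0 := contDiffOn_comp_coord h.contDiffOn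
    have hF := contDiffOn_comp_coord h.contDiffOn_primitive
    unfold lineFlow
    obtain ⟨g0, e0⟩ : ∃ g : (Fin 6 → 𝕜) → 𝕜, ∀ u, H (u 5) = g u := ⟨_, fun _ => rfl⟩
    obtain ⟨gF, eF⟩ : ∃ g : (Fin 6 → 𝕜) → 𝕜, ∀ u, F (u 5) = g u := ⟨_, fun _ => rfl⟩
    simp only [e0, eF] at *
    rw [contDiffOn_pi]
    intro i
    fin_cases i <;> simp <;> fun_prop
  have hτ : ContDiffOn 𝕜 ∞ (fibreComponent H F ξ) (contactDomain T) :=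
    (hw.comp_contDiffOn hl).sub hw.contDiffOn
  rw [contDiffOn_pi]
  intro i
  fin_cases i
  · exact (hc 0).contDiffOn
  · exact (hc 1).contDiffOn
  · exact (hc 2).contDiffOn
  · exact (hc 3).contDiffOn
  · exact (hc 4).contDiffOn
  · exact hτ

/-- The lift of a contact symmetry, as a smooth vector field. -/
def contactLiftVF (h : IsAdmissible T H F) {ξ : (Fin 5 → 𝕜) → Fin 5 → 𝕜}
    (hξ : ContDiff 𝕜 ∞ ξ) : SmoothVF 𝕜 (contactDomain T) :=
  SmoothVF.ofContDiffOn (contactLift H F ξ) (contDiffOn_contactLift h hξ)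

theorem forgetFibre_contactLift (ξ : (Fin 5 → 𝕜) → Fin 5 → 𝕜) (u : Fin 6 → 𝕜) :
    forgetFibre (contactLift H F ξ u) = ξ (forgetFibre u) := by
  funext i
  fin_cases i <;> rfl

/-- Differentiating the identities of `IsLineCompatible` at s = 0 gives four linear relations
between the derivatives of the lift along `lineField`. Combined, they say that the four forms
defining D̃₂ vanish on the bracket with `lineField`. The bracket with ∂_t is vertical, since only
the fibre component of the lift depends on t. -/
theorem contactLiftVF_mem_symmetryAlgebra (h : IsAdmissible T H F)
    {ξ : (Fin 5 → 𝕜) → Fin 5 → 𝕜} (hξ : ContDiff 𝕜 ∞ ξ) (hc : IsLineCompatible T H F ξ) :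
    contactLiftVF h hξ ∈ symmetryAlgebra (contactSystem H F) (contactDomain T) := by
  rw [mem_symmetryAlgebra_contactSystem_iff h]
  intro u hu
  have hu' : u 5 ∈ T := hu
  have dl : DifferentiableAt 𝕜 (contactLift H F ξ) u :=
    ((contDiffOn_contactLift h hξ).contDiffAt
      ((contactDomain T).isOpen.mem_nhds hu)).differentiableAt (by simp)
  have he := SmoothVF.ofContDiffOn_eventuallyEq (contDiffOn_contactLift h hξ) hu
  rw [contactLiftVF, he.lieBracket_vectorField_eq (Filter.EventuallyEq.refl _ (lineField H F)),
    he.lieBracket_vectorField_eq (Filter.EventuallyEq.refl _ (fibreField 𝕜))]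
  have dξ : ∀ j, DifferentiableAt 𝕜 (fun x : Fin 6 → 𝕜 => ξ (forgetFibre x) j) u := fun j =>
    (contDiff_pi.1 (hξ.comp contDiff_forgetFibre) j).differentiable (by simp) u
  constructor
  · have dcoord : ∀ j : Fin 6, HasDerivAt (fun s => contactLift H F ξ (lineFlow H F s u) j)
        (fderiv 𝕜 (contactLift H F ξ) u (lineField H F u) j) 0 := fun j => by
      rw [fderiv_apply_coord dl]
      exact hasDerivAt_comp_lineFlow (differentiableAt_pi.1 dl j)
    have flow0 := lineFlow_zero (H := H) (F := F) u
    have c := hasDerivAt_id (0 : 𝕜)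
    have x0 : HasDerivAt (fun s => ξ (forgetFibre (lineFlow H F s u)) 0) _ 0 := dcoord 0
    have x1 : HasDerivAt (fun s => ξ (forgetFibre (lineFlow H F s u)) 1) _ 0 := dcoord 1
    have x2 : HasDerivAt (fun s => ξ (forgetFibre (lineFlow H F s u)) 2) _ 0 := dcoord 2
    have x3 : HasDerivAt (fun s => ξ (forgetFibre (lineFlow H F s u)) 3) _ 0 := dcoord 3
    have x4 : HasDerivAt (fun s => ξ (forgetFibre (lineFlow H F s u)) 4) _ 0 := dcoord 4
    have x5 : HasDerivAt (fun s => fibreComponent H F ξ (lineFlow H F s u)) _ 0 := dcoord 5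
    set d := fderiv 𝕜 (contactLift H F ξ) u (lineField H F u) with hd
    have r1 : d 2 - (u 5 * H (u 5) - 2 * F (u 5)) * ξ (forgetFibre u) 0 - u 3 * d 0
        + H (u 5) * ξ (forgetFibre u) 1 - u 4 * d 1 = lineSlope H F ξ u := by
      have a1 : HasDerivAt
          (fun s => generatingFunction ξ (forgetFibre (lineFlow H F s u))) _ 0 :=
        (x2.fun_sub (((c.mul_const (u 5 * H (u 5) - 2 * F (u 5))).const_add (u 3)).fun_mul
          x0)).fun_sub (((c.mul_const (H (u 5))).const_sub (u 4)).fun_mul x1)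
      have a2 : HasDerivAt (fun s => generatingFunction ξ (forgetFibre (lineFlow H F s u)))
          (1 * lineSlope H F ξ u) 0 := by
        rw [funext (hc.generatingFunction_flow u hu')]
        exact (c.mul_const _).const_add _
      have a3 := a1.unique a2
      simp [flow0] at a3
      linear_combination a3
    have r2 : d 3 + u 5 * d 4 - (u 5 * H (u 5) - 2 * F (u 5)) * d 0 + H (u 5) * d 1 = 0 := by
      have a1 : HasDerivAt (fun s => lineSlope H F ξ (lineFlow H F s u)) _ 0 :=
        ((x3.fun_add (x4.const_mul (u 5))).fun_sub
          (x0.const_mul (u 5 * H (u 5) - 2 * F (u 5)))).fun_add (x1.const_mul (H (u 5)))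
      rw [funext (hc.lineSlope_flow hu')] at a1
      exact a1.unique (hasDerivAt_const _ _)
    have r3 : d 4 - (u 5 * deriv H (u 5) - H (u 5)) * d 0 + deriv H (u 5) * d 1 = 0 := by
      have a1 : HasDerivAt (fun s => osculatingSlope H ξ (lineFlow H F s u)) _ 0 :=
        (x4.fun_sub (x0.const_mul (u 5 * deriv H (u 5) - H (u 5)))).fun_add
          (x1.const_mul (deriv H (u 5)))
      rw [funext (hc.osculatingSlope_flow u hu')] at a1
      exact a1.unique (hasDerivAt_const _ _)
    have r4 : d 1 - u 5 * d 0 = fibreComponent H F ξ u := by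
      have a1 : HasDerivAt (fun s => transversalPart ξ (lineFlow H F s u)) _ 0 :=
        x1.fun_sub (x0.const_mul (u 5))
      have a2 : HasDerivAt (fun s => transversalPart ξ (lineFlow H F s u))
          (1 * fibreComponent H F ξ u) 0 := by
        rw [funext (hc.transversalPart_flow u hu')]
        exact (c.mul_const _).const_add _
      rw [a1.unique a2, one_mul]
    rw [mem_contactSystem_iff']
    simp only [VectorField.lieBracket, fderiv_lineField h hu', ← hd, Pi.sub_apply]
    simp only [contactLift, Matrix.cons_val]
    rw [lineSlope] at r1
    refine ⟨?_, ?_, ?_, ?_⟩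
    · linear_combination -r4
    · linear_combination -r1 - u 4 * r4
    · linear_combination -r2 + u 5 * r3 - (u 5 * deriv H (u 5) - H (u 5)) * r4
    · linear_combination -r3 + deriv H (u 5) * r4
  · have z : ∀ j : Fin 5,
        fderiv 𝕜 (contactLift H F ξ) u (fibreField 𝕜 u) j.castSucc = 0 := by
      intro j
      rw [fderiv_apply_coord dl]
      have e : (fun x => contactLift H F ξ x j.castSucc) =
          fun x : Fin 6 → 𝕜 => ξ (forgetFibre x) j := by
        funext x
        exact congrFun (forgetFibre_contactLift ξ x) j
      rw [e, ← (dξ j).lineDeriv_eq_fderiv]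
      refine HasLineDerivAt.lineDeriv ?_
      have e2 : (fun s : 𝕜 => ξ (forgetFibre (u + s • fibreField 𝕜 u)) j) =
          fun _ => ξ (forgetFibre u) j := by
        funext s
        have hf : forgetFibre (u + s • fibreField 𝕜 u) = forgetFibre u := by
          funext i
          fin_cases i <;> simp [forgetFibre, fibreField]
        rw [hf]
      change HasDerivAt _ _ _
      rw [e2]
      exact hasDerivAt_const _ _
    have ht : fderiv 𝕜 (fibreField 𝕜) u = 0 := fderiv_const_apply _
    have z0 := z 0
    have z1 := z 1
    have z2 := z 2
    have z3 := z 3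
    have z4 := z 4
    simp only [Fin.castSucc_zero, Fin.castSucc_one, Fin.reduceCastSucc] at z0 z1 z2 z3 z4
    rw [mem_contactSystem_iff']
    simp [VectorField.lieBracket, ht, z0, z1, z2, z3, z4]

/-- The projection to `(X, Y, Z, P, Q)` of the lift of a contact symmetry is constant along the
fibres of this projection. -/
theorem fderiv_contactLift_flow (h : IsAdmissible T H F) {ξ : (Fin 5 → 𝕜) → Fin 5 → 𝕜}
    (hc : IsLineCompatible T H F ξ) {u : Fin 6 → 𝕜} (hu : u 5 ∈ T) (s : 𝕜) :
    forgetFibre (fderiv 𝕜 (doubleFibrationMap H F) (lineFlow H F s u)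
      (contactLift H F ξ (lineFlow H F s u))) =
    forgetFibre (fderiv 𝕜 (doubleFibrationMap H F) u (contactLift H F ξ u)) := by
  rw [fderiv_doubleFibrationMap h hu, fderiv_doubleFibrationMap h (u := lineFlow H F s u) hu]
  -- The X-, Y-, Z-, P- and Q-components of the push-forward are governed in turn by the fibre
  -- component, the line slope, the generating function, the osculating slope and the transversal
  -- part. Their changes along the flow cancel against those of the coefficients.
  have h1 := hc.generatingFunction_flow u hu s
  have h2 := hc.lineSlope_flow hu s
  have h3 := hc.osculatingSlope_flow u hu s
  have h4 := hc.transversalPart_flow u hu s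
  have h5 := hc.fibreComponent_flow hu s
  set u' := lineFlow H F s u with hu'
  simp only [contactLift, h5]
  have c0 : u' 0 = u 0 + s := rfl
  have c1 : u' 1 = u 1 + s * u 5 := rfl
  have c4 : u' 4 = u 4 - s * H (u 5) := rfl
  have c5 : u' 5 = u 5 := rfl
  have f3 : forgetFibre u' 3 = u' 3 := rfl
  have f4 : forgetFibre u' 4 = u' 4 := rfl
  have g3 : forgetFibre u 3 = u 3 := rfl
  have g4 : forgetFibre u 4 = u 4 := rfl
  simp only [generatingFunction, lineSlope, osculatingSlope, transversalPart, c5, f3, f4, g3, g4]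
    at h1 h2 h3 h4
  generalize forgetFibre u' = m' at *
  generalize forgetFibre u = m at *
  clear_value u'
  funext i
  fin_cases i
  · simp [forgetFibre]
  · simp [forgetFibre, c0, c1, c4, c5]
    linear_combination h2
  · simp [forgetFibre, c0, c1, c5]
    linear_combination h1 - (u 0 + s) * h2 + (u 5 * u 0 - u 1) * h3
  · simp [forgetFibre, c0, c1, c5]
    linear_combination - (1 / 2) * h3
  · simp [forgetFibre, c0, c1, c5]
    linear_combination 1 / 4 * deriv (deriv H) (u 5) * h4

end Lift

end

noncomputable section

theorem exists_forgetFibre_eq {α : Type*} (m : Fin 5 → α) (l : α) :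
    ∃ w : Fin 6 → α, forgetFibre w = m ∧ w 5 = l := by
  refine ⟨Fin.snoc (α := fun _ => α) m l, ?_, ?_⟩
  · funext i
    simp [forgetFibre]
  · exact Fin.snoc_last (α := fun _ => α) l m

/-! ### The correspondence between vector fields on J and on M_T. -/

section Transforms

variable {𝕜 : Type*} [RCLike 𝕜] {T : Opens 𝕜} {H F : 𝕜 → 𝕜}

theorem invOn_doubleFibrationInv (h : IsAdmissible T H F) :
    InvOn (doubleFibrationInv H F) (doubleFibrationMap H F) (contactDomain T)
      (prolongedDomain235 T) :=
  ⟨fun _ hu => doubleFibrationInv_left h hu, fun _ hw => doubleFibrationInv_right h hw⟩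

theorem isProlongation_iff_related {U : Opens (Fin 6 → 𝕜)} {U' : Opens (Fin 5 → 𝕜)}
    {D : (Fin 6 → 𝕜) → Submodule 𝕜 (Fin 6 → 𝕜)} {V : SmoothVF 𝕜 U'} {ζ : SmoothVF 𝕜 U} :
    IsProlongation D V ζ ↔ ζ ∈ symmetryAlgebra D U ∧ SmoothVF.Related forgetFibre ζ V := by
  simp only [IsProlongation, SmoothVF.Related, (hasFDerivAt_forgetFibre _).fderiv,
    forgetFibreL_apply]

theorem isProlongation_contactSystem_unique (h : IsAdmissible T H F)
    {V : SmoothVF 𝕜 (⊤ : Opens (Fin 5 → 𝕜))} {ζ₁ ζ₂ : SmoothVF 𝕜 (contactDomain T)}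
    (h₁ : IsProlongation (contactSystem H F) V ζ₁)
    (h₂ : IsProlongation (contactSystem H F) V ζ₂) : ζ₁ = ζ₂ := by
  rw [← sub_eq_zero]
  refine eq_zero_of_mem_symmetryAlgebra_contactSystem h (sub_mem h₁.1 h₂.1) fun u hu => ?_
  funext i
  have e := (congrFun (h₁.2 u hu) i).trans (congrFun (h₂.2 u hu) i).symm
  exact sub_eq_zero.2 e

theorem isProlongation_prolongedDistribution235_unique (h : IsAdmissible T H F)
    {V : SmoothVF 𝕜 (domain235 T)} {ζ₁ ζ₂ : SmoothVF 𝕜 (prolongedDomain235 T)}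
    (h₁ : IsProlongation (prolongedDistribution235 H) V ζ₁)
    (h₂ : IsProlongation (prolongedDistribution235 H) V ζ₂) : ζ₁ = ζ₂ := by
  rw [← sub_eq_zero]
  refine eq_zero_of_mem_symmetryAlgebra_prolongedDistribution235 h (sub_mem h₁.1 h₂.1)
    fun u hu => ?_
  funext i
  have e := (congrFun (h₁.2 u hu) i).trans (congrFun (h₂.2 u hu) i).symm
  exact sub_eq_zero.2 e

/-- The vector fields `ξ` and `V` correspond under the double fibration: they have prolongations
which are matched by the double fibration transform. -/
def IsTransform (T : Opens 𝕜) (H F : 𝕜 → 𝕜) (ξ : SmoothVF 𝕜 (⊤ : Opens (Fin 5 → 𝕜)))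
    (V : SmoothVF 𝕜 (domain235 T)) : Prop :=
  ∃ (ζ : SmoothVF 𝕜 (contactDomain T)) (ζ' : SmoothVF 𝕜 (prolongedDomain235 T)),
    IsProlongation (contactSystem H F) ξ ζ ∧ IsProlongation (prolongedDistribution235 H) V ζ' ∧
    SmoothVF.Related (doubleFibrationMap H F) ζ ζ'

namespace IsTransform

variable {ξ ξ₁ ξ₂ : SmoothVF 𝕜 (⊤ : Opens (Fin 5 → 𝕜))} {V V₁ V₂ : SmoothVF 𝕜 (domain235 T)}

theorem add (h₁ : IsTransform T H F ξ₁ V₁) (h₂ : IsTransform T H F ξ₂ V₂) :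
    IsTransform T H F (ξ₁ + ξ₂) (V₁ + V₂) := by
  obtain ⟨ζ₁, η₁, a₁, b₁, c₁⟩ := h₁
  obtain ⟨ζ₂, η₂, a₂, b₂, c₂⟩ := h₂
  rw [isProlongation_iff_related] at a₁ a₂ b₁ b₂
  refine ⟨ζ₁ + ζ₂, η₁ + η₂, ?_, ?_, c₁.add c₂⟩ <;> rw [isProlongation_iff_related]
  · exact ⟨add_mem a₁.1 a₂.1, a₁.2.add a₂.2⟩
  · exact ⟨add_mem b₁.1 b₂.1, b₁.2.add b₂.2⟩

theorem smul (c : 𝕜) (h : IsTransform T H F ξ V) : IsTransform T H F (c • ξ) (c • V) := by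
  obtain ⟨ζ₁, η₁, a₁, b₁, c₁⟩ := h
  rw [isProlongation_iff_related] at a₁ b₁
  refine ⟨c • ζ₁, c • η₁, ?_, ?_, c₁.smul c⟩ <;> rw [isProlongation_iff_related]
  · exact ⟨(symmetryAlgebra _ _).smul_mem c a₁.1, a₁.2.smul c⟩
  · exact ⟨(symmetryAlgebra _ _).smul_mem c b₁.1, b₁.2.smul c⟩

theorem sub (h₁ : IsTransform T H F ξ₁ V₁) (h₂ : IsTransform T H F ξ₂ V₂) :
    IsTransform T H F (ξ₁ - ξ₂) (V₁ - V₂) := by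
  have := h₁.add (h₂.smul (-1))
  simpa [sub_eq_add_neg] using this

theorem lie (h : IsAdmissible T H F) (h₁ : IsTransform T H F ξ₁ V₁)
    (h₂ : IsTransform T H F ξ₂ V₂) : IsTransform T H F ⁅ξ₁, ξ₂⁆ ⁅V₁, V₂⁆ := by
  obtain ⟨ζ₁, η₁, a₁, b₁, c₁⟩ := h₁
  obtain ⟨ζ₂, η₂, a₂, b₂, c₂⟩ := h₂
  rw [isProlongation_iff_related] at a₁ a₂ b₁ b₂
  refine ⟨⁅ζ₁, ζ₂⁆, ⁅η₁, η₂⁆, ?_, ?_,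
    c₁.lie (contDiffOn_doubleFibrationMap h) mapsTo_doubleFibrationMap c₂⟩ <;>
    rw [isProlongation_iff_related]
  · exact ⟨(symmetryAlgebra _ _).lie_mem a₁.1 a₂.1,
      a₁.2.lie contDiff_forgetFibre.contDiffOn (fun _ _ => trivial) a₂.2⟩
  · exact ⟨(symmetryAlgebra _ _).lie_mem b₁.1 b₂.1,
      b₁.2.lie contDiff_forgetFibre.contDiffOn (fun _ hw => hw) b₂.2⟩

theorem mem_symmetryAlgebra (h : IsAdmissible T H F) (hV : IsTransform T H F ξ V) :
    V ∈ symmetryAlgebra (distribution235 H) (domain235 T) := by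
  obtain ⟨ζ, η, a, b, c⟩ := hV
  exact mem_symmetryAlgebra_distribution235_of_lift h b.1 b.2

/-- The prolongation of 0 is 0, and every point over M_T is in the image of Φ, so the vanishing
passes to the prolongation of V and then to V. -/
theorem eq_zero_right (h : IsAdmissible T H F) (hV : IsTransform T H F 0 V) : V = 0 := by
  obtain ⟨ζ, η, a, b, c⟩ := hV
  have hζ : ζ = 0 := eq_zero_of_mem_symmetryAlgebra_contactSystem h a.1 a.2
  refine SmoothVF.ext_on fun m hm => ?_
  obtain ⟨w, hw, -⟩ := exists_forgetFibre_eq m 0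
  have hw' : w ∈ prolongedDomain235 T := by
    rw [← hw] at hm
    exact hm
  have h1 := c _ (mapsTo_doubleFibrationInv (H := H) (F := F) hw')
  rw [(invOn_doubleFibrationInv h).2 hw', hζ] at h1
  have h2 : η.1 w = 0 := h1.symm.trans (map_zero _)
  have h3 := b.2 w hw'
  rw [hw, h2] at h3
  rw [← h3]
  rfl

/-- The field ξ lives on all of J, so T must be nonempty for a point of R_T to lie over each point
of J. There the derivative of Φ is injective. -/
theorem eq_zero_left (h : IsAdmissible T H F) (hT : (T : Set 𝕜).Nonempty)
    (hV : IsTransform T H F ξ 0) : ξ = 0 := by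
  obtain ⟨ζ, η, a, b, c⟩ := hV
  have hη : η = 0 := eq_zero_of_mem_symmetryAlgebra_prolongedDistribution235 h b.1 b.2
  refine SmoothVF.ext_on fun m _ => ?_
  obtain ⟨t, ht⟩ := hT
  obtain ⟨u, hu, hu5⟩ := exists_forgetFibre_eq m t
  have hu' : u ∈ contactDomain T := by
    change u 5 ∈ T
    rw [hu5]
    exact ht
  have h1 : fderiv 𝕜 (doubleFibrationMap H F) u (ζ.1 u) = 0 := by
    rw [c u hu', hη]
    rfl
  have h2 : ζ.1 u = 0 := by
    have e := fderiv_fderiv_of_invOn (contDiffOn_doubleFibrationInv h)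
      (contDiffOn_doubleFibrationMap h) mapsTo_doubleFibrationMap
      (invOn_doubleFibrationInv h).1 hu' (ζ.1 u)
    rw [← e, h1, map_zero]
  have h3 := a.2 u hu'
  rw [hu, h2] at h3
  rw [← h3]
  rfl

/-- A vector field which is compatible with the integral curves of `lineField` has a transform. -/
theorem exists_of_isLineCompatible (h : IsAdmissible T H F)
    (hc : IsLineCompatible T H F ξ.1) : ∃ V, IsTransform T H F ξ V := by
  have hξ : ContDiff 𝕜 ∞ ξ.1 := contDiffOn_univ.1 ξ.2.1
  have hf := contDiffOn_doubleFibrationMap h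
  have hg := contDiffOn_doubleFibrationInv h
  set ζ := contactLiftVF h hξ with hζ
  set η := SmoothVF.push hf hg mapsTo_doubleFibrationInv ζ with hη
  have hflow : ∀ w ∈ prolongedDomain235 T, ∀ w' ∈ prolongedDomain235 T,
      forgetFibre w = forgetFibre w' → forgetFibre (η.1 w) = forgetFibre (η.1 w') := by
    intro w hw w' hw' hww
    -- Two points of the same fibre over M_T are joined by the line flow; the time is the difference
    -- in L divided by the rate H_tt / 8.
    have key : doubleFibrationInv H F w' = lineFlow H F
        ((w' 5 - w 5) / (1 / 8 * deriv (deriv H) (-(w 0) / 2))) (doubleFibrationInv H F w) := by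
      set u := doubleFibrationInv H F w with hu
      have hu' : u ∈ contactDomain T := mapsTo_doubleFibrationInv hw
      have u5 : u 5 = -(w 0) / 2 := rfl
      have hn : 1 / 8 * deriv (deriv H) (-(w 0) / 2) ≠ 0 :=
        mul_ne_zero (by norm_num) (h.ne_zero _ hw)
      rw [← (invOn_doubleFibrationInv h).1 (x := lineFlow H F _ u) hu',
        doubleFibrationMap_lineFlow, u5, div_mul_cancel₀ _ hn, hu,
        (invOn_doubleFibrationInv h).2 hw]
      congr 1
      funext i
      refine Fin.lastCases ?_ (fun j => ?_) i
      · change w' 5 = w 5 + (w' 5 - w 5) * fibreField 𝕜 _ 5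
        simp [fibreField]
      · have hj : fibreField 𝕜 w j.castSucc = 0 := by fin_cases j <;> rfl
        change w' j.castSucc = w j.castSucc + (w' 5 - w 5) * fibreField 𝕜 w j.castSucc
        rw [hj, mul_zero, add_zero]
        exact (congrFun hww j).symm
    have e : ∀ w ∈ prolongedDomain235 T, η.1 w = fderiv 𝕜 (doubleFibrationMap H F)
        (doubleFibrationInv H F w) (contactLift H F ξ.1 (doubleFibrationInv H F w)) := by
      intro w hw
      rw [hη, SmoothVF.push, SmoothVF.ofContDiffOn_apply _ hw, hζ, contactLiftVF,
        SmoothVF.ofContDiffOn_apply _ (mapsTo_doubleFibrationInv hw)]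
    rw [e w hw, e w' hw', key]
    exact (fderiv_contactLift_flow h hc (u := doubleFibrationInv H F w) hw _).symm
  -- The field on M_T is read off along the section L = 0; constancy along the fibres makes this
  -- choice immaterial.
  let σ : (Fin 5 → 𝕜) → Fin 6 → 𝕜 := fun m => ![m 0, m 1, m 2, m 3, m 4, 0]
  have hσ : ContDiff 𝕜 ∞ σ := by
    rw [contDiff_pi]
    intro i
    fin_cases i <;> simp [σ] <;> fun_prop
  have hσf : ∀ m, forgetFibre (σ m) = m := fun m => by
    funext i
    fin_cases i <;> rfl
  have hσm : MapsTo σ (domain235 T) (prolongedDomain235 T) := fun _ hm => hm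
  have hV : ContDiffOn 𝕜 ∞ (fun m => forgetFibre (η.1 (σ m))) (domain235 T) :=
    contDiff_forgetFibre.comp_contDiffOn (η.2.1.comp hσ.contDiffOn hσm)
  refine ⟨SmoothVF.ofContDiffOn _ hV, ζ, η, ⟨contactLiftVF_mem_symmetryAlgebra h hξ hc, ?_⟩,
    ⟨?_, ?_⟩, SmoothVF.related_push hf hg mapsTo_doubleFibrationMap mapsTo_doubleFibrationInv
      (invOn_doubleFibrationInv h).1 ζ⟩
  · intro u hu
    rw [hζ, contactLiftVF, SmoothVF.ofContDiffOn_apply _ hu, forgetFibre_contactLift]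
  · exact SmoothVF.push_mem_symmetryAlgebra hf hg mapsTo_doubleFibrationMap
      mapsTo_doubleFibrationInv (invOn_doubleFibrationInv h).1 (invOn_doubleFibrationInv h).2
      (fun u hu => map_contactSystem h hu) (contactLiftVF_mem_symmetryAlgebra h hξ hc)
  · intro w hw
    have hm : forgetFibre w ∈ domain235 T := hw
    rw [SmoothVF.ofContDiffOn_apply _ hm]
    exact hflow w hw _ (hσm hm) (hσf _).symm

end IsTransform

end Transforms

end

noncomputable section

/-! ### The generator on J of a symmetry of D₁. -/

section Generating

variable {𝕜 : Type*} [RCLike 𝕜] {T : Opens 𝕜} {H F : 𝕜 → 𝕜}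

theorem deriv_inv_inX (h : IsAdmissible T H F) {X : 𝕜} (hX : -X / 2 ∈ T) :
    deriv (fun X => (deriv (deriv (inX H)) X)⁻¹) X =
      2 * deriv (deriv (deriv H)) (-X / 2) / deriv (deriv H) (-X / 2) ^ 2 := by
  have e : (fun X => (deriv (deriv (inX H)) X)⁻¹) =
      fun X => (1 / 4 * deriv (deriv H) (-X / 2))⁻¹ := by
    funext X
    rw [deriv_deriv_inX]
  have h2 := h.ne_zero _ hX
  have d1 : HasDerivAt (fun X : 𝕜 => -X / 2) (-1 / 2) X := (hasDerivAt_id X).neg.div_const 2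
  have d2 := (IsAdmissible.hasDerivAt_of_contDiffOn h.contDiffOn_deriv₂ hX).comp X d1
  have d3 : HasDerivAt (fun X => (1 / 4 * deriv (deriv H) (-X / 2))⁻¹) _ X :=
    (d2.const_mul (1 / 4)).fun_inv (mul_ne_zero (by norm_num) h2)
  rw [e, d3.deriv]
  simp only [Function.comp_apply]
  field_simp
  ring

/-- The equations satisfied by a symmetry of `D₁`. -/
theorem symmetry_equations (h : IsAdmissible T H F) {V : SmoothVF 𝕜 (domain235 T)}
    (hV : V ∈ symmetryAlgebra (distribution235 H) (domain235 T)) {m : Fin 5 → 𝕜}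
    (hm : m ∈ domain235 T) {a b : Fin 5 → 𝕜} {k k' : 𝕜}
    (ha : a = fderiv 𝕜 V.1 m (mongeField H m)) (hb : b = fderiv 𝕜 V.1 m (topField 𝕜 m))
    (hk : k = (deriv (deriv (inX H)) (m 0))⁻¹)
    (hk' : k' = deriv (fun X => (deriv (deriv (inX H)) X)⁻¹) (m 0)) :
    (b 1 = m 3 * b 0 ∧ b 2 = m 4 ^ 2 * k * b 0 ∧ b 3 = m 4 * b 0) ∧
    (a 1 = V.1 m 3 + m 3 * a 0 ∧
      a 2 = 2 * m 4 * k * V.1 m 4 + m 4 ^ 2 * k' * V.1 m 0 + m 4 ^ 2 * k * a 0 ∧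
      a 3 = V.1 m 4 + m 4 * a 0) := by
  obtain ⟨h1, h2⟩ := (mem_symmetryAlgebra_distribution235_iff h V).1 hV m hm
  rw [mem_distribution235_iff'] at h1 h2
  have ht : fderiv 𝕜 (topField 𝕜) m = 0 := fderiv_const_apply _
  simp only [VectorField.lieBracket, ht, fderiv_mongeField h hm, Pi.sub_apply, zero_apply,
    Pi.zero_apply, Matrix.cons_val, ← ha, ← hb, div_eq_mul_inv, ← hk, ← hk'] at h1 h2
  obtain ⟨a1, a2, a3⟩ := h1
  obtain ⟨b1, b2, b3⟩ := h2
  refine ⟨⟨?_, ?_, ?_⟩, ?_, ?_, ?_⟩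
  · linear_combination -b1
  · linear_combination -b2
  · linear_combination -b3
  · linear_combination -a1
  · linear_combination -a2
  · linear_combination -a3

/-- The value of the contact form `dz - p dx - q dy` on the vector fields which project to the
vector field `V` on the `(2,3,5)` side. -/
def transformedGenerator (H F : 𝕜 → 𝕜) (V : (Fin 5 → 𝕜) → Fin 5 → 𝕜) (u : Fin 6 → 𝕜) : 𝕜 :=
  let m := forgetFibre (doubleFibrationMap H F u)
  let k := (deriv (deriv (inX H)) (m 0))⁻¹
  -- This is ϖ written in the coordinates (X, Y, Z, P, Q), with 2Q / H_XX = 2(y - t x). Neither dQ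
  -- nor dL occurs, so no prolongation of V enters.
  V m 2 + m 4 ^ 2 * k * V m 0 - 2 * m 4 * k * V m 3 + u 0 * (V m 1 - m 3 * V m 0)

theorem contDiffOn_transformedGenerator (h : IsAdmissible T H F) (V : SmoothVF 𝕜 (domain235 T)) :
    ContDiffOn 𝕜 ∞ (transformedGenerator H F V.1) (contactDomain T) := by
  have hf := contDiffOn_doubleFibrationMap h
  have hψ : ContDiffOn 𝕜 ∞ (fun u => forgetFibre (doubleFibrationMap H F u)) (contactDomain T) :=
    contDiff_forgetFibre.comp_contDiffOn hf
  have hm : ∀ j, ContDiffOn 𝕜 ∞ (fun u => forgetFibre (doubleFibrationMap H F u) j)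
      (contactDomain T) := fun j => contDiffOn_pi.1 hψ j
  have hmaps : MapsTo (fun u => forgetFibre (doubleFibrationMap H F u)) (contactDomain T)
      (domain235 T) := fun u hu => mapsTo_doubleFibrationMap (H := H) (F := F) hu
  have hv : ∀ j, ContDiffOn 𝕜 ∞ (fun u => V.1 (forgetFibre (doubleFibrationMap H F u)) j)
      (contactDomain T) := fun j => contDiffOn_pi.1 (V.2.1.comp hψ hmaps) j
  have hk : ContDiffOn 𝕜 ∞ (fun u =>
      (deriv (deriv (inX H)) (forgetFibre (doubleFibrationMap H F u) 0))⁻¹) (contactDomain T) :=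
    (contDiffOn_inv_inX h).comp (hm 0) fun u hu => hmaps hu
  have hu0 : ContDiffOn 𝕜 ∞ (fun u : Fin 6 → 𝕜 => u 0) (contactDomain T) :=
    (contDiff_apply 𝕜 𝕜 0).contDiffOn
  exact ((((hv 2).add ((((hm 4).pow 2).mul hk).mul (hv 0))).sub
    (((contDiffOn_const.mul (hm 4)).mul hk).mul (hv 3)))).add
    (hu0.mul ((hv 1).sub ((hm 3).mul (hv 0))))

/-- The generator of a symmetry does not depend on the fibre coordinate `t`. -/
theorem fderiv_transformedGenerator_fibreField (h : IsAdmissible T H F)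
    {V : SmoothVF 𝕜 (domain235 T)}
    (hV : V ∈ symmetryAlgebra (distribution235 H) (domain235 T)) {u : Fin 6 → 𝕜}
    (hu : u ∈ contactDomain T) :
    fderiv 𝕜 (transformedGenerator H F V.1) u (fibreField 𝕜 u) = 0 := by
  have hu' : u 5 ∈ T := hu
  have hU := (contactDomain T).isOpen.mem_nhds hu
  have dG : DifferentiableAt 𝕜 (transformedGenerator H F V.1) u :=
    ((contDiffOn_transformedGenerator h V).contDiffAt hU).differentiableAt (by simp)
  have dΦ : DifferentiableAt 𝕜 (doubleFibrationMap H F) u :=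
    ((contDiffOn_doubleFibrationMap h).contDiffAt hU).differentiableAt (by simp)
  have hline : HasDerivAt (fun s : 𝕜 => u + s • fibreField 𝕜 u) (fibreField 𝕜 u) 0 := by
    simpa using ((hasDerivAt_id (0 : 𝕜)).smul_const (fibreField 𝕜 u)).const_add u
  have hl0 : u + (0 : 𝕜) • fibreField 𝕜 u = u := by simp
  set w := doubleFibrationMap H F u with hw
  have hwm : w ∈ prolongedDomain235 T := mapsTo_doubleFibrationMap hu
  set m := forgetFibre w with hm
  have hmm : m ∈ domain235 T := hwm
  set ψ : 𝕜 → Fin 5 → 𝕜 :=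
    fun s => forgetFibre (doubleFibrationMap H F (u + s • fibreField 𝕜 u)) with hψ
  have hψ0 : ψ 0 = m := by rw [hψ]; simp only [hl0, hm, hw]
  have hw5 : w 5 = 1 / 8 * (deriv (deriv (deriv H)) (u 5) * (u 5 * u 0 - u 1) +
      deriv (deriv H) (u 5) * u 0) := rfl
  -- Moving t moves the image point inside D₁, along -2 times the total derivative plus L ∂_Q; the
  -- symmetry equations therefore control the derivatives of V that occur.
  have dψ : HasDerivAt ψ ((-2 : 𝕜) • (mongeField H m + w 5 • topField 𝕜 m)) 0 := by
    have h1 : HasFDerivAt (doubleFibrationMap H F) (fderiv 𝕜 (doubleFibrationMap H F) u)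
        (u + (0 : 𝕜) • fibreField 𝕜 u) := by
      rw [hl0]
      exact dΦ.hasFDerivAt
    have h2 := (hasFDerivAt_forgetFibre _).comp_hasDerivAt (0 : 𝕜)
      (h1.comp_hasDerivAt (0 : 𝕜) hline)
    refine HasDerivAt.congr_deriv h2 ?_
    rw [fderiv_doubleFibrationMap_fibreField h hu', forgetFibreL_apply, ← hw]
    funext j
    fin_cases j <;>
      simp [forgetFibre, prolongedMongeField, fibreField, mongeField, topField, hm]
  have dV : HasDerivAt (fun s => V.1 (ψ s))
      ((-2 : 𝕜) • (fderiv 𝕜 V.1 m (mongeField H m) + w 5 • fderiv 𝕜 V.1 m (topField 𝕜 m))) 0 := by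
    have h1 : HasFDerivAt V.1 (fderiv 𝕜 V.1 m) (ψ 0) := by
      rw [hψ0]
      exact (SmoothVF.differentiableAt V hmm).hasFDerivAt
    refine HasDerivAt.congr_deriv (h1.comp_hasDerivAt (0 : 𝕜) dψ) ?_
    simp
  set a := fderiv 𝕜 V.1 m (mongeField H m) with ha
  set b := fderiv 𝕜 V.1 m (topField 𝕜 m) with hb
  have dk : HasDerivAt (fun s => (deriv (deriv (inX H)) (ψ s 0))⁻¹)
      (deriv (fun X => (deriv (deriv (inX H)) X)⁻¹) (m 0) * -2) 0 := by
    have h1 : HasDerivAt (fun X => (deriv (deriv (inX H)) X)⁻¹)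
        (deriv (fun X => (deriv (deriv (inX H)) X)⁻¹) (m 0)) (ψ 0 0) := by
      rw [hψ0]
      exact hasDerivAt_inv_inX h hmm
    have h2 : HasDerivAt ((fun X => (deriv (deriv (inX H)) X)⁻¹) ∘ fun s => ψ s 0) _ 0 :=
      h1.comp (0 : 𝕜) (hasDerivAt_pi.1 dψ 0)
    refine HasDerivAt.congr_deriv h2 ?_
    simp [mongeField, topField]
  have dc := hasDerivAt_pi.1 dψ
  have dv := hasDerivAt_pi.1 dV
  have hx : ∀ s : 𝕜, (u + s • fibreField 𝕜 u) 0 = u 0 := fun s => by simp [fibreField]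
  have e : (fun s : 𝕜 => transformedGenerator H F V.1 (u + s • fibreField 𝕜 u)) = fun s =>
      V.1 (ψ s) 2 + ψ s 4 ^ 2 * (deriv (deriv (inX H)) (ψ s 0))⁻¹ * V.1 (ψ s) 0 -
      2 * ψ s 4 * (deriv (deriv (inX H)) (ψ s 0))⁻¹ * V.1 (ψ s) 3 +
      u 0 * (V.1 (ψ s) 1 - ψ s 3 * V.1 (ψ s) 0) := by
    funext s
    simp only [transformedGenerator, hx, hψ]
  have key := (((dv 2).fun_add ((((dc 4).fun_pow 2).fun_mul dk).fun_mul (dv 0))).fun_sub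
    ((((dc 4).const_mul 2).fun_mul dk).fun_mul (dv 3))).fun_add
    (((dv 1).fun_sub ((dc 3).fun_mul (dv 0))).const_mul (u 0))
  rw [← e] at key
  rw [← dG.lineDeriv_eq_fderiv, HasLineDerivAt.lineDeriv key]
  obtain ⟨⟨b1, b2, b3⟩, a1, a2, a3⟩ := symmetry_equations h hV hmm ha hb rfl rfl
  have h2 := h.ne_zero _ hu'
  have m0 : -(m 0) / 2 = u 5 := by
    change -(-2 * u 5) / 2 = u 5
    ring
  have m4 : m 4 = 1 / 4 * deriv (deriv H) (u 5) * (u 1 - u 5 * u 0) := rfl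
  -- This says that x is the total X-derivative of 2Q / H_XX = 2(y - t x), taken with x and y fixed
  -- and t = -X/2.
  have key2 : u 0 - 2 * w 5 * (deriv (deriv (inX H)) (m 0))⁻¹ -
      2 * m 4 * deriv (fun X => (deriv (deriv (inX H)) X)⁻¹) (m 0) = 0 := by
    rw [deriv_inv_inX h hmm, deriv_deriv_inX, m0, hw5, m4]
    field_simp
    ring
  simp only [hψ0]
  have t3 : ((-2 : 𝕜) • (mongeField H m + w 5 • topField 𝕜 m)) 3 = -2 * m 4 := by
    simp [mongeField, topField]
  have t4 : ((-2 : 𝕜) • (mongeField H m + w 5 • topField 𝕜 m)) 4 = -2 * w 5 := by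
    simp [mongeField, topField]
  have tv : ∀ j, ((-2 : 𝕜) • (a + w 5 • b)) j = -2 * (a j + w 5 * b j) := fun j => by simp
  rw [t3, t4, tv, tv, tv, tv, a1, a2, a3, b1, b2, b3]
  push_cast
  linear_combination (-2 * (V.1 m 3 - m 4 * V.1 m 0)) * key2

/-- The point of M_T is fixed along a line, and the generator depends on the position along the line
only through the explicit factor x. -/
theorem transformedGenerator_lineFlow (V : (Fin 5 → 𝕜) → Fin 5 → 𝕜) (u : Fin 6 → 𝕜) (s : 𝕜) :
    transformedGenerator H F V (lineFlow H F s u) = transformedGenerator H F V u +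
      s * (V (forgetFibre (doubleFibrationMap H F u)) 1 -
        forgetFibre (doubleFibrationMap H F u) 3 *
          V (forgetFibre (doubleFibrationMap H F u)) 0) := by
  have e : forgetFibre (doubleFibrationMap H F (lineFlow H F s u)) =
      forgetFibre (doubleFibrationMap H F u) := by
    rw [doubleFibrationMap_lineFlow]
    funext j
    fin_cases j <;> simp [forgetFibre, fibreField]
  have e0 : lineFlow H F s u 0 = u 0 + s := rfl
  simp only [transformedGenerator, e, e0]
  ring

/-- The t-derivative vanishes and T is open and connected, so the generator descends to a function
on J. -/
theorem transformedGenerator_eq_of_forgetFibre_eq (h : IsAdmissible T H F)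
    (hT : IsPreconnected (T : Set 𝕜)) {V : SmoothVF 𝕜 (domain235 T)}
    (hV : V ∈ symmetryAlgebra (distribution235 H) (domain235 T)) {u u' : Fin 6 → 𝕜}
    (hu : u ∈ contactDomain T) (hu' : u' ∈ contactDomain T)
    (huu : forgetFibre u = forgetFibre u') :
    transformedGenerator H F V.1 u = transformedGenerator H F V.1 u' := by
  let γ : 𝕜 → Fin 6 → 𝕜 := fun t => ![u 0, u 1, u 2, u 3, u 4, t]
  have hγ : ∀ t, HasDerivAt γ (fibreField 𝕜 (γ t)) t := by
    intro t
    rw [hasDerivAt_pi]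
    intro i
    fin_cases i
    · exact hasDerivAt_const _ _
    · exact hasDerivAt_const _ _
    · exact hasDerivAt_const _ _
    · exact hasDerivAt_const _ _
    · exact hasDerivAt_const _ _
    · exact hasDerivAt_id _
  have hd : ∀ t ∈ T, HasDerivAt (fun t => transformedGenerator H F V.1 (γ t)) 0 t := by
    intro t ht
    have hm : γ t ∈ contactDomain T := ht
    have dG : DifferentiableAt 𝕜 (transformedGenerator H F V.1) (γ t) :=
      ((contDiffOn_transformedGenerator h V).contDiffAt
        ((contactDomain T).isOpen.mem_nhds hm)).differentiableAt (by simp)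
    rw [← fderiv_transformedGenerator_fibreField h hV hm]
    exact dG.hasFDerivAt.comp_hasDerivAt t (hγ t)
  have hc := IsOpen.is_const_of_deriv_eq_zero T.isOpen hT
    (f := fun t => transformedGenerator H F V.1 (γ t))
    (fun t ht => (hd t ht).differentiableAt.differentiableWithinAt)
    (fun t ht => (hd t ht).deriv) hu hu'
  have e1 : γ (u 5) = u := by
    funext i
    fin_cases i <;> rfl
  have e2 : γ (u' 5) = u' := by
    funext i
    refine Fin.lastCases rfl (fun j => ?_) i
    fin_cases j
    · exact congrFun huu 0
    · exact congrFun huu 1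
    · exact congrFun huu 2
    · exact congrFun huu 3
    · exact congrFun huu 4
  simpa only [e1, e2] using hc

/-- A symmetry of `D₁` is determined by its generator. -/
theorem eq_zero_of_transformedGenerator_eq_zero (h : IsAdmissible T H F)
    {V : SmoothVF 𝕜 (domain235 T)}
    (hV : V ∈ symmetryAlgebra (distribution235 H) (domain235 T))
    (h0 : ∀ u ∈ contactDomain T, transformedGenerator H F V.1 u = 0) : V = 0 := by
  -- The generator is affine in x over each point of M_T, so its vanishing gives two equations: the
  -- slope and the constant term are both zero.
  have hβ : ∀ m ∈ domain235 T, V.1 m 1 - m 3 * V.1 m 0 = 0 ∧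
      V.1 m 2 + m 4 ^ 2 * (deriv (deriv (inX H)) (m 0))⁻¹ * V.1 m 0 -
        2 * m 4 * (deriv (deriv (inX H)) (m 0))⁻¹ * V.1 m 3 = 0 := by
    intro m hm
    obtain ⟨w, hw, -⟩ := exists_forgetFibre_eq m 0
    have hwm : w ∈ prolongedDomain235 T := by
      rw [← hw] at hm
      exact hm
    set u := doubleFibrationInv H F w with hu
    have hum : u ∈ contactDomain T := mapsTo_doubleFibrationInv hwm
    have hm' : forgetFibre (doubleFibrationMap H F u) = m := by
      rw [hu, (invOn_doubleFibrationInv h).2 hwm, hw]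
    have h1 := transformedGenerator_lineFlow (H := H) (F := F) V.1 u 1
    rw [h0 _ hum, h0 (lineFlow H F 1 u) hum, hm'] at h1
    have h2 := h0 u hum
    simp only [transformedGenerator, hm'] at h2
    have h3 : V.1 m 1 - m 3 * V.1 m 0 = 0 := by linear_combination -h1
    exact ⟨h3, by linear_combination h2 - u 0 * h3⟩
  have hd : ∀ i j : Fin 5, (∀ m ∈ domain235 T, V.1 m j - m i * V.1 m 0 = 0) →
      ∀ m ∈ domain235 T, ∀ v : Fin 5 → 𝕜,
        fderiv 𝕜 V.1 m v j = v i * V.1 m 0 + m i * fderiv 𝕜 V.1 m v 0 := by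
    intro i j hij m hm v
    have line : HasDerivAt (fun s : 𝕜 => m + s • v) v 0 := by
      simpa using ((hasDerivAt_id (0 : 𝕜)).smul_const v).const_add m
    have l0 : m + (0 : 𝕜) • v = m := by simp
    have dV : ∀ j, HasDerivAt (fun s : 𝕜 => V.1 (m + s • v) j) (fderiv 𝕜 V.1 m v j) 0 := by
      have h1 : HasFDerivAt V.1 (fderiv 𝕜 V.1 m) (m + (0 : 𝕜) • v) := by
        rw [l0]
        exact (SmoothVF.differentiableAt V hm).hasFDerivAt
      exact hasDerivAt_pi.1 (h1.comp_hasDerivAt (0 : 𝕜) line)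
    have d1 := (dV j).fun_sub ((hasDerivAt_line m v i).fun_mul (dV 0))
    have hev : (fun s : 𝕜 => V.1 (m + s • v) j - (m i + s * v i) * V.1 (m + s • v) 0) =ᶠ[nhds 0]
        fun _ => 0 := by
      have hc := line.continuousAt
      rw [ContinuousAt, l0] at hc
      filter_upwards [hc ((domain235 T).isOpen.mem_nhds hm)] with s hs using hij _ hs
    have d2 := d1.unique ((hasDerivAt_const (0 : 𝕜) (0 : 𝕜)).congr_of_eventuallyEq hev)
    simp only [l0, zero_mul, add_zero] at d2
    linear_combination d2
  -- Differentiating V_Y = P V_X along the total derivative and comparing with the symmetry equation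
  -- for the Y-component gives V_P = Q V_X.
  have hβ₃ : ∀ m ∈ domain235 T, V.1 m 3 - m 4 * V.1 m 0 = 0 := by
    intro m hm
    have h1 := hd 3 1 (fun m hm => (hβ m hm).1) m hm (mongeField H m)
    obtain ⟨-, a1, -, -⟩ := symmetry_equations h hV hm rfl rfl rfl rfl
    have h2 : mongeField H m 3 = m 4 := rfl
    rw [h2] at h1
    linear_combination h1 - a1
  refine SmoothVF.ext_on fun m hm => ?_
  obtain ⟨⟨-, -, b3⟩, -, -, a3⟩ := symmetry_equations h hV hm rfl rfl rfl rfl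
  have h1 := hd 4 3 hβ₃ m hm (mongeField H m)
  have h2 := hd 4 3 hβ₃ m hm (topField 𝕜 m)
  have e1 : mongeField H m 4 = 0 := rfl
  have e2 : topField 𝕜 m 4 = 1 := rfl
  rw [e1] at h1
  rw [e2] at h2
  -- Differentiating V_P = Q V_X along ∂_Q forces V_X = 0, and along the total derivative V_Q = 0;
  -- the other components follow.
  have v0 : V.1 m 0 = 0 := by linear_combination b3 - h2
  have v4 : V.1 m 4 = 0 := by linear_combination h1 - a3
  have v3 : V.1 m 3 = 0 := by linear_combination hβ₃ m hm + m 4 * v0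
  have v1 : V.1 m 1 = 0 := by linear_combination (hβ m hm).1 + m 3 * v0
  have v2 : V.1 m 2 = 0 := by
    have := (hβ m hm).2
    rw [v0, v3] at this
    linear_combination this
  funext i
  fin_cases i
  · exact v0
  · exact v1
  · exact v2
  · exact v3
  · exact v4

end Generating

end

noncomputable section

/-! ### The overdetermined system over the Heisenberg algebra of binary cubics. -/

section HeisenbergModule

variable {K M : Type*} [Field K] [CharZero K] [AddCommGroup M] [Module K M]

/-- For operators `eᵢ`, `Z` which satisfy the relations of the Heisenberg algebra of binary cubics,
an element killed by the squares of all `e₀ + r e₁ + r² e₂ + r³ e₃` vanishes if fourteen of its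
derivatives vanish at a point. -/
theorem eq_zero_of_heisenberg_jet (e₀ e₁ e₂ e₃ Z : M →ₗ[K] M) (ev : M →ₗ[K] K)
    (hev : ∀ g, e₀ g = 0 → e₁ g = 0 → e₂ g = 0 → e₃ g = 0 → ev g = 0 → g = 0)
    (c01 : ∀ g, e₁ (e₀ g) = e₀ (e₁ g)) (c02 : ∀ g, e₂ (e₀ g) = e₀ (e₂ g))
    (c13 : ∀ g, e₃ (e₁ g) = e₁ (e₃ g)) (c23 : ∀ g, e₃ (e₂ g) = e₂ (e₃ g))
    (c03 : ∀ g, e₃ (e₀ g) = e₀ (e₃ g) - Z g) (c12 : ∀ g, e₂ (e₁ g) = e₁ (e₂ g) + (3 : K) • Z g)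
    (z0 : ∀ g, Z (e₀ g) = e₀ (Z g)) (z1 : ∀ g, Z (e₁ g) = e₁ (Z g))
    (z2 : ∀ g, Z (e₂ g) = e₂ (Z g)) (z3 : ∀ g, Z (e₃ g) = e₃ (Z g)) (f : M)
    (R0 : e₀ (e₀ f) = 0) (R1 : e₀ (e₁ f) = 0) (R2 : e₁ (e₁ f) = (-2 : K) • e₀ (e₂ f))
    (R3 : e₁ (e₂ f) = -e₀ (e₃ f) - Z f) (R4 : e₂ (e₂ f) = (-2 : K) • e₁ (e₃ f))
    (R5 : e₂ (e₃ f) = 0) (R6 : e₃ (e₃ f) = 0)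
    (v : ev f = 0) (v0 : ev (e₀ f) = 0) (v1 : ev (e₁ f) = 0) (v2 : ev (e₂ f) = 0)
    (v3 : ev (e₃ f) = 0) (va : ev (e₀ (e₂ f)) = 0) (vb : ev (e₁ (e₃ f)) = 0)
    (vc : ev (e₀ (e₃ f)) = 0) (vd : ev (Z f) = 0) (vd0 : ev (e₀ (Z f)) = 0)
    (vd1 : ev (e₁ (Z f)) = 0) (vd2 : ev (e₂ (Z f)) = 0) (vd3 : ev (e₃ (Z f)) = 0)
    (vD : ev (Z (Z f)) = 0) : f = 0 := by
  have two : ∀ g : M, (2 : K) • g = 0 → g = 0 := fun g hg =>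
    (smul_eq_zero.1 hg).resolve_left two_ne_zero
  -- All second derivatives of f are combinations of a, b, c and d, and all first derivatives of a,
  -- b, c turn out to be combinations of first derivatives of d. It remains to close the system for
  -- d.
  obtain ⟨a, ha⟩ : ∃ a, a = e₀ (e₂ f) := ⟨_, rfl⟩
  obtain ⟨b, hb⟩ : ∃ b, b = e₁ (e₃ f) := ⟨_, rfl⟩
  obtain ⟨c, hc⟩ : ∃ c, c = e₀ (e₃ f) := ⟨_, rfl⟩
  obtain ⟨d, hd⟩ : ∃ d, d = Z f := ⟨_, rfl⟩
  have h30 : e₃ (e₀ f) = c - d := by rw [c03, hc, hd]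
  have e0a : e₀ a = 0 := by rw [ha, ← c02, ← c02, R0, map_zero]
  have e0b : e₀ b = e₁ d := by
    have h : e₁ (e₃ (e₀ f)) = 0 := by rw [← c13, c01, R1, map_zero]
    rw [hb, ← c01, ← hc]
    rw [h30, map_sub] at h
    exact sub_eq_zero.1 h
  have e1c : e₁ c = e₁ d := by
    rw [← e0b, hb, ← c01, hc]
  have e0c : e₀ c = (2 : K) • e₀ d := by
    have h : e₃ (e₀ (e₀ f)) = 0 := by rw [R0, map_zero]
    rw [c03, h30, map_sub, z0, ← hd] at h
    linear_combination (norm := module) h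
  have e1a : e₁ a = (-3 : K) • e₀ d := by
    rw [ha, c01, R3, map_sub, map_neg, ← hc, ← hd, e0c]
    module
  have e2a : e₂ a = (-2 : K) • e₁ d := by
    rw [ha, c02, R4, map_smul, ← hb, e0b]
  have e3a : e₃ a = -e₂ d := by
    rw [ha, c03, c23, R5, map_zero, z2, hd, zero_sub]
  have e1b : e₁ b = (2 : K) • e₂ d := by
    rw [hb, ← c13, ← c13, R2, map_smul, ← ha, e3a]
    module
  have e2b : e₂ b = (3 : K) • e₃ d := by
    rw [hb, c12, R5, map_zero, z3, hd, zero_add]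
  have e3b : e₃ b = 0 := by rw [hb, c13, R6, map_zero]
  have e2c : e₂ c = 0 := by rw [hc, c02, R5, map_zero]
  have e3c : e₃ c = -e₃ d := by rw [hc, c03, R6, map_zero, z3, hd, zero_sub]
  have d00 : e₀ (e₀ d) = 0 := by rw [hd, ← z0, ← z0, R0, map_zero]
  have d01 : e₀ (e₁ d) = 0 := by rw [hd, ← z1, ← z0, R1, map_zero]
  have d02 : e₀ (e₂ d) = Z a := by rw [hd, ← z2, ← z0, ha]
  have d03 : e₀ (e₃ d) = Z c := by rw [hd, ← z3, ← z0, hc]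
  have d30 : e₃ (e₀ d) = Z c - Z d := by rw [hd, ← z0, ← z3, h30, map_sub, hd]
  have d13 : e₁ (e₃ d) = Z b := by rw [hd, ← z3, ← z1, hb]
  -- The compatibility conditions: the commutator of e₀ and e₃, applied to a, b and c, determines Z
  -- a, Z b and Z c in terms of Z d.
  have Za : Z a = 0 := by
    have h := c03 a
    rw [e0a, e3a, map_zero, map_neg, d02] at h
    refine two _ ?_
    linear_combination (norm := module) h
  have Zb : Z b = 0 := by
    have h := c03 b
    rw [e0b, e3b, map_zero, c13, d13] at h
    refine two _ ?_
    linear_combination (norm := module) h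
  have Zc : (2 : K) • Z c = Z d := by
    have h := c03 c
    rw [e0c, e3c, map_smul, map_neg, d30, d03] at h
    rw [← sub_eq_zero]
    refine two _ ?_
    linear_combination (norm := module) h
  -- Applying Z to the first derivatives of c and inserting 2 Z c = Z d gives e₀ Z d = 4 e₀ Z d, e₁
  -- Z d = 2 e₁ Z d, e₂ Z d = 0 and e₃ Z d = -2 e₃ Z d. So every eᵢ kills Z d, and `hev` applies.
  have D0 : Z d = 0 := by
    refine hev _ ?_ ?_ ?_ ?_ (by rw [hd]; exact vD)
    · have h := congrArg Z e0c
      have h2 := congrArg e₀ Zc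
      rw [z0, map_smul, z0] at h
      rw [map_smul] at h2
      have h3 : (3 : K) • e₀ (Z d) = 0 := by
        linear_combination (norm := module) (-2 : K) • h + h2
      exact (smul_eq_zero.1 h3).resolve_left three_ne_zero
    · have h := congrArg Z e1c
      have h2 := congrArg e₁ Zc
      rw [z1, z1] at h
      rw [map_smul] at h2
      linear_combination (norm := module) (-2 : K) • h + h2
    · have h := congrArg Z e2c
      have h2 := congrArg e₂ Zc
      rw [z2, map_zero] at h
      rw [map_smul, h, smul_zero] at h2
      exact h2.symm
    · have h := congrArg Z e3c
      have h2 := congrArg e₃ Zc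
      rw [z3, map_neg, z3] at h
      rw [map_smul] at h2
      have h3 : (3 : K) • e₃ (Z d) = 0 := by
        linear_combination (norm := module) (2 : K) • h - h2
      exact (smul_eq_zero.1 h3).resolve_left three_ne_zero
  have Zc0 : Z c = 0 := two _ (Zc.trans D0)
  have h12 : e₁ (e₂ d) = 0 := by
    rw [hd, ← z2, ← z1, R3, map_sub, map_neg, ← hc, ← hd, Zc0, D0]
    simp
  have h22 : e₂ (e₂ d) = 0 := by
    rw [hd, ← z2, ← z2, R4, map_smul, ← hb, Zb, smul_zero]
  have h11 : e₁ (e₁ d) = 0 := by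
    rw [hd, ← z1, ← z1, R2, map_smul, ← ha, Za, smul_zero]
  have h23 : e₂ (e₃ d) = 0 := by rw [hd, ← z3, ← z2, R5, map_zero]
  have h33 : e₃ (e₃ d) = 0 := by rw [hd, ← z3, ← z3, R6, map_zero]
  -- From here the system is integrated backwards. At each level all eᵢ kill the element in question
  -- and its value at the point vanishes: first the eᵢ d, then d, then a, b, c, then the eᵢ f, then
  -- f.
  have d0 : e₀ d = 0 := by
    refine hev _ d00 (by rw [c01, d01]) (by rw [c02, d02, Za]) (by rw [d30, Zc0, D0, sub_zero]) ?_
    rw [hd]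
    exact vd0
  have d1 : e₁ d = 0 := by
    refine hev _ d01 h11 (by rw [c12, h12, D0, smul_zero, add_zero]) (by rw [c13, d13, Zb]) ?_
    rw [hd]
    exact vd1
  have d2 : e₂ d = 0 := by
    refine hev _ (by rw [d02, Za]) h12 h22 (by rw [c23, h23]) ?_
    rw [hd]
    exact vd2
  have d3 : e₃ d = 0 := by
    refine hev _ (by rw [d03, Zc0]) (by rw [d13, Zb]) h23 h33 ?_
    rw [hd]
    exact vd3
  have dz : d = 0 := hev _ d0 d1 d2 d3 (by rw [hd]; exact vd)
  have az : a = 0 := hev _ e0a (by rw [e1a, d0, smul_zero]) (by rw [e2a, d1, smul_zero])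
    (by rw [e3a, d2, neg_zero]) (by rw [ha]; exact va)
  have bz : b = 0 := hev _ (by rw [e0b, d1]) (by rw [e1b, d2, smul_zero])
    (by rw [e2b, d3, smul_zero]) e3b (by rw [hb]; exact vb)
  have cz : c = 0 := hev _ (by rw [e0c, d0, smul_zero]) (by rw [e1c, d1]) e2c
    (by rw [e3c, d3, neg_zero]) (by rw [hc]; exact vc)
  have r12 : e₁ (e₂ f) = 0 := by rw [R3, ← hc, ← hd, cz, dz]; simp
  refine hev _ ?_ ?_ ?_ ?_ v
  · exact hev _ R0 (by rw [c01, R1]) (by rw [c02, ← ha, az]) (by rw [h30, cz, dz, sub_zero]) v0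
  · exact hev _ R1 (by rw [R2, ← ha, az, smul_zero])
      (by rw [c12, r12, ← hd, dz, smul_zero, add_zero]) (by rw [c13, ← hb, bz]) v1
  · exact hev _ (by rw [← ha, az]) r12 (by rw [R4, ← hb, bz, smul_zero]) (by rw [c23, R5]) v2
  · exact hev _ (by rw [← hc, cz]) (by rw [← hb, bz]) R5 R6 v3

end HeisenbergModule

/-! ### Derivations of smooth functions on J along horizontal fields with constant coefficients. -/

section SmoothFunctions

variable {𝕜 : Type*} [RCLike 𝕜]

/-- The smooth functions on `𝕜⁵`. -/
def SmoothFn (𝕜 : Type*) [RCLike 𝕜] : Submodule 𝕜 ((Fin 5 → 𝕜) → 𝕜) where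
  carrier := {f | ContDiff 𝕜 ∞ f}
  add_mem' := fun {f g} (hf : ContDiff 𝕜 ∞ f) (hg : ContDiff 𝕜 ∞ g) => hf.add hg
  zero_mem' := (contDiff_const : ContDiff 𝕜 ∞ fun _ : Fin 5 → 𝕜 => (0 : 𝕜))
  smul_mem' := fun _ f (hf : ContDiff 𝕜 ∞ f) => contDiff_const.smul hf

theorem SmoothFn.contDiff (f : SmoothFn 𝕜) : ContDiff 𝕜 ∞ f.1 := f.2

theorem SmoothFn.differentiableAt (f : SmoothFn 𝕜) (m : Fin 5 → 𝕜) : DifferentiableAt 𝕜 f.1 m :=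
  (SmoothFn.contDiff f).differentiable (by simp) m

/-- The derivative along a smooth vector field. -/
def derAlong (X : (Fin 5 → 𝕜) → Fin 5 → 𝕜) (hX : ContDiff 𝕜 ∞ X) :
    SmoothFn 𝕜 →ₗ[𝕜] SmoothFn 𝕜 where
  toFun f := ⟨fun m => fderiv 𝕜 f.1 m (X m),
    ((contDiff_infty_iff_fderiv.1 f.2).2).clm_apply hX⟩
  map_add' f g := by
    apply Subtype.ext
    funext m
    change fderiv 𝕜 (f.1 + g.1) m (X m) = fderiv 𝕜 f.1 m (X m) + fderiv 𝕜 g.1 m (X m)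
    rw [fderiv_add (SmoothFn.differentiableAt f m) (SmoothFn.differentiableAt g m),
      add_apply]
  map_smul' c f := by
    apply Subtype.ext
    funext m
    change fderiv 𝕜 (c • f.1) m (X m) = c • fderiv 𝕜 f.1 m (X m)
    rw [fderiv_const_smul (SmoothFn.differentiableAt f m), smul_apply]

theorem derAlong_commutator {X Y : (Fin 5 → 𝕜) → Fin 5 → 𝕜} (hX : ContDiff 𝕜 ∞ X)
    (hY : ContDiff 𝕜 ∞ Y) (f : SmoothFn 𝕜) (m : Fin 5 → 𝕜) :
    (derAlong X hX (derAlong Y hY f)).1 m - (derAlong Y hY (derAlong X hX f)).1 m =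
      fderiv 𝕜 f.1 m (VectorField.lieBracket 𝕜 X Y m) := by
  rw [VectorField.fderiv_apply_lieBracket (n := ∞) (SmoothFn.contDiff f).contDiffAt
    (by rw [minSmoothness_of_isRCLikeNormedField]; exact ENat.LEInfty.out)
    (hY.differentiable (by simp) m) (hX.differentiable (by simp) m)]
  rfl

/-- The horizontal vector field `c₀ (∂_x + p ∂_z) + c₁ (∂_y + q ∂_z) + c₂ ∂_p + c₃ ∂_q`. -/
def horizontalField (c : Fin 4 → 𝕜) (m : Fin 5 → 𝕜) : Fin 5 → 𝕜 :=
  ![c 0, c 1, m 3 * c 0 + m 4 * c 1, c 2, c 3]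

/-- The Reeb field `∂_z`. -/
def reebField (𝕜 : Type*) [RCLike 𝕜] (_ : Fin 5 → 𝕜) : Fin 5 → 𝕜 := ![0, 0, 1, 0, 0]

theorem contDiff_reebField : ContDiff 𝕜 ∞ (reebField 𝕜) := contDiff_const

theorem contDiff_horizontalField (c : Fin 4 → 𝕜) : ContDiff 𝕜 ∞ (horizontalField c) := by
  unfold horizontalField
  rw [contDiff_pi]
  intro i
  fin_cases i <;> simp <;> fun_prop

theorem fderiv_horizontalField (c : Fin 4 → 𝕜) (m v : Fin 5 → 𝕜) :
    fderiv 𝕜 (horizontalField c) m v = (v 3 * c 0 + v 4 * c 1) • reebField 𝕜 m := by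
  refine fderiv_apply_eq_of_hasDerivAt ((contDiff_horizontalField c).differentiable
    (by simp) m) ?_
  have d := hasDerivAt_line m v
  intro i
  fin_cases i
  · refine HasDerivAt.congr_deriv (hasDerivAt_const _ _) ?_
    simp [reebField]
  · refine HasDerivAt.congr_deriv (hasDerivAt_const _ _) ?_
    simp [reebField]
  · refine HasDerivAt.congr_deriv (((d 3).mul_const (c 0)).fun_add ((d 4).mul_const (c 1))) ?_
    simp [reebField]
  · refine HasDerivAt.congr_deriv (hasDerivAt_const _ _) ?_
    simp [reebField]
  · refine HasDerivAt.congr_deriv (hasDerivAt_const _ _) ?_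
    simp [reebField]

/-- The symplectic form on the horizontal directions. -/
def horizontalForm (c d : Fin 4 → 𝕜) : 𝕜 := c 2 * d 0 + c 3 * d 1 - d 2 * c 0 - d 3 * c 1

theorem lieBracket_horizontalField (c d : Fin 4 → 𝕜) (m : Fin 5 → 𝕜) :
    VectorField.lieBracket 𝕜 (horizontalField c) (horizontalField d) m =
      horizontalForm c d • reebField 𝕜 m := by
  rw [VectorField.lieBracket, fderiv_horizontalField, fderiv_horizontalField, ← sub_smul]
  congr 1
  simp [horizontalField, horizontalForm]
  ring

theorem lieBracket_reebField_horizontalField (c : Fin 4 → 𝕜) (m : Fin 5 → 𝕜) :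
    VectorField.lieBracket 𝕜 (reebField 𝕜) (horizontalField c) m = 0 := by
  have ht : fderiv 𝕜 (reebField 𝕜) m = 0 := fderiv_const_apply _
  rw [VectorField.lieBracket, fderiv_horizontalField, ht]
  simp [reebField]

/-- The derivative along the horizontal fields with constant coefficients. -/
def horizontalDer (𝕜 : Type*) [RCLike 𝕜] : (Fin 4 → 𝕜) →ₗ[𝕜] Module.End 𝕜 (SmoothFn 𝕜) where
  toFun c := derAlong (horizontalField c) (contDiff_horizontalField c)
  map_add' c d := by
    refine LinearMap.ext fun f => Subtype.ext (funext fun m => ?_)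
    change fderiv 𝕜 f.1 m _ = fderiv 𝕜 f.1 m _ + fderiv 𝕜 f.1 m _
    rw [← map_add]
    congr 1
    funext i
    fin_cases i <;> (simp [horizontalField]; try ring)
  map_smul' a c := by
    refine LinearMap.ext fun f => Subtype.ext (funext fun m => ?_)
    change fderiv 𝕜 f.1 m _ = a • fderiv 𝕜 f.1 m _
    rw [← map_smul]
    congr 1
    funext i
    fin_cases i <;> (simp [horizontalField]; try ring)

/-- The derivative along the Reeb field. -/
def reebDer (𝕜 : Type*) [RCLike 𝕜] : Module.End 𝕜 (SmoothFn 𝕜) :=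
  derAlong (reebField 𝕜) contDiff_reebField

theorem horizontalDer_commutator (c d : Fin 4 → 𝕜) (f : SmoothFn 𝕜) :
    horizontalDer 𝕜 c (horizontalDer 𝕜 d f) =
      horizontalDer 𝕜 d (horizontalDer 𝕜 c f) + horizontalForm c d • reebDer 𝕜 f := by
  rw [← sub_eq_iff_eq_add']
  refine Subtype.ext (funext fun m => ?_)
  refine (derAlong_commutator (contDiff_horizontalField c) (contDiff_horizontalField d) f m).trans
    ?_
  rw [lieBracket_horizontalField, map_smul]
  rfl

theorem reebDer_horizontalDer (c : Fin 4 → 𝕜) (f : SmoothFn 𝕜) :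
    reebDer 𝕜 (horizontalDer 𝕜 c f) = horizontalDer 𝕜 c (reebDer 𝕜 f) := by
  rw [← sub_eq_zero]
  refine Subtype.ext (funext fun m => ?_)
  refine (derAlong_commutator contDiff_reebField (contDiff_horizontalField c) f m).trans ?_
  rw [lieBracket_reebField_horizontalField, map_zero]
  rfl

/-- A basis `n₀, …, n₃` of the horizontal directions in which the symplectic form is the invariant
form of binary cubics, so that `r ↦ n₀ + r n₁ + r² n₂ + r³ n₃` is Legendrian. -/
structure IsCubicFrame (n : Fin 4 → Fin 4 → 𝕜) (κ : 𝕜) : Prop where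
  ne_zero : κ ≠ 0
  form_01 : horizontalForm (n 0) (n 1) = 0
  form_02 : horizontalForm (n 0) (n 2) = 0
  form_03 : horizontalForm (n 0) (n 3) = κ
  form_12 : horizontalForm (n 1) (n 2) = -3 * κ
  form_13 : horizontalForm (n 1) (n 3) = 0
  form_23 : horizontalForm (n 2) (n 3) = 0
  span : Submodule.span 𝕜 (range n) = ⊤

/-- The point `n₀ + r n₁ + r² n₂ + r³ n₃` of the cubic curve. -/
def cubicCurve (n : Fin 4 → Fin 4 → 𝕜) (r : 𝕜) : Fin 4 → 𝕜 :=
  n 0 + r • n 1 + r ^ 2 • n 2 + r ^ 3 • n 3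

/-- The value of a smooth function at the origin. -/
def evalZero (𝕜 : Type*) [RCLike 𝕜] : SmoothFn 𝕜 →ₗ[𝕜] 𝕜 where
  toFun f := f.1 0
  map_add' _ _ := rfl
  map_smul' _ _ := rfl

/-- Fourteen derivatives at the origin. -/
def cubicJet (n : Fin 4 → Fin 4 → 𝕜) (κ : 𝕜) : SmoothFn 𝕜 →ₗ[𝕜] (Fin 14 → 𝕜) :=
  let e := fun i => horizontalDer 𝕜 (n i)
  let Z := κ • reebDer 𝕜
  LinearMap.pi fun i => evalZero 𝕜 ∘ₗ
    (![1, e 0, e 1, e 2, e 3, e 0 * e 2, e 1 * e 3, e 0 * e 3, Z, e 0 * Z, e 1 * Z, e 2 * Z,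
      e 3 * Z, Z * Z] : Fin 14 → Module.End 𝕜 (SmoothFn 𝕜)) i

/-- Degree six is what arises when a direction cubic in r enters quadratically. -/
theorem coeff_eq_zero_of_infinite {W : Set 𝕜} (hW : W.Infinite) {s : Fin 7 → 𝕜}
    (h : ∀ r ∈ W, s 0 + r * s 1 + r ^ 2 * s 2 + r ^ 3 * s 3 + r ^ 4 * s 4 + r ^ 5 * s 5 +
      r ^ 6 * s 6 = 0) (i : Fin 7) : s i = 0 := by
  let P : Polynomial 𝕜 := ∑ i : Fin 7, Polynomial.monomial i (s i)
  have hP : P = 0 := by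
    refine Polynomial.eq_zero_of_infinite_isRoot P (hW.mono fun r hr => ?_)
    change P.eval r = 0
    rw [← h r hr]
    simp [P, Fin.sum_univ_seven]
    ring
  have hc : P.coeff i = s i := by
    simp only [P, Polynomial.finsetSum_coeff, Polynomial.coeff_monomial]
    simp [Fin.val_inj]
  rw [← hc, hP, Polynomial.coeff_zero]

/-- The coefficients of r⁰, …, r⁶ in the squared derivation all kill f. After reordering by the
commutation rules of the frame these are the seven relations of `eq_zero_of_heisenberg_jet`, with Z
= κ ∂_z. -/
theorem eq_zero_of_cubicJet_eq_zero {n : Fin 4 → Fin 4 → 𝕜} {κ : 𝕜} (hn : IsCubicFrame n κ)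
    {W : Set 𝕜} (hW : W.Infinite) {f : SmoothFn 𝕜}
    (hf : ∀ r ∈ W, horizontalDer 𝕜 (cubicCurve n r) (horizontalDer 𝕜 (cubicCurve n r) f) = 0)
    (hj : cubicJet n κ f = 0) : f = 0 := by
  set e := fun i => horizontalDer 𝕜 (n i) with he
  set Z := κ • reebDer 𝕜 with hZ
  have comm : ∀ i j g, e j (e i g) = e i (e j g) - horizontalForm (n i) (n j) • reebDer 𝕜 g := by
    intro i j g
    rw [he]
    simp only
    rw [horizontalDer_commutator (n i) (n j)]
    abel
  have hZe : ∀ i g, Z (e i g) = e i (Z g) := by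
    intro i g
    simp only [hZ, he, LinearMap.smul_apply, map_smul, reebDer_horizontalDer]
  have hev : ∀ g, e 0 g = 0 → e 1 g = 0 → e 2 g = 0 → e 3 g = 0 → evalZero 𝕜 g = 0 → g = 0 := by
    intro g g0 g1 g2 g3 gv
    have hall : ∀ c, horizontalDer 𝕜 c g = 0 := by
      have hle : Submodule.span 𝕜 (range n) ≤
          LinearMap.ker ((LinearMap.applyₗ g).comp (horizontalDer 𝕜)) := by
        rw [Submodule.span_le]
        rintro _ ⟨i, rfl⟩
        fin_cases i
        · exact g0
        · exact g1
        · exact g2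
        · exact g3
      intro c
      have hc : c ∈ Submodule.span 𝕜 (range n) := by rw [hn.span]; trivial
      exact hle hc
    -- The bracket of the fields of n₀ and n₃ is κ ∂_z with κ ≠ 0, so ∂_z kills g as well, and g is
    -- constant.
    have hreeb : reebDer 𝕜 g = 0 := by
      have h1 := comm 0 3 g
      simp only [he, hall, map_zero, hn.form_03] at h1
      have h2 : κ • reebDer 𝕜 g = 0 := by simpa using h1.symm
      exact (smul_eq_zero.1 h2).resolve_left hn.ne_zero
    have hder : ∀ m, fderiv 𝕜 g.1 m = 0 := by
      intro m
      refine ContinuousLinearMap.ext fun v => ?_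
      have hv : v = horizontalField ![v 0, v 1, v 3, v 4] m +
          (v 2 - m 3 * v 0 - m 4 * v 1) • reebField 𝕜 m := by
        funext i
        fin_cases i <;> simp [horizontalField, reebField]
      rw [hv, map_add, map_smul]
      have h1 : fderiv 𝕜 g.1 m (horizontalField ![v 0, v 1, v 3, v 4] m) = 0 :=
        congrFun (congrArg Subtype.val (hall ![v 0, v 1, v 3, v 4])) m
      have h2 : fderiv 𝕜 g.1 m (reebField 𝕜 m) = 0 :=
        congrFun (congrArg Subtype.val hreeb) m
      rw [h1, h2, smul_zero, add_zero]
      rfl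
    refine Subtype.ext (funext fun m => ?_)
    rw [is_const_of_fderiv_eq_zero (fun m => SmoothFn.differentiableAt g m) hder m 0]
    exact gv
  have hrel : ∀ i : Fin 7, (![e 0 (e 0 f), e 0 (e 1 f) + e 1 (e 0 f),
      e 0 (e 2 f) + e 1 (e 1 f) + e 2 (e 0 f),
      e 0 (e 3 f) + e 1 (e 2 f) + e 2 (e 1 f) + e 3 (e 0 f),
      e 1 (e 3 f) + e 2 (e 2 f) + e 3 (e 1 f), e 2 (e 3 f) + e 3 (e 2 f),
      e 3 (e 3 f)] : Fin 7 → SmoothFn 𝕜) i = 0 := by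
    intro i
    refine Subtype.ext (funext fun m => ?_)
    refine coeff_eq_zero_of_infinite hW (s := fun i => ((![e 0 (e 0 f), e 0 (e 1 f) + e 1 (e 0 f),
      e 0 (e 2 f) + e 1 (e 1 f) + e 2 (e 0 f),
      e 0 (e 3 f) + e 1 (e 2 f) + e 2 (e 1 f) + e 3 (e 0 f),
      e 1 (e 3 f) + e 2 (e 2 f) + e 3 (e 1 f), e 2 (e 3 f) + e 3 (e 2 f),
      e 3 (e 3 f)] : Fin 7 → SmoothFn 𝕜) i).1 m) ?_ i
    intro r hr
    have h1 := hf r hr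
    simp only [cubicCurve, map_add, map_smul, LinearMap.add_apply, LinearMap.smul_apply] at h1
    have h2 := congrFun (congrArg Subtype.val h1) m
    simp only [Submodule.coe_add, Submodule.coe_smul, Pi.add_apply, Pi.smul_apply, smul_eq_mul]
      at h2
    simp only [Matrix.cons_val, Submodule.coe_add, Pi.add_apply, he]
    refine Eq.trans ?_ h2
    ring
  have R0 := hrel 0
  have R1 := hrel 1
  have R2 := hrel 2
  have R3 := hrel 3
  have R4 := hrel 4
  have R5 := hrel 5
  have R6 := hrel 6
  simp only [Matrix.cons_val] at R0 R1 R2 R3 R4 R5 R6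
  have c01 := comm 0 1
  have c02 := comm 0 2
  have c03 := comm 0 3
  have c12 := comm 1 2
  have c13 := comm 1 3
  have c23 := comm 2 3
  simp only [hn.form_01, hn.form_02, hn.form_03, hn.form_12, hn.form_13, hn.form_23, zero_smul,
    sub_zero] at c01 c02 c03 c12 c13 c23
  have hZr : ∀ g, Z g = κ • reebDer 𝕜 g := fun g => rfl
  rw [c01] at R1
  rw [c02] at R2
  rw [c03, c12] at R3
  rw [c13] at R4
  rw [c23] at R5
  have two : ∀ g : SmoothFn 𝕜, (2 : 𝕜) • g = 0 → g = 0 := fun g hg =>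
    (smul_eq_zero.1 hg).resolve_left two_ne_zero
  have jets : ∀ i, cubicJet n κ f i = 0 := fun i => by rw [hj]; rfl
  refine eq_zero_of_heisenberg_jet (e 0) (e 1) (e 2) (e 3) Z (evalZero 𝕜) hev c01 c02 c13 c23
    c03 ?_ (hZe 0) (hZe 1) (hZe 2) (hZe 3) f R0 ?_ ?_ ?_ ?_ ?_ R6 (jets 0) (jets 1) (jets 2)
    (jets 3) (jets 4) (jets 5) (jets 6) (jets 7) (jets 8) (jets 9) (jets 10) (jets 11) (jets 12)
    (jets 13)
  · intro g
    rw [c12, hZr]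
    module
  · refine two _ ?_
    linear_combination (norm := module) R1
  · linear_combination (norm := module) R2
  · rw [hZr, ← sub_eq_zero]
    refine two _ ?_
    linear_combination (norm := module) R3
  · linear_combination (norm := module) R4
  · refine two _ ?_
    linear_combination (norm := module) R5

end SmoothFunctions

end

noncomputable section

/-! ### Injectivity of the fourteen-jet on the symmetries of D₁. -/

section JetMap

variable {𝕜 : Type*} [RCLike 𝕜] {T : Opens 𝕜} {H F : 𝕜 → 𝕜}

/-- The point `(x, y, z, p, q, t)` over `m = (x, y, z, p, q)`. -/
def insertFibre {𝕜 : Type*} (t : 𝕜) (m : Fin 5 → 𝕜) : Fin 6 → 𝕜 := ![m 0, m 1, m 2, m 3, m 4, t]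

theorem forgetFibre_insertFibre {𝕜 : Type*} (t : 𝕜) (m : Fin 5 → 𝕜) : forgetFibre (insertFibre t m) = m := by
  funext i
  fin_cases i <;> rfl

theorem contDiff_insertFibre (t : 𝕜) : ContDiff 𝕜 ∞ (insertFibre t) := by
  unfold insertFibre
  rw [contDiff_pi]
  intro i
  fin_cases i <;> simp <;> fun_prop

/-- The constant coefficients of the horizontal direction of `lineField`. -/
def lineDirection (H F : 𝕜 → 𝕜) (t : 𝕜) : Fin 4 → 𝕜 := ![1, t, t * H t - 2 * F t, -H t]

theorem forgetFibre_lineField (u : Fin 6 → 𝕜) :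
    forgetFibre (lineField H F u) = horizontalField (lineDirection H F (u 5)) (forgetFibre u) := by
  funext i
  fin_cases i <;> simp [forgetFibre, lineField, horizontalField, lineDirection] <;> ring

/-- The generator of a vector field on the `(2,3,5)` side, as a function on `𝕜⁵`. -/
def generatorMap (h : IsAdmissible T H F) {t₀ : 𝕜} (ht₀ : t₀ ∈ T) :
    SmoothVF 𝕜 (domain235 T) →ₗ[𝕜] SmoothFn 𝕜 where
  toFun V := ⟨fun m => transformedGenerator H F V.1 (insertFibre t₀ m), contDiffOn_univ.1
    ((contDiffOn_transformedGenerator h V).comp (contDiff_insertFibre t₀).contDiffOn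
      fun _ _ => ht₀)⟩
  map_add' V V' := by
    refine Subtype.ext (funext fun m => ?_)
    simp only [transformedGenerator, Submodule.coe_add, Pi.add_apply]
    ring
  map_smul' c V := by
    refine Subtype.ext (funext fun m => ?_)
    simp only [transformedGenerator, Submodule.coe_smul, Pi.smul_apply, smul_eq_mul,
      RingHom.id_apply]
    ring

/-- For fixed t the projected line is an integral curve of a horizontal field with constant
coefficients, so the derivative of an affine function along it is its slope. -/
theorem horizontalDer_lineDirection_apply (g : SmoothFn 𝕜) {u : Fin 6 → 𝕜} {μ : 𝕜}
    (hμ : ∀ s, g.1 (forgetFibre (lineFlow H F s u)) = g.1 (forgetFibre u) + s * μ) :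
    (horizontalDer 𝕜 (lineDirection H F (u 5)) g).1 (forgetFibre u) = μ := by
  have d1 : HasFDerivAt g.1 (fderiv 𝕜 g.1 (forgetFibre u)) (forgetFibre (lineFlow H F 0 u)) := by
    rw [lineFlow_zero]
    exact (SmoothFn.differentiableAt g _).hasFDerivAt
  have d2 := d1.comp_hasDerivAt (0 : 𝕜)
    ((hasFDerivAt_forgetFibre _).comp_hasDerivAt (0 : 𝕜) (hasDerivAt_lineFlow (H := H) (F := F) u))
  have d3 : HasDerivAt (fun s => g.1 (forgetFibre (lineFlow H F s u))) (1 * μ) 0 := by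
    rw [funext hμ]
    exact ((hasDerivAt_id (0 : 𝕜)).mul_const μ).const_add _
  have d4 := d2.unique d3
  rw [forgetFibreL_apply, forgetFibre_lineField, one_mul] at d4
  exact d4

/-- The generator of a symmetry of `D₁` is affine along the integral curves of `lineField`. -/
theorem horizontalDer_lineDirection_generatorMap (h : IsAdmissible T H F)
    (hT : IsPreconnected (T : Set 𝕜)) {t₀ : 𝕜} (ht₀ : t₀ ∈ T) {V : SmoothVF 𝕜 (domain235 T)}
    (hV : V ∈ symmetryAlgebra (distribution235 H) (domain235 T)) {t : 𝕜} (ht : t ∈ T) :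
    horizontalDer 𝕜 (lineDirection H F t)
      (horizontalDer 𝕜 (lineDirection H F t) (generatorMap h ht₀ V)) = 0 := by
  obtain ⟨μ, hμ⟩ : ∃ μ : (Fin 6 → 𝕜) → 𝕜, μ = fun u =>
      V.1 (forgetFibre (doubleFibrationMap H F u)) 1 -
        forgetFibre (doubleFibrationMap H F u) 3 *
          V.1 (forgetFibre (doubleFibrationMap H F u)) 0 := ⟨_, rfl⟩
  have hg : ∀ u : Fin 6 → 𝕜, u 5 ∈ T →
      (generatorMap h ht₀ V).1 (forgetFibre u) = transformedGenerator H F V.1 u := fun u hu =>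
    transformedGenerator_eq_of_forgetFibre_eq h hT hV (u := insertFibre t₀ (forgetFibre u)) ht₀ hu
      (forgetFibre_insertFibre _ _)
  -- The slope of the generator is a function of the point of M_T, hence constant along the line; a
  -- second differentiation gives zero.
  have hμf : ∀ u s, μ (lineFlow H F s u) = μ u := by
    intro u s
    have e : forgetFibre (doubleFibrationMap H F (lineFlow H F s u)) =
        forgetFibre (doubleFibrationMap H F u) := by
      rw [doubleFibrationMap_lineFlow]
      funext j
      fin_cases j <;> simp [forgetFibre, fibreField]
    simp only [hμ, e]
  have h1 : ∀ u : Fin 6 → 𝕜, u 5 = t →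
      (horizontalDer 𝕜 (lineDirection H F t) (generatorMap h ht₀ V)).1 (forgetFibre u) = μ u := by
    intro u hu
    have hu5 : u 5 ∈ T := by rw [hu]; exact ht
    rw [← hu]
    refine horizontalDer_lineDirection_apply _ fun s => ?_
    rw [hg _ hu5, hg (lineFlow H F s u) hu5, transformedGenerator_lineFlow, hμ]
  refine Subtype.ext (funext fun m => ?_)
  have h2 := horizontalDer_lineDirection_apply (H := H) (F := F)
    (horizontalDer 𝕜 (lineDirection H F t) (generatorMap h ht₀ V)) (u := insertFibre t m) (μ := 0)
    fun s => by
      rw [h1 (insertFibre t m) rfl, h1 (lineFlow H F s (insertFibre t m)) rfl, hμf, mul_zero,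
        add_zero]
  rw [forgetFibre_insertFibre] at h2
  exact h2

/-- A symmetry of `D₁` is determined by fourteen derivatives of its generator at a point. -/
theorem injective_cubicJet_generatorMap (h : IsAdmissible T H F)
    (hT : IsPreconnected (T : Set 𝕜)) {t₀ : 𝕜} (ht₀ : t₀ ∈ T) {n : Fin 4 → Fin 4 → 𝕜} {κ : 𝕜}
    (hn : IsCubicFrame n κ) {W : Set 𝕜} (hW : W.Infinite)
    (hWT : ∀ r ∈ W, ∃ t ∈ T, ∃ c : 𝕜, cubicCurve n r = c • lineDirection H F t) :
    Function.Injective ((cubicJet n κ ∘ₗ generatorMap h ht₀) ∘ₗ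
      (symmetryAlgebra (distribution235 H) (domain235 T)).toSubmodule.subtype) := by
  rw [← LinearMap.ker_eq_bot, LinearMap.ker_eq_bot']
  rintro ⟨V, hV⟩ h0
  have hg : generatorMap h ht₀ V = 0 := by
    refine eq_zero_of_cubicJet_eq_zero hn hW (fun r hr => ?_) h0
    obtain ⟨t, ht, c, hc⟩ := hWT r hr
    rw [hc]
    simp only [map_smul, LinearMap.smul_apply,
      horizontalDer_lineDirection_generatorMap h hT ht₀ hV ht, smul_zero]
  refine Subtype.ext (eq_zero_of_transformedGenerator_eq_zero h hV fun u hu => ?_)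
  have h1 := transformedGenerator_eq_of_forgetFibre_eq h hT hV
    (u := insertFibre t₀ (forgetFibre u)) ht₀ hu (forgetFibre_insertFibre _ _)
  rw [← h1]
  exact congrFun (congrArg Subtype.val hg) (forgetFibre u)

end JetMap

end

noncomputable section

/-! ### The two solutions of Noth's equation as twisted cubics. -/

section Branch

variable {𝕜 : Type*} [RCLike 𝕜]

/-- A function `φ` with `φ ∘ f = G` near a regular point of `f`. -/
theorem hasDerivAt_of_comp_eq {f G φ : 𝕜 → 𝕜} {r f' G' : 𝕜} (hf : HasStrictDerivAt f f' r)
    (hf' : f' ≠ 0) (hG : HasDerivAt G G' r) (h : ∀ᶠ x in nhds r, φ (f x) = G x) :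
    HasDerivAt φ (G' / f') (f r) := by
  rw [div_eq_mul_inv]
  have hg := hf.to_localInverse hf'
  have hgr : hf.localInverse f f' r hf' (f r) = r :=
    HasStrictFDerivAt.localInverse_apply_image _
  have hG' : HasDerivAt G G' (hf.localInverse f f' r hf' (f r)) := by rwa [hgr]
  refine HasDerivAt.congr_of_eventuallyEq (hG'.comp (f r) hg.hasDerivAt) ?_
  have hc := hg.hasDerivAt.continuousAt
  rw [ContinuousAt, hgr] at hc
  filter_upwards [hc h, HasStrictFDerivAt.eventually_right_inverse
    (hf.hasStrictFDerivAt_equiv hf')] with y hy hy'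
  exact (congrArg φ hy').symm.trans hy

/-- Near f r the function φ is G composed with the smooth local inverse of f. -/
theorem contDiffAt_of_comp_eq {f G φ : 𝕜 → 𝕜} {r f' : 𝕜} (hf : HasDerivAt f f' r)
    (hf' : f' ≠ 0) (hfc : ContDiffAt 𝕜 ∞ f r) (hG : ContDiffAt 𝕜 ∞ G r)
    (h : ∀ᶠ x in nhds r, φ (f x) = G x) : ContDiffAt 𝕜 ∞ φ (f r) := by
  have he : HasFDerivAt f
      (ContinuousLinearEquiv.unitsEquivAut 𝕜 (Units.mk0 f' hf') : 𝕜 →L[𝕜] 𝕜) r := by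
    have := hf.hasFDerivAt
    convert this using 1
    ext
    simp
  have hn : (∞ : WithTop ℕ∞) ≠ 0 := by simp
  have hg := hfc.to_localInverse he hn
  have hgr : hfc.localInverse he hn (f r) = r := ContDiffAt.localInverse_apply_image ..
  have hG' : ContDiffAt 𝕜 ∞ G (hfc.localInverse he hn (f r)) := by rwa [hgr]
  refine ContDiffAt.congr_of_eventuallyEq (hG'.comp (f r) hg) ?_
  have hc := hg.continuousAt
  rw [ContinuousAt, hgr] at hc
  filter_upwards [hc h, HasStrictFDerivAt.eventually_right_inverse
    (hfc.hasStrictFDerivAt' he hn)] with y hy hy'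
  exact (congrArg φ hy').symm.trans hy

/-- The velocity of the cubic curve. -/
def cubicTangent (n : Fin 4 → Fin 4 → 𝕜) (r : 𝕜) : Fin 4 → 𝕜 :=
  n 1 + (2 * r) • n 2 + (3 * r ^ 2) • n 3

/-- The derivative of `lineDirection` by `t`. -/
def osculatingDirection (H : 𝕜 → 𝕜) (t : 𝕜) : Fin 4 → 𝕜 :=
  ![0, 1, t * deriv H t - H t, -deriv H t]

/-- The curve of directions `lineDirection` is a piece of the twisted cubic of the frame `n`. -/
structure IsCubicBranch (n : Fin 4 → Fin 4 → 𝕜) (κ : 𝕜) (W : Set 𝕜) (T : Opens 𝕜)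
    (H F : 𝕜 → 𝕜) : Prop where
  admissible : IsAdmissible T H F
  frame : IsCubicFrame n κ
  nonempty : (T : Set 𝕜).Nonempty
  isPreconnected : IsPreconnected (T : Set 𝕜)
  infinite : W.Infinite
  exists_mem : ∀ r ∈ W, ∃ t ∈ T, ∃ c : 𝕜, cubicCurve n r = c • lineDirection H F t
  exists_param : ∀ t ∈ T, ∃ r c a d : 𝕜, c ≠ 0 ∧ d ≠ 0 ∧
    cubicCurve n r = c • lineDirection H F t ∧
    cubicTangent n r = a • lineDirection H F t + d • osculatingDirection H t

/-- The frames of the twisted cubics of the two solutions. -/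
def nothFrame (𝕜 : Type*) [RCLike 𝕜] : Fin 2 → Fin 4 → Fin 4 → 𝕜 :=
  -- The i-th vector collects the coefficients of rⁱ in (r³ + 2, 2r, 8/3, 4r²), respectively (1 +
  -- 2r³, 2r², -4/3, 4r), which are the multiples of `lineDirection` by the denominator of t.
  ![![![2, 0, 8 / 3, 0], ![0, 2, 0, 0], ![0, 0, 0, 4], ![1, 0, 0, 0]],
    ![![1, 0, -(4 / 3), 0], ![0, 0, 0, 4], ![0, 2, 0, 0], ![2, 0, 0, 0]]]

theorem isCubicFrame_nothFrame (k : Fin 2) :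
    IsCubicFrame (nothFrame 𝕜 k) ((![8 / 3, -(8 / 3)] : Fin 2 → 𝕜) k) := by
  -- The matrix a supplies the coordinates of v in the family n, that is, the coordinate functionals
  -- of the frame.
  have hs : ∀ n : Fin 4 → Fin 4 → 𝕜, ∀ a : Fin 4 → Fin 4 → 𝕜,
      (∀ v : Fin 4 → 𝕜, v = ∑ i, (∑ j, a i j * v j) • n i) → Submodule.span 𝕜 (range n) = ⊤ := by
    intro n a h
    rw [eq_top_iff]
    intro v _
    rw [h v]
    exact Submodule.sum_mem _ fun i _ =>
      Submodule.smul_mem _ _ (Submodule.subset_span (mem_range_self i))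
  fin_cases k
  · refine ⟨?_, ?_, ?_, ?_, ?_, ?_, ?_, ?_⟩
    · simp
    iterate 6
      simp [nothFrame, horizontalForm]
      try norm_num
    refine hs _ ![![0, 0, 3 / 8, 0], ![0, 1 / 2, 0, 0], ![0, 0, 0, 1 / 4], ![1, 0, -(3 / 4), 0]] ?_
    intro v
    funext j
    fin_cases j <;> simp [nothFrame, Fin.sum_univ_four] <;> ring
  · refine ⟨?_, ?_, ?_, ?_, ?_, ?_, ?_, ?_⟩
    · simp
    iterate 6
      simp [nothFrame, horizontalForm]
      try norm_num
    refine hs _ ![![0, 0, -(3 / 4), 0], ![0, 0, 0, 1 / 4], ![0, 1 / 2, 0, 0],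
      ![1 / 2, 0, 3 / 8, 0]] ?_
    intro v
    funext j
    fin_cases j <;> simp [nothFrame, Fin.sum_univ_four] <;> ring

/-- Along the curve H_t = H'/t' = G and H_tt = G'/t', the prime being d/dr. So t' ≠ 0 makes H
smooth, and G' ≠ 0 keeps H_tt away from zero. -/
theorem IsBranch.isAdmissible {c : NothCurve 𝕜} {W : Set 𝕜} {T : Opens 𝕜} {H F : 𝕜 → 𝕜}
    (hB : IsBranch c W T H F) {t' H' G G' : 𝕜 → 𝕜} (ht : ∀ r ∈ W, HasDerivAt c.t (t' r) r)
    (ht₀ : ∀ r ∈ W, t' r ≠ 0) (htc : ∀ r ∈ W, ContDiffAt 𝕜 ∞ c.t r)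
    (hH : ∀ r ∈ W, HasDerivAt c.H (H' r) r) (hHc : ∀ r ∈ W, ContDiffAt 𝕜 ∞ c.H r)
    (hG : ∀ r ∈ W, H' r / t' r = G r) (hG' : ∀ r ∈ W, HasDerivAt G (G' r) r)
    (hG₀ : ∀ r ∈ W, G' r ≠ 0) :
    IsAdmissible T H F ∧ ∀ r ∈ W, deriv H (c.t r) = G r := by
  have hn : (∞ : WithTop ℕ∞) ≠ 0 := by simp
  have hT : ∀ t ∈ T, ∃ r ∈ W, c.t r = t := fun t ht => by
    have h : t ∈ c.t '' W := by rw [hB.image_eq]; exact ht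
    exact h
  have hW : ∀ r ∈ W, ∀ᶠ x in nhds r, x ∈ W := fun r hr => hB.isOpen.mem_nhds hr
  have d1 : ∀ r ∈ W, deriv H (c.t r) = G r := fun r hr => by
    rw [← hG r hr]
    refine (hasDerivAt_of_comp_eq ((htc r hr).hasStrictDerivAt' (ht r hr) hn) (ht₀ r hr)
      (hH r hr) ?_).deriv
    filter_upwards [hW r hr] with x hx using hB.apply_eq x hx
  have d2 : ∀ r ∈ W, deriv (deriv H) (c.t r) = G' r / t' r := fun r hr => by
    refine (hasDerivAt_of_comp_eq ((htc r hr).hasStrictDerivAt' (ht r hr) hn) (ht₀ r hr)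
      (hG' r hr) ?_).deriv
    filter_upwards [hW r hr] with x hx using d1 x hx
  refine ⟨⟨?_, hB.hasDerivAt, ?_⟩, d1⟩
  · intro t htT
    obtain ⟨r, hr, rfl⟩ := hT t htT
    refine (contDiffAt_of_comp_eq (ht r hr) (ht₀ r hr) (htc r hr) (hHc r hr) ?_).contDiffWithinAt
    filter_upwards [hW r hr] with x hx using hB.apply_eq x hx
  · intro t htT
    obtain ⟨r, hr, rfl⟩ := hT t htT
    rw [d2 r hr]
    exact div_ne_zero (hG₀ r hr) (ht₀ r hr)

/-- Everything is tested on W: T is a continuous image of a nonempty connected set, and the nonempty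
open set W is infinite. -/
theorem IsBranch.isCubicBranch_of_param {c : NothCurve 𝕜} {W : Set 𝕜} {T : Opens 𝕜}
    {H F : 𝕜 → 𝕜} (hB : IsBranch c W T H F) (ha : IsAdmissible T H F)
    (htc : ∀ r ∈ W, ContDiffAt 𝕜 ∞ c.t r) {n : Fin 4 → Fin 4 → 𝕜} {κ : 𝕜}
    (hn : IsCubicFrame n κ)
    (h : ∀ r ∈ W, ∃ b a d : 𝕜, b ≠ 0 ∧ d ≠ 0 ∧
      cubicCurve n r = b • lineDirection H F (c.t r) ∧
      cubicTangent n r = a • lineDirection H F (c.t r) + d • osculatingDirection H (c.t r)) :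
    IsCubicBranch n κ W T H F := by
  have hmem : ∀ r ∈ W, c.t r ∈ T := fun r hr => by
    have h : c.t r ∈ c.t '' W := mem_image_of_mem _ hr
    rw [hB.image_eq] at h
    exact h
  refine ⟨ha, hn, ?_, ?_, ?_, ?_, ?_⟩
  · rw [← hB.image_eq]
    exact hB.isConnected.nonempty.image _
  · rw [← hB.image_eq]
    exact hB.isConnected.isPreconnected.image _
      fun r hr => (htc r hr).continuousAt.continuousWithinAt
  · obtain ⟨r, hr⟩ := hB.isConnected.nonempty
    exact infinite_of_mem_nhds r (hB.isOpen.mem_nhds hr)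
  · intro r hr
    obtain ⟨b, -, -, -, -, hb, -⟩ := h r hr
    exact ⟨c.t r, hmem r hr, b, hb⟩
  · intro t ht
    have h' : t ∈ c.t '' W := by rw [hB.image_eq]; exact ht
    obtain ⟨r, hr, rfl⟩ := h'
    exact ⟨r, h r hr⟩

theorem isCubicBranch_first {W : Set 𝕜} {T : Opens 𝕜} {H F : 𝕜 → 𝕜}
    (hB : IsBranch (nothCurve 𝕜 0) W T H F) :
    IsCubicBranch (nothFrame 𝕜 0) (8 / 3) W T H F := by
  have hD : ∀ r ∈ W, r ^ 3 + 2 ≠ 0 := fun r hr => (hB.subset_dom hr).1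
  have hE : ∀ r ∈ W, 1 - r ^ 3 ≠ 0 := fun r hr h0 =>
    (hB.subset_dom hr).2 (by linear_combination -h0)
  have pw : ∀ (k : ℕ) (r : 𝕜), HasDerivAt (fun r : 𝕜 => r ^ k) (k * r ^ (k - 1)) r :=
    fun k r => hasDerivAt_pow k r
  have ht : ∀ r ∈ W, HasDerivAt (nothCurve 𝕜 0).t (4 * (1 - r ^ 3) / (r ^ 3 + 2) ^ 2) r := by
    intro r hr
    refine HasDerivAt.congr_deriv (((hasDerivAt_id r).const_mul 2).fun_div
      ((pw 3 r).add_const 2) (hD r hr)) ?_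
    simp
    ring
  have hH : ∀ r ∈ W, HasDerivAt (nothCurve 𝕜 0).H ((4 * r ^ 4 - 16 * r) / (r ^ 3 + 2) ^ 2) r := by
    intro r hr
    refine HasDerivAt.congr_deriv ((((pw 2 r).const_mul 4).fun_neg).fun_div
      ((pw 3 r).add_const 2) (hD r hr)) ?_
    simp
    ring
  have hG : ∀ r ∈ W, HasDerivAt (fun r : 𝕜 => (r ^ 4 - 4 * r) / (1 - r ^ 3))
      (-(r ^ 3 + 2) ^ 2 / (1 - r ^ 3) ^ 2) r := by
    intro r hr
    refine HasDerivAt.congr_deriv (((pw 4 r).fun_sub ((hasDerivAt_id r).const_mul 4)).fun_div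
      ((pw 3 r).const_sub 1) (hE r hr)) ?_
    simp
    ring
  have htc : ∀ r ∈ W, ContDiffAt 𝕜 ∞ (nothCurve 𝕜 0).t r := fun r hr =>
    (contDiffAt_const.mul contDiffAt_id).div ((contDiffAt_id.pow 3).add contDiffAt_const) (hD r hr)
  have hHc : ∀ r ∈ W, ContDiffAt 𝕜 ∞ (nothCurve 𝕜 0).H r := fun r hr =>
    (contDiffAt_const.mul (contDiffAt_id.pow 2)).neg.div
      ((contDiffAt_id.pow 3).add contDiffAt_const) (hD r hr)
  obtain ⟨ha, hd⟩ := hB.isAdmissible ht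
    (fun r hr => div_ne_zero (mul_ne_zero (by norm_num) (hE r hr)) (pow_ne_zero 2 (hD r hr))) htc hH
    hHc (G := fun r => (r ^ 4 - 4 * r) / (1 - r ^ 3))
    (fun r hr => by have := hD r hr; have := hE r hr; field_simp; ring) hG
    (fun r hr => div_ne_zero (neg_ne_zero.2 (pow_ne_zero 2 (hD r hr))) (pow_ne_zero 2 (hE r hr)))
  refine hB.isCubicBranch_of_param ha htc (isCubicFrame_nothFrame 0) fun r hr => ?_
  have h1 := hD r hr
  have h2 := hE r hr
  have h3 : r ^ 3 - 1 ≠ 0 := (hB.subset_dom hr).2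
  have et : (nothCurve 𝕜 0).t r = 2 * r / (r ^ 3 + 2) := rfl
  have eH : H ((nothCurve 𝕜 0).t r) = -(4 * r ^ 2) / (r ^ 3 + 2) := hB.apply_eq r hr
  have eG := hd r hr
  have eF := hB.p₁₁_eq r hr
  have ep : (nothCurve 𝕜 0).p₁₁ r = 4 / (3 * (r ^ 3 - 1)) := rfl
  rw [eH, eG, ep] at eF
  -- The prescribed value of p₁₁ fixes the constant of integration; with it, tH - 2F acquires the
  -- denominator of t and the third coordinate of the cubic is the constant 8/3.
  have eF' : (2 : 𝕜) * F ((nothCurve 𝕜 0).t r) = 4 / (3 * (r ^ 3 - 1)) -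
      (2 * r / (r ^ 3 + 2)) ^ 2 * ((r ^ 4 - 4 * r) / (1 - r ^ 3)) +
      2 * (2 * r / (r ^ 3 + 2)) * (-(4 * r ^ 2) / (r ^ 3 + 2)) := by
    rw [et] at eF ⊢
    linear_combination eF
  have e4 : (4 : 𝕜) / (3 * (r ^ 3 - 1)) = -4 / (3 * (1 - r ^ 3)) := by
    field_simp
    ring
  rw [e4] at eF'
  have nd : (4 : 𝕜) * (1 - r ^ 3) / (r ^ 3 + 2) ≠ 0 :=
    div_ne_zero (mul_ne_zero (by norm_num) h2) h1
  -- With D = r³ + 2, the r-derivative of D · `lineDirection` is D' times `lineDirection` plus D t'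
  -- times its t-derivative; D t' is the third witness.
  refine ⟨r ^ 3 + 2, 3 * r ^ 2, 4 * (1 - r ^ 3) / (r ^ 3 + 2), h1, nd, ?_, ?_⟩
  · funext j
    fin_cases j <;>
      simp [cubicCurve, nothFrame, lineDirection, eF', eH] <;> (try rw [et]) <;>
      (try field_simp) <;> try ring
  · funext j
    fin_cases j <;>
      simp [cubicTangent, nothFrame, lineDirection, osculatingDirection, eF', eH, eG] <;>
      (try rw [et]) <;> (try field_simp) <;> try ring

theorem isCubicBranch_second {W : Set 𝕜} {T : Opens 𝕜} {H F : 𝕜 → 𝕜}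
    (hB : IsBranch (nothCurve 𝕜 1) W T H F) :
    IsCubicBranch (nothFrame 𝕜 1) (-(8 / 3)) W T H F := by
  have hD : ∀ r ∈ W, 1 + 2 * r ^ 3 ≠ 0 := fun r hr => (hB.subset_dom hr).1
  have hE : ∀ r ∈ W, 1 - r ^ 3 ≠ 0 := fun r hr h0 =>
    (hB.subset_dom hr).2.1 (by linear_combination -h0)
  -- Here t' has the factor r, so r = 0 must be excluded for t to be a local coordinate.
  have hr0 : ∀ r ∈ W, r ≠ 0 := fun r hr => (hB.subset_dom hr).2.2
  have pw : ∀ (k : ℕ) (r : 𝕜), HasDerivAt (fun r : 𝕜 => r ^ k) (k * r ^ (k - 1)) r :=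
    fun k r => hasDerivAt_pow k r
  have ht : ∀ r ∈ W, HasDerivAt (nothCurve 𝕜 1).t (4 * r * (1 - r ^ 3) / (1 + 2 * r ^ 3) ^ 2) r := by
    intro r hr
    refine HasDerivAt.congr_deriv (((pw 2 r).const_mul 2).fun_div
      (((pw 3 r).const_mul 2).const_add 1) (hD r hr)) ?_
    simp
    ring
  have hH : ∀ r ∈ W, HasDerivAt (nothCurve 𝕜 1).H ((16 * r ^ 3 - 4) / (1 + 2 * r ^ 3) ^ 2) r := by
    intro r hr
    refine HasDerivAt.congr_deriv ((((hasDerivAt_id r).const_mul 4).fun_neg).fun_div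
      (((pw 3 r).const_mul 2).const_add 1) (hD r hr)) ?_
    simp
    ring
  have hrE : ∀ r ∈ W, r - r ^ 4 ≠ 0 := fun r hr h0 =>
    mul_ne_zero (hr0 r hr) (hE r hr) (by linear_combination h0)
  have hG : ∀ r ∈ W, HasDerivAt (fun r : 𝕜 => (4 * r ^ 3 - 1) / (r - r ^ 4))
      ((1 + 2 * r ^ 3) ^ 2 / (r - r ^ 4) ^ 2) r := by
    intro r hr
    refine HasDerivAt.congr_deriv ((((pw 3 r).const_mul 4).sub_const 1).fun_div
      ((hasDerivAt_id r).fun_sub (pw 4 r)) (hrE r hr)) ?_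
    simp
    ring
  have htc : ∀ r ∈ W, ContDiffAt 𝕜 ∞ (nothCurve 𝕜 1).t r := fun r hr =>
    (contDiffAt_const.mul (contDiffAt_id.pow 2)).div
      (contDiffAt_const.add (contDiffAt_const.mul (contDiffAt_id.pow 3))) (hD r hr)
  have hHc : ∀ r ∈ W, ContDiffAt 𝕜 ∞ (nothCurve 𝕜 1).H r := fun r hr =>
    (contDiffAt_const.mul contDiffAt_id).neg.div
      (contDiffAt_const.add (contDiffAt_const.mul (contDiffAt_id.pow 3))) (hD r hr)
  obtain ⟨ha, hd⟩ := hB.isAdmissible ht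
    (fun r hr => div_ne_zero (mul_ne_zero (mul_ne_zero (by norm_num) (hr0 r hr)) (hE r hr))
      (pow_ne_zero 2 (hD r hr))) htc hH hHc (G := fun r => (4 * r ^ 3 - 1) / (r - r ^ 4))
    (fun r hr => by
      have := hD r hr
      have := hE r hr
      have := hr0 r hr
      have : 1 + r ^ 3 * 2 ≠ 0 := by rw [mul_comm]; exact hD r hr
      rw [show r - r ^ 4 = r * (1 - r ^ 3) by ring]
      field_simp
      ring) hG
    (fun r hr => div_ne_zero (pow_ne_zero 2 (hD r hr)) (pow_ne_zero 2 (hrE r hr)))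
  refine hB.isCubicBranch_of_param ha htc (isCubicFrame_nothFrame 1) fun r hr => ?_
  have h0 := hr0 r hr
  have h1 := hD r hr
  have h2 := hE r hr
  have h1' : 1 + r ^ 3 * 2 ≠ 0 := by rw [mul_comm]; exact h1
  have h3 : r ^ 3 - 1 ≠ 0 := (hB.subset_dom hr).2.1
  have et : (nothCurve 𝕜 1).t r = 2 * r ^ 2 / (1 + 2 * r ^ 3) := rfl
  have eH : H ((nothCurve 𝕜 1).t r) = -(4 * r) / (1 + 2 * r ^ 3) := hB.apply_eq r hr
  have eG := hd r hr
  simp only [show r - r ^ 4 = r * (1 - r ^ 3) by ring] at eG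
  have eF := hB.p₁₁_eq r hr
  have ep : (nothCurve 𝕜 1).p₁₁ r = -4 / (3 * (r ^ 3 - 1)) := rfl
  rw [eH, eG, ep] at eF
  have eF' : (2 : 𝕜) * F ((nothCurve 𝕜 1).t r) = -4 / (3 * (r ^ 3 - 1)) -
      (2 * r ^ 2 / (1 + 2 * r ^ 3)) ^ 2 * ((4 * r ^ 3 - 1) / (r * (1 - r ^ 3))) +
      2 * (2 * r ^ 2 / (1 + 2 * r ^ 3)) * (-(4 * r) / (1 + 2 * r ^ 3)) := by
    rw [et] at eF ⊢
    linear_combination eF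
  have e4 : (-4 : 𝕜) / (3 * (r ^ 3 - 1)) = 4 / (3 * (1 - r ^ 3)) := by
    field_simp
    ring
  rw [e4] at eF'
  have nd : (4 : 𝕜) * r * (1 - r ^ 3) / (1 + 2 * r ^ 3) ≠ 0 :=
    div_ne_zero (mul_ne_zero (mul_ne_zero (by norm_num) h0) h2) h1
  refine ⟨1 + 2 * r ^ 3, 6 * r ^ 2, 4 * r * (1 - r ^ 3) / (1 + 2 * r ^ 3), h1, nd, ?_, ?_⟩
  · funext j
    fin_cases j <;>
      simp [cubicCurve, nothFrame, lineDirection, eF', eH] <;> (try rw [et]) <;>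
      (try field_simp) <;> try ring
  · funext j
    fin_cases j <;>
      simp [cubicTangent, nothFrame, lineDirection, osculatingDirection, eF', eH, eG] <;>
      (try rw [et]) <;> (try field_simp) <;> try ring

end Branch

end

noncomputable section

/-! ### Compatibility with the lines, restated along the twisted cubic. -/

section CubicCompatible

variable {𝕜 : Type*} [RCLike 𝕜]

/-- The flow of `horizontalField c`. -/
def horizontalFlow (c : Fin 4 → 𝕜) (s : 𝕜) (m : Fin 5 → 𝕜) : Fin 5 → 𝕜 :=
  ![m 0 + s * c 0, m 1 + s * c 1,
    m 2 + s * (m 3 * c 0 + m 4 * c 1) + s ^ 2 * (c 2 * c 0 + c 3 * c 1) / 2,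
    m 3 + s * c 2, m 4 + s * c 3]

/-- The derivative in the direction `c` of the generating function of a contact vector field with
the value `v`. -/
def slopeForm (c : Fin 4 → 𝕜) (v : Fin 5 → 𝕜) : 𝕜 := c 0 * v 3 + c 1 * v 4 - c 2 * v 0 - c 3 * v 1

theorem slopeForm_smul (a : 𝕜) (c : Fin 4 → 𝕜) (v : Fin 5 → 𝕜) :
    slopeForm (a • c) v = a * slopeForm c v := by
  simp [slopeForm]
  ring

theorem slopeForm_add (c d : Fin 4 → 𝕜) (v : Fin 5 → 𝕜) :
    slopeForm (c + d) v = slopeForm c v + slopeForm d v := by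
  simp [slopeForm]
  ring

theorem horizontalFlow_smul (a : 𝕜) (c : Fin 4 → 𝕜) (s : 𝕜) (m : Fin 5 → 𝕜) :
    horizontalFlow (a • c) s m = horizontalFlow c (s * a) m := by
  funext i
  fin_cases i <;> simp [horizontalFlow] <;> ring

theorem forgetFibre_lineFlow (H F : 𝕜 → 𝕜) (s : 𝕜) (u : Fin 6 → 𝕜) :
    forgetFibre (lineFlow H F s u) =
      horizontalFlow (lineDirection H F (u 5)) s (forgetFibre u) := by
  funext i
  fin_cases i <;> simp [forgetFibre, lineFlow, horizontalFlow, lineDirection] <;> ring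

theorem lineFlow_five (H F : 𝕜 → 𝕜) (s : 𝕜) (u : Fin 6 → 𝕜) : lineFlow H F s u 5 = u 5 := rfl

theorem lineSlope_eq (H F : 𝕜 → 𝕜) (ξ : (Fin 5 → 𝕜) → Fin 5 → 𝕜) (u : Fin 6 → 𝕜) :
    lineSlope H F ξ u = slopeForm (lineDirection H F (u 5)) (ξ (forgetFibre u)) := by
  simp [lineSlope, slopeForm, lineDirection]

theorem osculatingSlope_eq (H : 𝕜 → 𝕜) (ξ : (Fin 5 → 𝕜) → Fin 5 → 𝕜) (u : Fin 6 → 𝕜) :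
    osculatingSlope H ξ u = slopeForm (osculatingDirection H (u 5)) (ξ (forgetFibre u)) := by
  simp [osculatingSlope, slopeForm, osculatingDirection]

/-- The conditions of `IsLineCompatible` along the twisted cubic of the frame `n`. -/
structure IsCubicCompatible (n : Fin 4 → Fin 4 → 𝕜) (ξ : (Fin 5 → 𝕜) → Fin 5 → 𝕜) : Prop where
  generatingFunction_flow : ∀ r s m,
    generatingFunction ξ (horizontalFlow (cubicCurve n r) s m) =
      generatingFunction ξ m + s * slopeForm (cubicCurve n r) (ξ m)
  tangent_flow : ∀ r s m,
    slopeForm (cubicTangent n r) (ξ (horizontalFlow (cubicCurve n r) s m)) =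
      slopeForm (cubicTangent n r) (ξ m)
  transversal_flow : ∀ r m, ∃ ν, ∀ s,
    cubicCurve n r 0 * ξ (horizontalFlow (cubicCurve n r) s m) 1 -
      cubicCurve n r 1 * ξ (horizontalFlow (cubicCurve n r) s m) 0 =
      cubicCurve n r 0 * ξ m 1 - cubicCurve n r 1 * ξ m 0 + s * ν

/-- Scaling a direction by c only rescales the time of its flow, so the conditions along the cubic
transfer with time s / c. The tangent of the cubic is a combination of the line direction and d
times the osculating one; since the line slope is constant and d ≠ 0, the osculating slope is
constant too. -/
theorem IsCubicCompatible.isLineCompatible {n : Fin 4 → Fin 4 → 𝕜} {κ : 𝕜} {W : Set 𝕜}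
    {T : Opens 𝕜} {H F : 𝕜 → 𝕜} (hB : IsCubicBranch n κ W T H F)
    {ξ : (Fin 5 → 𝕜) → Fin 5 → 𝕜} (h : IsCubicCompatible n ξ) : IsLineCompatible T H F ξ := by
  have hgen : ∀ u : Fin 6 → 𝕜, u 5 ∈ T → ∀ s,
      generatingFunction ξ (forgetFibre (lineFlow H F s u)) =
        generatingFunction ξ (forgetFibre u) + s * lineSlope H F ξ u := by
    intro u hu s
    obtain ⟨r, c, -, -, hc, -, e, -⟩ := hB.exists_param _ hu
    have h1 := h.generatingFunction_flow r (s / c) (forgetFibre u)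
    rw [e, horizontalFlow_smul, slopeForm_smul, div_mul_cancel₀ _ hc, ← lineSlope_eq,
      ← forgetFibre_lineFlow, ← mul_assoc, div_mul_cancel₀ _ hc] at h1
    exact h1
  have hslope : ∀ u : Fin 6 → 𝕜, u 5 ∈ T → ∀ s,
      lineSlope H F ξ (lineFlow H F s u) = lineSlope H F ξ u := by
    intro u hu s
    have h1 := hgen u hu s
    have h2 := hgen u hu (s + 1)
    have h3 := hgen (lineFlow H F s u) hu 1
    rw [lineFlow_lineFlow] at h3
    linear_combination h2 - h3 - h1
  refine ⟨hgen, fun u hu s => ?_, fun u hu s => ?_⟩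
  · obtain ⟨r, c, a, d, hc, hd, e, e'⟩ := hB.exists_param _ hu
    have h1 := h.tangent_flow r (s / c) (forgetFibre u)
    have h2 := hslope u hu s
    rw [lineSlope_eq, lineSlope_eq, lineFlow_five] at h2
    rw [e, e', horizontalFlow_smul, div_mul_cancel₀ _ hc, ← forgetFibre_lineFlow, slopeForm_add,
      slopeForm_add, slopeForm_smul, slopeForm_smul, slopeForm_smul, slopeForm_smul, h2] at h1
    rw [osculatingSlope_eq, osculatingSlope_eq, lineFlow_five]
    exact mul_left_cancel₀ hd (by linear_combination h1)
  · obtain ⟨r, c, -, -, hc, -, e, -⟩ := hB.exists_param _ hu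
    obtain ⟨ν, hν⟩ := h.transversal_flow r (forgetFibre u)
    have e0 : cubicCurve n r 0 = c := by rw [e]; simp [lineDirection]
    have e1 : cubicCurve n r 1 = c * u 5 := by rw [e]; simp [lineDirection]
    -- The transversal expression along the cubic is c times `transversalPart`, because the first
    -- two coordinates of the cubic are c and c t.
    have key : ∀ s, c * transversalPart ξ (lineFlow H F s u) =
        c * transversalPart ξ u + s / c * ν := by
      intro s
      have h1 := hν (s / c)
      rw [e0, e1, e, horizontalFlow_smul, div_mul_cancel₀ _ hc, ← forgetFibre_lineFlow] at h1
      simp only [transversalPart, lineFlow_five]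
      linear_combination h1
    refine mul_left_cancel₀ hc ?_
    rw [fibreComponent]
    linear_combination key s - s * key 1

end CubicCompatible

end

noncomputable section

/-! ### The fourteen vector fields satisfy the conditions along the cubic. -/

section Fields

variable {𝕜 : Type*} [RCLike 𝕜]

theorem isCubicCompatible_first (i : Fin 14) :
    IsCubicCompatible (nothFrame 𝕜 0) (contactFieldFun 𝕜 0 i) := by
  have hc : ∀ r : 𝕜, cubicCurve (nothFrame 𝕜 0) r = ![r ^ 3 + 2, 2 * r, 8 / 3, 4 * r ^ 2] := by
    intro r
    funext j
    fin_cases j <;> simp [cubicCurve, nothFrame] <;> ring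
  have hd : ∀ r : 𝕜, cubicTangent (nothFrame 𝕜 0) r = ![3 * r ^ 2, 2, 0, 8 * r] := by
    intro r
    funext j
    fin_cases j <;> simp [cubicTangent, nothFrame]
    ring
  refine ⟨fun r s m => ?_, fun r s m => ?_, fun r m =>
    -- The expression is affine in s, so its slope is the difference of its values at times 1 and 0.
    ⟨(r ^ 3 + 2) * (contactFieldFun 𝕜 0 i (horizontalFlow (cubicCurve (nothFrame 𝕜 0) r) 1 m) 1 -
      contactFieldFun 𝕜 0 i m 1) - 2 * r *
      (contactFieldFun 𝕜 0 i (horizontalFlow (cubicCurve (nothFrame 𝕜 0) r) 1 m) 0 -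
      contactFieldFun 𝕜 0 i m 0), fun s => ?_⟩⟩
  · rw [hc]
    simp only [generatingFunction, slopeForm, contactFieldFun, contactFieldCoeff₁, horizontalFlow,
      Matrix.cons_val]
    generalize m 0 = x, m 1 = y, m 2 = z, m 3 = p, m 4 = q
    fin_cases i <;> simp only [Matrix.cons_val, Fin.reduceFinMk, Fin.zero_eta, Fin.mk_one] <;> ring
  · rw [hc, hd]
    simp only [slopeForm, contactFieldFun, contactFieldCoeff₁, horizontalFlow, Matrix.cons_val]
    generalize m 0 = x, m 1 = y, m 2 = z, m 3 = p, m 4 = q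
    fin_cases i <;> simp only [Matrix.cons_val, Fin.reduceFinMk, Fin.zero_eta, Fin.mk_one] <;> ring
  · rw [hc]
    simp only [contactFieldFun, contactFieldCoeff₁, horizontalFlow, Matrix.cons_val]
    generalize m 0 = x, m 1 = y, m 2 = z, m 3 = p, m 4 = q
    fin_cases i <;> simp only [Matrix.cons_val, Fin.reduceFinMk, Fin.zero_eta, Fin.mk_one] <;> ring

theorem isCubicCompatible_second (i : Fin 14) :
    IsCubicCompatible (nothFrame 𝕜 1) (contactFieldFun 𝕜 1 i) := by
  have hc : ∀ r : 𝕜, cubicCurve (nothFrame 𝕜 1) r = ![1 + 2 * r ^ 3, 2 * r ^ 2, -(4 / 3), 4 * r] := by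
    intro r
    funext j
    fin_cases j <;> simp [cubicCurve, nothFrame] <;> ring
  have hd : ∀ r : 𝕜, cubicTangent (nothFrame 𝕜 1) r = ![6 * r ^ 2, 4 * r, 0, 4] := by
    intro r
    funext j
    fin_cases j <;> simp [cubicTangent, nothFrame] <;> ring
  refine ⟨fun r s m => ?_, fun r s m => ?_, fun r m =>
    ⟨(1 + 2 * r ^ 3) * (contactFieldFun 𝕜 1 i (horizontalFlow (cubicCurve (nothFrame 𝕜 1) r) 1 m) 1 -
      contactFieldFun 𝕜 1 i m 1) - 2 * r ^ 2 *
      (contactFieldFun 𝕜 1 i (horizontalFlow (cubicCurve (nothFrame 𝕜 1) r) 1 m) 0 -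
      contactFieldFun 𝕜 1 i m 0), fun s => ?_⟩⟩
  · rw [hc]
    simp only [generatingFunction, slopeForm, contactFieldFun, contactFieldCoeff₂, horizontalFlow,
      Matrix.cons_val]
    generalize m 0 = x, m 1 = y, m 2 = z, m 3 = p, m 4 = q
    fin_cases i <;> simp only [Matrix.cons_val, Fin.reduceFinMk, Fin.zero_eta, Fin.mk_one] <;> ring
  · rw [hc, hd]
    simp only [slopeForm, contactFieldFun, contactFieldCoeff₂, horizontalFlow, Matrix.cons_val]
    generalize m 0 = x, m 1 = y, m 2 = z, m 3 = p, m 4 = q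
    fin_cases i <;> simp only [Matrix.cons_val, Fin.reduceFinMk, Fin.zero_eta, Fin.mk_one] <;> ring
  · rw [hc]
    simp only [contactFieldFun, contactFieldCoeff₂, horizontalFlow, Matrix.cons_val]
    generalize m 0 = x, m 1 = y, m 2 = z, m 3 = p, m 4 = q
    fin_cases i <;> simp only [Matrix.cons_val, Fin.reduceFinMk, Fin.zero_eta, Fin.mk_one] <;> ring

theorem isCubicCompatible_contactField (k : Fin 2) (i : Fin 14) :
    IsCubicCompatible (nothFrame 𝕜 k) (contactFieldFun 𝕜 k i) := by
  match k with
  | 0 => exact isCubicCompatible_first i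
  | 1 => exact isCubicCompatible_second i

end Fields

end

noncomputable section

/-! ### From the dimension bound to the isomorphism with the symmetry algebra. -/

section TransformEquiv

variable {𝕜 : Type*} [RCLike 𝕜] {T : Opens 𝕜} {H F : 𝕜 → 𝕜}

theorem IsTransform.zero (T : Opens 𝕜) (H F : 𝕜 → 𝕜) : IsTransform T H F 0 0 :=
  ⟨0, 0, ⟨zero_mem _, fun _ _ => rfl⟩, ⟨zero_mem _, fun _ _ => rfl⟩, fun _ _ => map_zero _⟩

theorem IsTransform.sum {ι : Type*} (s : Finset ι) (c : ι → 𝕜)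
    {b : ι → SmoothVF 𝕜 (⊤ : Opens (Fin 5 → 𝕜))} {V : ι → SmoothVF 𝕜 (domain235 T)}
    (h : ∀ i, IsTransform T H F (b i) (V i)) :
    IsTransform T H F (∑ i ∈ s, c i • b i) (∑ i ∈ s, c i • V i) := by
  classical
  induction s using Finset.induction_on with
  | empty => exact IsTransform.zero T H F
  | insert i s hi ih =>
    rw [Finset.sum_insert hi, Finset.sum_insert hi]
    exact ((h i).smul (c i)).add ih

theorem IsTransform.unique_right (ha : IsAdmissible T H F)
    {ξ : SmoothVF 𝕜 (⊤ : Opens (Fin 5 → 𝕜))} {V V' : SmoothVF 𝕜 (domain235 T)}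
    (h : IsTransform T H F ξ V) (h' : IsTransform T H F ξ V') : V = V' := by
  have h1 := h.sub h'
  rw [sub_self] at h1
  exact sub_eq_zero.1 (h1.eq_zero_right ha)

theorem IsTransform.unique_left (ha : IsAdmissible T H F) (hT : (T : Set 𝕜).Nonempty)
    {ξ ξ' : SmoothVF 𝕜 (⊤ : Opens (Fin 5 → 𝕜))} {V : SmoothVF 𝕜 (domain235 T)}
    (h : IsTransform T H F ξ V) (h' : IsTransform T H F ξ' V) : ξ = ξ' := by
  have h1 := h.sub h'
  rw [sub_self] at h1
  exact sub_eq_zero.1 (h1.eq_zero_left ha hT)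

/-- If the symmetries of `D₁` are at most as many as the members of a linearly independent family
of transformable vector fields, then the family is a basis of the Lie algebra which it generates,
and this Lie algebra is identified with the symmetry algebra. -/
theorem exists_lieEquiv_of_isTransform (ha : IsAdmissible T H F) (hT : (T : Set 𝕜).Nonempty)
    {ι : Type*} [Fintype ι] {b : ι → SmoothVF 𝕜 (⊤ : Opens (Fin 5 → 𝕜))}
    (hb : LinearIndependent 𝕜 b) (hV : ∀ i, ∃ V, IsTransform T H F (b i) V)
    (J : symmetryAlgebra (distribution235 H) (domain235 T) →ₗ[𝕜] (ι → 𝕜))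
    (hJ : Function.Injective J) :
    (LieSubalgebra.lieSpan 𝕜 _ (range b)).toSubmodule = Submodule.span 𝕜 (range b) ∧
    ∃ e : LieSubalgebra.lieSpan 𝕜 (SmoothVF 𝕜 (⊤ : Opens (Fin 5 → 𝕜))) (range b) ≃ₗ⁅𝕜⁆
        symmetryAlgebra (distribution235 H) (domain235 T),
      ∀ ξ, IsTransform T H F ξ.1 (e ξ).1 := by
  choose V hV using hV
  have hVs : ∀ i, V i ∈ symmetryAlgebra (distribution235 H) (domain235 T) := fun i =>
    (hV i).mem_symmetryAlgebra ha
  have : FiniteDimensional 𝕜 (symmetryAlgebra (distribution235 H) (domain235 T)) :=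
    FiniteDimensional.of_injective J hJ
  -- A linear relation among the V i is a combination of the b i with transform zero, hence a
  -- relation among the b i.
  have hli : LinearIndependent 𝕜
      fun i => (⟨V i, hVs i⟩ : symmetryAlgebra (distribution235 H) (domain235 T)) := by
    rw [Fintype.linearIndependent_iff]
    intro c hc
    have h1 := IsTransform.sum Finset.univ c hV
    have h2 : ∑ i, c i • V i = 0 := by
      have := congrArg Subtype.val hc
      simpa using this
    rw [h2] at h1
    exact Fintype.linearIndependent_iff.1 hb c (h1.eq_zero_left ha hT)
  -- Independence bounds the dimension below and the injection J bounds it above by the same number.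
  have hcard : Fintype.card ι =
      Module.finrank 𝕜 (symmetryAlgebra (distribution235 H) (domain235 T)) := by
    refine le_antisymm hli.fintype_card_le_finrank ?_
    have := LinearMap.finrank_le_finrank_of_injective hJ
    rwa [Module.finrank_fintype_fun_eq_card] at this
  have hspan := hli.span_eq_top_of_card_eq_finrank' hcard
  have hex : ∀ U ∈ symmetryAlgebra (distribution235 H) (domain235 T),
      ∃ ξ ∈ Submodule.span 𝕜 (range b), IsTransform T H F ξ U := by
    intro U hU
    have h1 : (⟨U, hU⟩ : symmetryAlgebra (distribution235 H) (domain235 T)) ∈ Submodule.span 𝕜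
        (range fun i => (⟨V i, hVs i⟩ : symmetryAlgebra (distribution235 H) (domain235 T))) := by
      rw [hspan]
      trivial
    obtain ⟨c, hc⟩ := (Submodule.mem_span_range_iff_exists_fun 𝕜).1 h1
    have h2 : ∑ i, c i • V i = U := by
      have := congrArg Subtype.val hc
      simpa using this
    refine ⟨∑ i, c i • b i, (Submodule.mem_span_range_iff_exists_fun 𝕜).2 ⟨c, rfl⟩, ?_⟩
    rw [← h2]
    exact IsTransform.sum Finset.univ c hV
  have hex' : ∀ ξ ∈ Submodule.span 𝕜 (range b), ∃ U, IsTransform T H F ξ U := by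
    intro ξ hξ
    obtain ⟨c, rfl⟩ := (Submodule.mem_span_range_iff_exists_fun 𝕜).1 hξ
    exact ⟨_, IsTransform.sum Finset.univ c hV⟩
  -- The span is closed under brackets without any bracket table: the bracket of two of its elements
  -- has a symmetry as transform, this symmetry is also the transform of an element of the span, and
  -- transforms are injective.
  let S : LieSubalgebra 𝕜 (SmoothVF 𝕜 (⊤ : Opens (Fin 5 → 𝕜))) :=
    { Submodule.span 𝕜 (range b) with
      lie_mem' := by
        intro ξ η hξ hη
        obtain ⟨U, hU⟩ := hex' ξ hξ
        obtain ⟨U', hU'⟩ := hex' η hη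
        have h1 := hU.lie ha hU'
        obtain ⟨ζ, hζ, h2⟩ := hex _ (h1.mem_symmetryAlgebra ha)
        rw [IsTransform.unique_left ha hT h1 h2]
        exact hζ }
  have hS : LieSubalgebra.lieSpan 𝕜 _ (range b) ≤ S :=
    LieSubalgebra.lieSpan_le.2 Submodule.subset_span
  have hS' : ∀ ξ ∈ LieSubalgebra.lieSpan 𝕜 (SmoothVF 𝕜 (⊤ : Opens (Fin 5 → 𝕜))) (range b),
      ξ ∈ Submodule.span 𝕜 (range b) := fun ξ hξ => hS hξ
  have hS'' : ∀ ξ ∈ Submodule.span 𝕜 (range b),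
      ξ ∈ LieSubalgebra.lieSpan 𝕜 (SmoothVF 𝕜 (⊤ : Opens (Fin 5 → 𝕜))) (range b) := fun ξ hξ =>
    LieSubalgebra.submodule_span_le_lieSpan hξ
  refine ⟨le_antisymm hS' hS'', ?_⟩
  choose f hf using fun ξ : LieSubalgebra.lieSpan 𝕜 (SmoothVF 𝕜 (⊤ : Opens (Fin 5 → 𝕜))) (range b) =>
    hex' ξ.1 (hS' _ ξ.2)
  let φ : LieSubalgebra.lieSpan 𝕜 (SmoothVF 𝕜 (⊤ : Opens (Fin 5 → 𝕜))) (range b) →ₗ⁅𝕜⁆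
      symmetryAlgebra (distribution235 H) (domain235 T) :=
    { toFun := fun ξ => ⟨f ξ, (hf ξ).mem_symmetryAlgebra ha⟩
      map_add' := fun ξ η => Subtype.ext
        (IsTransform.unique_right ha (hf (ξ + η)) ((hf ξ).add (hf η)))
      map_smul' := fun c ξ => Subtype.ext
        (IsTransform.unique_right ha (hf (c • ξ)) ((hf ξ).smul c))
      map_lie' := fun {ξ η} => Subtype.ext
        (IsTransform.unique_right ha (hf ⁅ξ, η⁆) ((hf ξ).lie ha (hf η))) }
  have hφ : Function.Bijective φ := by
    constructor
    · intro ξ η h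
      have h1 : f ξ = f η := congrArg Subtype.val h
      have h2 := hf ξ
      rw [h1] at h2
      exact Subtype.ext (IsTransform.unique_left ha hT h2 (hf η))
    · rintro ⟨U, hU⟩
      obtain ⟨ξ, hξ, h1⟩ := hex U hU
      exact ⟨⟨ξ, hS'' ξ hξ⟩, Subtype.ext (IsTransform.unique_right ha (hf _) h1)⟩
  exact ⟨LieEquiv.ofBijective φ hφ, fun ξ => hf ξ⟩

end TransformEquiv

end

noncomputable section

/-! ### Contact fields, generating functions and the Lagrange bracket. -/

section ContactBracket

variable {𝕜 : Type*} [RCLike 𝕜]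

/-- Translation by `s` in the direction of the Reeb field. -/
def reebFlow (s : 𝕜) (m : Fin 5 → 𝕜) : Fin 5 → 𝕜 := ![m 0, m 1, m 2 + s, m 3, m 4]

/-- The derivative by `z` of a generating function which is quadratic in `z`. -/
def reebSlope (ξ : (Fin 5 → 𝕜) → Fin 5 → 𝕜) (m : Fin 5 → 𝕜) : 𝕜 :=
  -- A central difference with step 1 is the exact derivative of a quadratic polynomial.
  (generatingFunction ξ (reebFlow 1 m) - generatingFunction ξ (reebFlow (-1) m)) / 2

/-- The Lagrange bracket of the generating functions of two contact vector fields. -/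
def lagrangeBracket (ξ η : (Fin 5 → 𝕜) → Fin 5 → 𝕜) (m : Fin 5 → 𝕜) : 𝕜 :=
  ξ m 0 * η m 3 + ξ m 1 * η m 4 - ξ m 3 * η m 0 - ξ m 4 * η m 1 +
    generatingFunction ξ m * reebSlope η m - generatingFunction η m * reebSlope ξ m

theorem hasFDerivAt_generatingFunction {ξ : (Fin 5 → 𝕜) → Fin 5 → 𝕜} {m : Fin 5 → 𝕜}
    (hξ : DifferentiableAt 𝕜 ξ m) (v : Fin 5 → 𝕜) :
    DifferentiableAt 𝕜 (generatingFunction ξ) m ∧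
    fderiv 𝕜 (generatingFunction ξ) m v =
      generatingFunction (fun m => fderiv 𝕜 ξ m v) m - v 3 * ξ m 0 - v 4 * ξ m 1 := by
  have hd : ∀ j, HasFDerivAt (fun m => ξ m j) ((ContinuousLinearMap.proj j).comp (fderiv 𝕜 ξ m)) m :=
    fun j => hasFDerivAt_pi'.1 hξ.hasFDerivAt j
  have hp : ∀ j, HasFDerivAt (fun m : Fin 5 → 𝕜 => m j)
      (ContinuousLinearMap.proj (R := 𝕜) (φ := fun _ : Fin 5 => 𝕜) j) m :=
    fun j => (ContinuousLinearMap.proj (R := 𝕜) (φ := fun _ : Fin 5 => 𝕜) j).hasFDerivAt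
  have h := ((hd 2).fun_sub ((hp 3).fun_mul (hd 0))).fun_sub ((hp 4).fun_mul (hd 1))
  refine ⟨h.differentiableAt, ?_⟩
  have h' : fderiv 𝕜 (generatingFunction ξ) m = _ := h.fderiv
  rw [h']
  simp [generatingFunction]
  ring

/-- The polynomial contact vector fields whose generating function is quadratic in `z`. -/
def contactFields (𝕜 : Type*) [RCLike 𝕜] : Submodule 𝕜 (SmoothVF 𝕜 (⊤ : Opens (Fin 5 → 𝕜))) where
  carrier := {ξ | ∀ m, (∀ c, fderiv 𝕜 (generatingFunction ξ.1) m (horizontalField c m) =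
    slopeForm c (ξ.1 m)) ∧ fderiv 𝕜 (generatingFunction ξ.1) m (reebField 𝕜 m) =
    reebSlope ξ.1 m}
  add_mem' := by
    intro ξ η hξ hη m
    have e : generatingFunction (ξ + η).1 = generatingFunction ξ.1 + generatingFunction η.1 := by
      funext m
      simp only [generatingFunction, Submodule.coe_add, Pi.add_apply]
      ring
    have h1 := (hasFDerivAt_generatingFunction (SmoothVF.differentiableAt ξ (x := m) trivial) 0).1
    have h2 := (hasFDerivAt_generatingFunction (SmoothVF.differentiableAt η (x := m) trivial) 0).1
    rw [e, fderiv_add h1 h2]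
    refine ⟨fun c => ?_, ?_⟩
    · rw [add_apply, (hξ m).1, (hη m).1]
      simp [slopeForm]
      ring
    · rw [add_apply, (hξ m).2, (hη m).2]
      simp only [reebSlope, e, Pi.add_apply]
      ring
  zero_mem' := by
    intro m
    have e : generatingFunction (0 : SmoothVF 𝕜 (⊤ : Opens (Fin 5 → 𝕜))).1 = fun _ => 0 := by
      funext m
      simp [generatingFunction]
    have hr : reebSlope (0 : SmoothVF 𝕜 (⊤ : Opens (Fin 5 → 𝕜))).1 m = 0 := by
      simp only [reebSlope, e, sub_zero, zero_div]
    rw [hr, e]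
    simp [slopeForm]
  smul_mem' := by
    intro a ξ hξ m
    have e : generatingFunction (a • ξ).1 = a • generatingFunction ξ.1 := by
      funext m
      simp only [generatingFunction, Submodule.coe_smul, Pi.smul_apply, smul_eq_mul]
      ring
    have h1 := (hasFDerivAt_generatingFunction (SmoothVF.differentiableAt ξ (x := m) trivial) 0).1
    rw [e, fderiv_const_smul h1]
    refine ⟨fun c => ?_, ?_⟩
    · rw [smul_apply, (hξ m).1]
      simp [slopeForm]
      ring
    · rw [smul_apply, (hξ m).2]
      simp only [reebSlope, e, Pi.smul_apply, smul_eq_mul]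
      ring

theorem eq_horizontalField_add_reebField (v m : Fin 5 → 𝕜) :
    v = horizontalField ![v 0, v 1, v 3, v 4] m +
      (v 2 - m 3 * v 0 - m 4 * v 1) • reebField 𝕜 m := by
  funext i
  fin_cases i <;> simp [horizontalField, reebField]

theorem fderiv_generatingFunction_of_mem {ξ : SmoothVF 𝕜 (⊤ : Opens (Fin 5 → 𝕜))}
    (hξ : ξ ∈ contactFields 𝕜) (m v : Fin 5 → 𝕜) :
    fderiv 𝕜 (generatingFunction ξ.1) m v =
      v 0 * ξ.1 m 3 + v 1 * ξ.1 m 4 - v 3 * ξ.1 m 0 - v 4 * ξ.1 m 1 +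
        (v 2 - m 3 * v 0 - m 4 * v 1) * reebSlope ξ.1 m := by
  conv_lhs => rw [eq_horizontalField_add_reebField v m]
  rw [map_add, map_smul, (hξ m).1, (hξ m).2]
  simp [slopeForm]

/-- Apply ϖ to Dη · ξ - Dξ · η. The derivatives of the generating functions are known in terms of
the components of the fields, so no derivative is left and bracket computations become polynomial
identities. -/
theorem generatingFunction_lie {ξ η : SmoothVF 𝕜 (⊤ : Opens (Fin 5 → 𝕜))}
    (hξ : ξ ∈ contactFields 𝕜) (hη : η ∈ contactFields 𝕜) (m : Fin 5 → 𝕜) :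
    generatingFunction (⁅ξ, η⁆ : SmoothVF 𝕜 (⊤ : Opens (Fin 5 → 𝕜))).1 m =
      lagrangeBracket ξ.1 η.1 m := by
  have h1 := (hasFDerivAt_generatingFunction (SmoothVF.differentiableAt ξ (x := m) trivial)
    (η.1 m)).2
  have h2 := (hasFDerivAt_generatingFunction (SmoothVF.differentiableAt η (x := m) trivial)
    (ξ.1 m)).2
  rw [fderiv_generatingFunction_of_mem hξ] at h1
  rw [fderiv_generatingFunction_of_mem hη] at h2
  simp only [generatingFunction] at h1 h2
  have h3 : (⁅ξ, η⁆ : SmoothVF 𝕜 (⊤ : Opens (Fin 5 → 𝕜))).1 m =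
      fderiv 𝕜 η.1 m (ξ.1 m) - fderiv 𝕜 ξ.1 m (η.1 m) := SmoothVF.bracket_apply ξ η trivial
  rw [lagrangeBracket]
  simp only [generatingFunction, h3, Pi.sub_apply]
  linear_combination h1 - h2

/-- The horizontal derivatives of the generating function give the p-, q-, x- and y-components up to
sign; its value then gives the z-component. -/
theorem eq_of_generatingFunction_eq {ξ η : SmoothVF 𝕜 (⊤ : Opens (Fin 5 → 𝕜))}
    (hξ : ξ ∈ contactFields 𝕜) (hη : η ∈ contactFields 𝕜)
    (h : ∀ m, generatingFunction ξ.1 m = generatingFunction η.1 m) : ξ = η := by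
  have e : generatingFunction ξ.1 = generatingFunction η.1 := funext h
  have hs : ∀ c m, slopeForm c (ξ.1 m) = slopeForm c (η.1 m) := fun c m => by
    rw [← (hξ m).1, ← (hη m).1, e]
  refine SmoothVF.ext_on fun m _ => ?_
  have h0 := hs ![1, 0, 0, 0] m
  have h1 := hs ![0, 1, 0, 0] m
  have h2 := hs ![0, 0, 1, 0] m
  have h3 := hs ![0, 0, 0, 1] m
  have h4 := h m
  simp [slopeForm] at h0 h1 h2 h3
  simp only [generatingFunction, h2, h3] at h4
  funext j
  fin_cases j
  · exact h2
  · exact h3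
  · exact add_right_cancel (b := -(m 3 * η.1 m 0) - m 4 * η.1 m 1) (by
      simp only [Fin.reduceFinMk]
      linear_combination h4)
  · exact h0
  · exact h1

/-- The conditions along the cubic already contain the contact condition, because the cubic spans
the horizontal directions. The hypothesis `hz` is the expansion in z of a quadratic polynomial and
yields the z-derivative. -/
theorem mem_contactFields_of_isCubicCompatible {n : Fin 4 → Fin 4 → 𝕜} {κ : 𝕜}
    (hn : IsCubicFrame n κ) {ξ : SmoothVF 𝕜 (⊤ : Opens (Fin 5 → 𝕜))}
    (h : IsCubicCompatible n ξ.1)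
    (hz : ∀ s m, generatingFunction ξ.1 (reebFlow s m) = generatingFunction ξ.1 m +
      s * reebSlope ξ.1 m + s ^ 2 * ((generatingFunction ξ.1 (reebFlow 1 m) +
        generatingFunction ξ.1 (reebFlow (-1) m)) / 2 - generatingFunction ξ.1 m)) :
    ξ ∈ contactFields 𝕜 := by
  intro m
  have hd := (hasFDerivAt_generatingFunction (SmoothVF.differentiableAt ξ (x := m) trivial) 0).1
  have c := hasDerivAt_id (0 : 𝕜)
  constructor
  · let D : (Fin 4 → 𝕜) →ₗ[𝕜] 𝕜 :=
      { toFun := fun c => fderiv 𝕜 (generatingFunction ξ.1) m (horizontalField c m) -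
          slopeForm c (ξ.1 m)
        map_add' := fun c d => by
          have e : horizontalField (c + d) m = horizontalField c m + horizontalField d m := by
            funext i
            fin_cases i <;> (simp [horizontalField]; try ring)
          rw [e, map_add, slopeForm_add]
          ring
        map_smul' := fun a c => by
          have e : horizontalField (a • c) m = a • horizontalField c m := by
            funext i
            fin_cases i <;> (simp [horizontalField]; try ring)
          rw [e, map_smul, slopeForm_smul, smul_eq_mul, RingHom.id_apply, smul_eq_mul]
          ring }
    have hD : ∀ r, D (cubicCurve n r) = 0 := by
      intro r
      have d1 : HasDerivAt (fun s => horizontalFlow (cubicCurve n r) s m)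
          (horizontalField (cubicCurve n r) m) 0 := by
        rw [hasDerivAt_pi]
        intro i
        fin_cases i
        · exact ((c.mul_const (cubicCurve n r 0)).const_add (m 0)).congr_deriv
            (by simp [horizontalField])
        · exact ((c.mul_const (cubicCurve n r 1)).const_add (m 1)).congr_deriv
            (by simp [horizontalField])
        · exact (((c.mul_const (m 3 * cubicCurve n r 0 + m 4 * cubicCurve n r 1)).const_add
            (m 2)).fun_add (((c.fun_pow 2).mul_const (cubicCurve n r 2 * cubicCurve n r 0 +
              cubicCurve n r 3 * cubicCurve n r 1)).div_const 2)).congr_deriv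
            (by simp [horizontalField])
        · exact ((c.mul_const (cubicCurve n r 2)).const_add (m 3)).congr_deriv
            (by simp [horizontalField])
        · exact ((c.mul_const (cubicCurve n r 3)).const_add (m 4)).congr_deriv
            (by simp [horizontalField])
      have e0 : horizontalFlow (cubicCurve n r) 0 m = m := by
        funext i
        fin_cases i <;> simp [horizontalFlow]
      have d2 : HasFDerivAt (generatingFunction ξ.1) (fderiv 𝕜 (generatingFunction ξ.1) m)
          (horizontalFlow (cubicCurve n r) 0 m) := by
        rw [e0]
        exact hd.hasFDerivAt
      have d3 := d2.comp_hasDerivAt (0 : 𝕜) d1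
      have d4 : HasDerivAt (fun s => generatingFunction ξ.1 (horizontalFlow (cubicCurve n r) s m))
          (1 * slopeForm (cubicCurve n r) (ξ.1 m)) 0 := by
        rw [funext fun s => h.generatingFunction_flow r s m]
        exact (c.mul_const _).const_add _
      have d5 := d3.unique d4
      rw [one_mul] at d5
      exact sub_eq_zero.2 d5
    have hDn : ∀ i, D (n i) = 0 := by
      have h7 := coeff_eq_zero_of_infinite (W := univ) infinite_univ
        (s := ![D (n 0), D (n 1), D (n 2), D (n 3), 0, 0, 0]) fun r _ => by
          have := hD r
          simp only [cubicCurve, map_add, map_smul, smul_eq_mul] at this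
          simp only [Matrix.cons_val]
          linear_combination this
      intro i
      fin_cases i
      · exact h7 0
      · exact h7 1
      · exact h7 2
      · exact h7 3
    have hD0 : D = 0 := by
      refine LinearMap.ext_on_range (v := n) hn.span fun i => ?_
      rw [hDn]
      rfl
    intro c
    exact sub_eq_zero.1 (LinearMap.congr_fun hD0 c)
  · have d1 : HasDerivAt (fun s => reebFlow s m) (reebField 𝕜 m) 0 := by
      rw [hasDerivAt_pi]
      intro i
      fin_cases i
      · exact hasDerivAt_const _ _
      · exact hasDerivAt_const _ _
      · exact c.const_add (m 2)
      · exact hasDerivAt_const _ _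
      · exact hasDerivAt_const _ _
    have e0 : reebFlow 0 m = m := by
      funext i
      fin_cases i <;> simp [reebFlow]
    have d2 : HasFDerivAt (generatingFunction ξ.1) (fderiv 𝕜 (generatingFunction ξ.1) m)
        (reebFlow 0 m) := by
      rw [e0]
      exact hd.hasFDerivAt
    have d3 := d2.comp_hasDerivAt (0 : 𝕜) d1
    have d4 := (((c.mul_const (reebSlope ξ.1 m)).const_add (generatingFunction ξ.1 m)).fun_add
      ((c.fun_pow 2).mul_const ((generatingFunction ξ.1 (reebFlow 1 m) +
        generatingFunction ξ.1 (reebFlow (-1) m)) / 2 - generatingFunction ξ.1 m)))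
    rw [(d3.congr_of_eventuallyEq (Filter.Eventually.of_forall fun s => (hz s m).symm)).unique d4]
    simp

theorem contactField_mem_contactFields (k : Fin 2) (i : Fin 14) :
    contactField 𝕜 k i ∈ contactFields 𝕜 := by
  refine mem_contactFields_of_isCubicCompatible (isCubicFrame_nothFrame k)
    (isCubicCompatible_contactField k i) fun s m => ?_
  change generatingFunction (contactFieldFun 𝕜 k i) _ = generatingFunction (contactFieldFun 𝕜 k i) _
    + s * reebSlope (contactFieldFun 𝕜 k i) m + s ^ 2 *
      ((generatingFunction (contactFieldFun 𝕜 k i) _ +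
        generatingFunction (contactFieldFun 𝕜 k i) _) / 2 -
          generatingFunction (contactFieldFun 𝕜 k i) _)
  match k with
  | 0 =>
    simp only [generatingFunction, reebSlope, contactFieldFun, contactFieldCoeff₁, reebFlow,
      Matrix.cons_val]
    generalize m 0 = x, m 1 = y, m 2 = z, m 3 = p, m 4 = q
    fin_cases i <;> simp only [Matrix.cons_val, Fin.reduceFinMk, Fin.zero_eta, Fin.mk_one] <;> ring
  | 1 =>
    simp only [generatingFunction, reebSlope, contactFieldFun, contactFieldCoeff₂, reebFlow,
      Matrix.cons_val]
    generalize m 0 = x, m 1 = y, m 2 = z, m 3 = p, m 4 = q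
    fin_cases i <;> simp only [Matrix.cons_val, Fin.reduceFinMk, Fin.zero_eta, Fin.mk_one] <;> ring

end ContactBracket

end

noncomputable section

/-! ### Spanning words from the Serre relations of type G₂. -/

section G2

variable {K L : Type*} [Field K] [CharZero K] [LieRing L] [LieAlgebra K L]

/-- Elements of a Lie algebra which satisfy the Serre relations of type `G₂`, with the short
simple root first. -/
structure IsG2System (h e f : Fin 2 → L) : Prop where
  lie_h_h : ∀ i j, ⁅h i, h j⁆ = 0
  lie_e_f : ∀ i, ⁅e i, f i⁆ = h i
  lie_e_f_of_ne : ∀ i j, i ≠ j → ⁅e i, f j⁆ = 0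
  lie_h_e : ∀ i j, ⁅h i, e j⁆ = CartanMatrix.G₂ i j • e j
  lie_h_f : ∀ i j, ⁅h i, f j⁆ = -(CartanMatrix.G₂ i j • f j)
  serre_e_zero : ⁅e 0, ⁅e 0, ⁅e 0, ⁅e 0, e 1⁆⁆⁆⁆ = 0
  serre_e_one : ⁅e 1, ⁅e 1, e 0⁆⁆ = 0
  serre_f_zero : ⁅f 0, ⁅f 0, ⁅f 0, ⁅f 0, f 1⁆⁆⁆⁆ = 0
  serre_f_one : ⁅f 1, ⁅f 1, f 0⁆⁆ = 0

/-- The root vectors of the six positive roots of `G₂`, as iterated brackets of simple ones. -/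
def g2RootWords (e : Fin 2 → L) : Fin 6 → L :=
  ![e 0, e 1, ⁅e 0, e 1⁆, ⁅e 0, ⁅e 0, e 1⁆⁆, ⁅e 0, ⁅e 0, ⁅e 0, e 1⁆⁆⁆,
    ⁅e 1, ⁅e 0, ⁅e 0, ⁅e 0, e 1⁆⁆⁆⁆]

/-- A spanning family of a Lie algebra of type `G₂`. -/
def g2Words (h e f : Fin 2 → L) : Fin 2 ⊕ (Fin 6 ⊕ Fin 6) → L :=
  Sum.elim h (Sum.elim (g2RootWords e) (g2RootWords f))

namespace IsG2System

variable {h e f : Fin 2 → L}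

/-- The Chevalley involution; it transfers every statement about positive root words to negative
ones. -/
theorem swap (hs : IsG2System h e f) : IsG2System (-h) f e where
  lie_h_h i j := by simp [hs.lie_h_h]
  lie_e_f i := by rw [← lie_skew, hs.lie_e_f]; rfl
  lie_e_f_of_ne i j hij := by rw [← lie_skew, hs.lie_e_f_of_ne j i hij.symm, neg_zero]
  lie_h_e i j := by simp [hs.lie_h_f]
  lie_h_f i j := by simp [hs.lie_h_e]
  serre_e_zero := hs.serre_f_zero
  serre_e_one := hs.serre_f_one
  serre_f_zero := hs.serre_e_zero
  serre_f_one := hs.serre_e_one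

/-- Write a, b for the simple root vectors and p, q, r, s for the other four words. The Serre
relations and the Jacobi identity show that each bracket of a or b with a word is zero, plus or
minus a word, or the next word. -/
theorem lie_e_mem (hs : IsG2System h e f) {U : Submodule K L} (hU : ∀ j, g2RootWords e j ∈ U)
    (i : Fin 2) (j : Fin 6) : ⁅e i, g2RootWords e j⁆ ∈ U := by
  obtain ⟨a, ha⟩ : ∃ a, a = e 0 := ⟨_, rfl⟩
  obtain ⟨b, hb⟩ : ∃ b, b = e 1 := ⟨_, rfl⟩
  have s1 := hs.serre_e_zero
  have s2 := hs.serre_e_one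
  have u2 := hU 2
  have u3 := hU 3
  have u4 := hU 4
  have u5 := hU 5
  simp only [g2RootWords, Matrix.cons_val] at u2 u3 u4 u5
  simp only [← ha, ← hb] at s1 s2 u2 u3 u4 u5
  obtain ⟨p, hp⟩ : ∃ p, p = ⁅a, b⁆ := ⟨_, rfl⟩
  obtain ⟨q, hq⟩ : ∃ q, q = ⁅a, p⁆ := ⟨_, rfl⟩
  obtain ⟨r, hr⟩ : ∃ r, r = ⁅a, q⁆ := ⟨_, rfl⟩
  obtain ⟨s, hs⟩ : ∃ s, s = ⁅b, r⁆ := ⟨_, rfl⟩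
  have ba : ⁅b, a⁆ = -p := by rw [hp, lie_skew]
  have bp : ⁅b, p⁆ = 0 := by
    rw [ba, lie_neg, neg_eq_zero] at s2
    exact s2
  have bq : ⁅b, q⁆ = 0 := by
    rw [hq, leibniz_lie, ba, bp, lie_zero, add_zero, neg_lie, lie_self, neg_zero]
  have pq : ⁅p, q⁆ = -s := by
    have h1 := leibniz_lie a b q
    rw [bq, lie_zero, ← hp, ← hr, ← hs] at h1
    exact eq_neg_of_add_eq_zero_left h1.symm
  have pr : ⁅p, r⁆ = ⁅a, s⁆ := by
    have h1 := leibniz_lie a b r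
    rw [← hp, ← hs] at h1
    rw [← hp, ← hq, ← hr] at s1
    rw [s1, lie_zero, add_zero] at h1
    exact h1.symm
  -- The would-be root vector of weight 4α + 2β. Computing ⁅a, ⁅p, q⁆⁆ in two ways gives ⁅a, s⁆ =
  -- -⁅a, s⁆, and 2 is invertible.
  have as : ⁅a, s⁆ = 0 := by
    have h1 := leibniz_lie a p q
    rw [pq, lie_neg, ← hq, ← hr, lie_self, zero_add, pr] at h1
    have h2 : (2 : K) • ⁅a, s⁆ = 0 := by
      rw [two_smul]
      nth_rewrite 1 [← neg_neg ⁅a, s⁆]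
      rw [h1, neg_add_cancel]
    exact (smul_eq_zero.1 h2).resolve_left two_ne_zero
  have bs : ⁅b, s⁆ = 0 := by
    have h1 := leibniz_lie b p q
    rw [pq, lie_neg, bp, bq, zero_lie, lie_zero, add_zero, neg_eq_zero] at h1
    exact h1
  simp only [← hp, ← hq, ← hr, ← hs] at s1 u2 u3 u4 u5
  fin_cases i <;> fin_cases j <;>
    simp only [g2RootWords, Matrix.cons_val, Fin.reduceFinMk, Fin.zero_eta, Fin.mk_one, ← ha, ← hb,
      ← hp, ← hq, ← hr, ← hs, lie_self, ba, bp, bq, as, bs, s1] <;>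
    first | assumption | exact U.zero_mem | exact U.neg_mem u2

/-- Lowering a word gives a multiple of a shorter word, by induction on its length with the weights
of h 0 and h 1. The span must contain the h j, as ⁅f i, e i⁆ = -h i. -/
theorem lie_f_mem (hs : IsG2System h e f) {U : Submodule K L} (hU : ∀ j, g2RootWords e j ∈ U)
    (hh : ∀ j, h j ∈ U) (i : Fin 2) (j : Fin 6) : ⁅f i, g2RootWords e j⁆ ∈ U := by
  obtain ⟨a, ha⟩ : ∃ a, a = e 0 := ⟨_, rfl⟩
  obtain ⟨b, hb⟩ : ∃ b, b = e 1 := ⟨_, rfl⟩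
  have u0 := hU 0
  have u1 := hU 1
  have u2 := hU 2
  have u3 := hU 3
  have u4 := hU 4
  simp only [g2RootWords, Matrix.cons_val] at u0 u1 u2 u3 u4
  have f0a : ⁅f 0, e 0⁆ = -h 0 := by rw [← lie_skew, hs.lie_e_f]
  have f1b : ⁅f 1, e 1⁆ = -h 1 := by rw [← lie_skew, hs.lie_e_f]
  have f0b : ⁅f 0, e 1⁆ = 0 := by
    rw [← lie_skew, hs.lie_e_f_of_ne 1 0 (by decide), neg_zero]
  have f1a : ⁅f 1, e 0⁆ = 0 := by
    rw [← lie_skew, hs.lie_e_f_of_ne 0 1 (by decide), neg_zero]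
  have h0a : ⁅h 0, e 0⁆ = (2 : ℤ) • e 0 := hs.lie_h_e 0 0
  have h0b : ⁅h 0, e 1⁆ = (-3 : ℤ) • e 1 := hs.lie_h_e 0 1
  have h1a : ⁅h 1, e 0⁆ = (-1 : ℤ) • e 0 := hs.lie_h_e 1 0
  have h1b : ⁅h 1, e 1⁆ = (2 : ℤ) • e 1 := hs.lie_h_e 1 1
  simp only [← ha, ← hb] at u0 u1 u2 u3 u4 f0a f1b f0b f1a h0a h0b h1a h1b
  obtain ⟨p, hp⟩ : ∃ p, p = ⁅a, b⁆ := ⟨_, rfl⟩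
  obtain ⟨q, hq⟩ : ∃ q, q = ⁅a, p⁆ := ⟨_, rfl⟩
  obtain ⟨r, hr⟩ : ∃ r, r = ⁅a, q⁆ := ⟨_, rfl⟩
  have h0p : ⁅h 0, p⁆ = (-1 : ℤ) • p := by
    rw [hp, leibniz_lie, h0a, h0b, lie_smul, smul_lie]
    module
  have h0q : ⁅h 0, q⁆ = (1 : ℤ) • q := by
    rw [hq, leibniz_lie, h0a, h0p, lie_smul, smul_lie]
    module
  have h1p : ⁅h 1, p⁆ = (1 : ℤ) • p := by
    rw [hp, leibniz_lie, h1a, h1b, lie_smul, smul_lie]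
    module
  have h1q : ⁅h 1, q⁆ = (0 : ℤ) • q := by
    rw [hq, leibniz_lie, h1a, h1p, lie_smul, smul_lie]
    module
  have h1r : ⁅h 1, r⁆ = (-1 : ℤ) • r := by
    rw [hr, leibniz_lie, h1a, h1q, lie_smul, smul_lie]
    module
  have f0p : ⁅f 0, p⁆ = (3 : ℤ) • b := by
    rw [hp, leibniz_lie, f0a, f0b, neg_lie, h0b, lie_zero]
    module
  have f0q : ⁅f 0, q⁆ = (4 : ℤ) • p := by
    rw [hq, leibniz_lie, f0a, f0p, neg_lie, h0p, lie_smul, ← hp]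
    module
  have f0r : ⁅f 0, r⁆ = (3 : ℤ) • q := by
    rw [hr, leibniz_lie, f0a, f0q, neg_lie, h0q, lie_smul, ← hq]
    module
  have f1p : ⁅f 1, p⁆ = -a := by
    rw [hp, leibniz_lie, f1a, f1b, zero_lie, lie_neg, lie_skew, h1a]
    module
  have f1q : ⁅f 1, q⁆ = 0 := by
    rw [hq, leibniz_lie, f1a, f1p, zero_lie, lie_neg, lie_self]
    module
  have f1r : ⁅f 1, r⁆ = 0 := by
    rw [hr, leibniz_lie, f1a, f1q, zero_lie, lie_zero, add_zero]
  have f0s : ⁅f 0, ⁅b, r⁆⁆ = (3 : ℤ) • ⁅b, q⁆ := by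
    rw [leibniz_lie, f0b, f0r, zero_lie, lie_smul, zero_add]
  have f1s : ⁅f 1, ⁅b, r⁆⁆ = r := by
    rw [leibniz_lie, f1b, f1r, lie_zero, neg_lie, h1r]
    module
  have bq : ⁅b, q⁆ ∈ U := by
    have h1 := hs.lie_e_mem hU 1 3
    simp only [g2RootWords, Matrix.cons_val, ← ha, ← hb, ← hp, ← hq] at h1
    exact h1
  have z : ∀ (n : ℤ) {x : L}, x ∈ U → n • x ∈ U := fun n x hx => zsmul_mem hx n
  simp only [← hp, ← hq, ← hr] at u2 u3 u4
  fin_cases i <;> fin_cases j <;>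
    simp only [g2RootWords, Matrix.cons_val, Fin.reduceFinMk, Fin.zero_eta, Fin.mk_one, ← ha, ← hb,
      ← hp, ← hq, ← hr, f0a, f0b, f0p, f0q, f0r, f0s, f1a, f1b, f1p, f1q, f1r, f1s] <;>
    first
    | assumption
    | exact U.zero_mem
    | exact U.neg_mem (by first | assumption | exact hh _)
    | exact z _ (by assumption)

/-- The elements x with ⁅x, U⁆ ⊆ U form a subalgebra. It contains the generators, so it is
everything; thus U is itself a subalgebra, and it contains the generators. -/
theorem span_g2Words_eq_top (hs : IsG2System h e f)
    (hgen : LieSubalgebra.lieSpan K L (range e ∪ range f) = ⊤) :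
    Submodule.span K (range (g2Words h e f)) = ⊤ := by
  set U := Submodule.span K (range (g2Words h e f)) with hU
  have mem : ∀ i, g2Words h e f i ∈ U := fun i => Submodule.subset_span (mem_range_self i)
  have hh : ∀ i, h i ∈ U := fun i => mem (Sum.inl i)
  have he : ∀ i, g2RootWords e i ∈ U := fun i => mem (Sum.inr (Sum.inl i))
  have hf : ∀ i, g2RootWords f i ∈ U := fun i => mem (Sum.inr (Sum.inr i))
  have he' : ∀ i, e i ∈ U := fun i => by
    match i with
    | 0 => exact he 0
    | 1 => exact he 1
  have hf' : ∀ i, f i ∈ U := fun i => by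
    match i with
    | 0 => exact hf 0
    | 1 => exact hf 1
  have z : ∀ (n : ℤ) {x : L}, x ∈ U → n • x ∈ U := fun n x hx => zsmul_mem hx n
  let N : LieSubalgebra K L :=
    { carrier := {x | ∀ u ∈ U, ⁅x, u⁆ ∈ U}
      add_mem' := fun {x y} hx hy u hu => by rw [add_lie]; exact U.add_mem (hx u hu) (hy u hu)
      zero_mem' := fun u _ => by rw [zero_lie]; exact U.zero_mem
      smul_mem' := fun c x hx u hu => by rw [smul_lie]; exact U.smul_mem c (hx u hu)
      lie_mem' := fun {x y} hx hy u hu => by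
        rw [lie_lie]
        exact U.sub_mem (hx _ (hy u hu)) (hy _ (hx u hu)) }
  have memN : ∀ x, (∀ i, ⁅x, g2Words h e f i⁆ ∈ U) → x ∈ N := by
    intro x hx u hu
    have hle : U ≤ U.comap ((LieAlgebra.ad K L x : L →ₗ[K] L)) := by
      rw [hU, Submodule.span_le]
      rintro _ ⟨i, rfl⟩
      exact hx i
    exact hle hu
  have hN : N = ⊤ := by
    rw [eq_top_iff, ← hgen, LieSubalgebra.lieSpan_le]
    rintro _ (⟨i, rfl⟩ | ⟨i, rfl⟩)
    · refine memN _ ?_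
      rintro (j | j | j)
      · change ⁅e i, h j⁆ ∈ U
        rw [← lie_skew, hs.lie_h_e]
        exact U.neg_mem (z _ (he' i))
      · exact hs.lie_e_mem he i j
      · exact hs.swap.lie_f_mem hf (fun j => U.neg_mem (hh j)) i j
    · refine memN _ ?_
      rintro (j | j | j)
      · change ⁅f i, h j⁆ ∈ U
        rw [← lie_skew, hs.lie_h_f, neg_neg]
        exact z _ (hf' i)
      · exact hs.lie_f_mem he hh i j
      · exact hs.swap.lie_e_mem hf i j
  let S : LieSubalgebra K L :=
    { U with
      lie_mem' := fun {x y} _ hy => by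
        have hx : x ∈ N := by rw [hN]; trivial
        exact hx y hy }
  have hS : S = ⊤ := by
    rw [eq_top_iff, ← hgen, LieSubalgebra.lieSpan_le]
    rintro _ (⟨i, rfl⟩ | ⟨i, rfl⟩)
    · exact he' i
    · exact hf' i
  rw [eq_top_iff]
  intro x _
  have hx : x ∈ S := by rw [hS]; trivial
  exact hx

end IsG2System

end G2

end

noncomputable section

/-! ### The Serre presentation of the split algebra of type G₂ and a recognition criterion. -/

section G2Presentation

variable {K L : Type*} [Field K] [LieRing L] [LieAlgebra K L]

/-- The projection from the free Lie algebra to the Lie algebra of type `G₂`. -/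
def g2Mk (K : Type*) [Field K] :
    FreeLieAlgebra K (CartanMatrix.Generators (Fin 2)) →ₗ⁅K⁆ LieAlgebra.g₂ K where
  toFun := LieSubmodule.Quotient.mk (N := CartanMatrix.Relations.toIdeal K CartanMatrix.G₂)
  map_add' _ _ := rfl
  map_smul' _ _ := rfl
  map_lie' := rfl

theorem g2Mk_surjective (K : Type*) [Field K] : Function.Surjective (g2Mk K) :=
  LieSubmodule.Quotient.surjective_mk' (CartanMatrix.Relations.toIdeal K CartanMatrix.G₂)

theorem g2Mk_eq_zero {K : Type*} [Field K] {x : FreeLieAlgebra K (CartanMatrix.Generators (Fin 2))}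
    (hx : x ∈ CartanMatrix.Relations.toSet K CartanMatrix.G₂) : g2Mk K x = 0 :=
  (LieSubmodule.Quotient.mk_eq_zero _).2 (LieSubmodule.subset_lieSpan hx)

/-- The generators of the Lie algebra of type `G₂`. -/
def g2Gen (K : Type*) [Field K] (x : CartanMatrix.Generators (Fin 2)) : LieAlgebra.g₂ K :=
  g2Mk K (FreeLieAlgebra.of K x)

open CartanMatrix.Generators in
theorem isG2System_g2Gen (K : Type*) [Field K] :
    IsG2System (fun i => g2Gen K (H i)) (fun i => g2Gen K (E i)) (fun i => g2Gen K (F i)) := by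
  have rHH : ∀ x ∈ range (CartanMatrix.Relations.HH K (B := Fin 2)), g2Mk K x = 0 := fun x hx =>
    g2Mk_eq_zero (Or.inl (Or.inl (Or.inl (Or.inl (Or.inl hx)))))
  have rEF : ∀ x ∈ range (CartanMatrix.Relations.EF K (B := Fin 2)), g2Mk K x = 0 := fun x hx =>
    g2Mk_eq_zero (Or.inl (Or.inl (Or.inl (Or.inl (Or.inr hx)))))
  have rHE : ∀ x ∈ range (CartanMatrix.Relations.HE K CartanMatrix.G₂), g2Mk K x = 0 :=
    fun x hx => g2Mk_eq_zero (Or.inl (Or.inl (Or.inl (Or.inr hx))))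
  have rHF : ∀ x ∈ range (CartanMatrix.Relations.HF K CartanMatrix.G₂), g2Mk K x = 0 :=
    fun x hx => g2Mk_eq_zero (Or.inl (Or.inl (Or.inr hx)))
  have rE : ∀ x ∈ range (CartanMatrix.Relations.adE K CartanMatrix.G₂), g2Mk K x = 0 :=
    fun x hx => g2Mk_eq_zero (Or.inl (Or.inr hx))
  have rF : ∀ x ∈ range (CartanMatrix.Relations.adF K CartanMatrix.G₂), g2Mk K x = 0 :=
    fun x hx => g2Mk_eq_zero (Or.inr hx)
  -- The power of ad in the presentation acts on ⁅E i, E j⁆, so exponents 3 and 1 amount to four and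
  -- two brackets with E i.
  have n3 : (-(CartanMatrix.G₂ 0 1)).toNat = 3 := by decide
  have n1 : (-(CartanMatrix.G₂ 1 0)).toNat = 1 := by decide
  refine ⟨fun i j => ?_, fun i => ?_, fun i j hij => ?_, fun i j => ?_, fun i j => ?_, ?_, ?_, ?_,
    ?_⟩
  · have h := rHH _ ⟨(i, j), rfl⟩
    simpa [g2Gen, CartanMatrix.Relations.HH] using h
  · have h := rEF _ ⟨(i, i), rfl⟩
    simpa [g2Gen, CartanMatrix.Relations.EF, sub_eq_zero] using h
  · have h := rEF _ ⟨(i, j), rfl⟩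
    simpa [g2Gen, CartanMatrix.Relations.EF, hij] using h
  · have h := rHE _ ⟨(i, j), rfl⟩
    simpa [g2Gen, CartanMatrix.Relations.HE, sub_eq_zero] using h
  · have h := rHF _ ⟨(i, j), rfl⟩
    simpa [g2Gen, CartanMatrix.Relations.HF, add_eq_zero_iff_eq_neg] using h
  · have h := rE _ ⟨(0, 1), rfl⟩
    simpa [g2Gen, CartanMatrix.Relations.adE, n3, pow_succ] using h
  · have h := rE _ ⟨(1, 0), rfl⟩
    simpa [g2Gen, CartanMatrix.Relations.adE, n1] using h
  · have h := rF _ ⟨(0, 1), rfl⟩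
    simpa [g2Gen, CartanMatrix.Relations.adF, n3, pow_succ] using h
  · have h := rF _ ⟨(1, 0), rfl⟩
    simpa [g2Gen, CartanMatrix.Relations.adF, n1] using h

-- Each H i is the bracket of E i and F i, so the E i and F i suffice to generate.
open CartanMatrix.Generators in
theorem lieSpan_g2Gen (K : Type*) [Field K] :
    LieSubalgebra.lieSpan K (LieAlgebra.g₂ K)
      (range (fun i => g2Gen K (E i)) ∪ range fun i => g2Gen K (F i)) = ⊤ := by
  set S := LieSubalgebra.lieSpan K (LieAlgebra.g₂ K)
    (range (fun i => g2Gen K (E i)) ∪ range fun i => g2Gen K (F i)) with hS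
  have hE : ∀ i, g2Gen K (E i) ∈ S := fun i =>
    LieSubalgebra.subset_lieSpan (Or.inl (mem_range_self i))
  have hF : ∀ i, g2Gen K (F i) ∈ S := fun i =>
    LieSubalgebra.subset_lieSpan (Or.inr (mem_range_self i))
  have hg : ∀ x, g2Gen K x ∈ S := by
    rintro (i | i | i)
    · rw [← (isG2System_g2Gen K).lie_e_f i]
      exact S.lie_mem (hE i) (hF i)
    · exact hE i
    · exact hF i
  let ψ : FreeLieAlgebra K (CartanMatrix.Generators (Fin 2)) →ₗ⁅K⁆ S :=
    FreeLieAlgebra.lift K fun x => ⟨g2Gen K x, hg x⟩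
  have hψ : S.incl.comp ψ = g2Mk K := by
    refine FreeLieAlgebra.hom_ext fun x => ?_
    simp only [LieHom.comp_apply, ψ, FreeLieAlgebra.lift_of_apply]
    rfl
  rw [eq_top_iff]
  intro x _
  obtain ⟨y, rfl⟩ := g2Mk_surjective K x
  rw [← hψ]
  exact (ψ y).2

/-- The homomorphism from the Lie algebra of type `G₂` given by the Serre presentation. -/
theorem IsG2System.exists_lieHom {h e f : Fin 2 → L} (hs : IsG2System h e f) :
    ∃ φ : LieAlgebra.g₂ K →ₗ⁅K⁆ L, ∀ i, φ (g2Gen K (.H i)) = h i ∧ φ (g2Gen K (.E i)) = e i ∧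
      φ (g2Gen K (.F i)) = f i := by
  let g : CartanMatrix.Generators (Fin 2) → L := fun x => match x with
    | .H i => h i
    | .E i => e i
    | .F i => f i
  let φ₀ := FreeLieAlgebra.lift K g
  have hφ : ∀ x, φ₀ (FreeLieAlgebra.of K x) = g x := fun x => FreeLieAlgebra.lift_of_apply g x
  have hφH : ∀ i, φ₀ (FreeLieAlgebra.of K (.H i)) = h i := fun i => hφ _
  have hφE : ∀ i, φ₀ (FreeLieAlgebra.of K (.E i)) = e i := fun i => hφ _
  have hφF : ∀ i, φ₀ (FreeLieAlgebra.of K (.F i)) = f i := fun i => hφ _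
  have n3 : (-(CartanMatrix.G₂ 0 1)).toNat = 3 := by decide
  have n1 : (-(CartanMatrix.G₂ 1 0)).toNat = 1 := by decide
  have hker : CartanMatrix.Relations.toIdeal K CartanMatrix.G₂ ≤ φ₀.ker := by
    refine LieSubmodule.lieSpan_le.2 ?_
    have e0 := hs.serre_e_zero
    have e1 := hs.serre_e_one
    have f0 := hs.serre_f_zero
    have f1 := hs.serre_f_one
    rintro _ (((((⟨⟨i, j⟩, rfl⟩ | ⟨⟨i, j⟩, rfl⟩) | ⟨⟨i, j⟩, rfl⟩) | ⟨⟨i, j⟩, rfl⟩) |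
      ⟨⟨i, j⟩, rfl⟩) | ⟨⟨i, j⟩, rfl⟩) <;> refine LieHom.mem_ker.2 ?_
    · simp [CartanMatrix.Relations.HH, hφH, hs.lie_h_h]
    · by_cases hij : i = j
      · subst hij
        simp [CartanMatrix.Relations.EF, hφH, hφE, hφF, hs.lie_e_f]
      · simp [CartanMatrix.Relations.EF, hφE, hφF, hs.lie_e_f_of_ne i j hij, hij]
    · simp [CartanMatrix.Relations.HE, hφH, hφE, hs.lie_h_e]
    · simp [CartanMatrix.Relations.HF, hφH, hφF, hs.lie_h_f]
    -- For i = j the exponent -2 truncates to 0 and the relation is ⁅E i, E i⁆ = 0, which is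
    -- automatic.
    · fin_cases i <;> fin_cases j <;>
        simp [CartanMatrix.Relations.adE, hφE, n3, n1, pow_succ, e0, e1]
    · fin_cases i <;> fin_cases j <;>
        simp [CartanMatrix.Relations.adF, hφF, n3, n1, pow_succ, f0, f1]
  let φ₁ : LieAlgebra.g₂ K →ₗ[K] L :=
    Submodule.liftQ (CartanMatrix.Relations.toIdeal K CartanMatrix.G₂).toSubmodule
      (φ₀ : FreeLieAlgebra K (CartanMatrix.Generators (Fin 2)) →ₗ[K] L) fun x hx => hker hx
  have hφ₁ : ∀ x, φ₁ (g2Mk K x) = φ₀ x := fun x => rfl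
  let φ : LieAlgebra.g₂ K →ₗ⁅K⁆ L :=
    { φ₁ with
      map_lie' := fun {x y} => by
        obtain ⟨x, rfl⟩ := g2Mk_surjective K x
        obtain ⟨y, rfl⟩ := g2Mk_surjective K y
        change φ₁ ⁅g2Mk K x, g2Mk K y⁆ = ⁅φ₁ (g2Mk K x), φ₁ (g2Mk K y)⁆
        rw [← LieHom.map_lie, hφ₁, hφ₁, hφ₁, LieHom.map_lie] }
  exact ⟨φ, fun i => ⟨hφH i, hφE i, hφF i⟩⟩

theorem map_g2Words {L' : Type*} [LieRing L'] [LieAlgebra K L'] (φ : L →ₗ⁅K⁆ L')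
    (h e f : Fin 2 → L) (i) :
    φ (g2Words h e f i) = g2Words (fun i => φ (h i)) (fun i => φ (e i)) (fun i => φ (f i)) i := by
  have w : ∀ (e : Fin 2 → L) j, φ (g2RootWords e j) = g2RootWords (fun i => φ (e i)) j := by
    intro e j
    fin_cases j <;> simp [g2RootWords]
  rcases i with i | i | i
  · rfl
  · exact w e i
  · exact w f i

/-- A Lie algebra with a basis of iterated brackets of a system of type `G₂` is the split simple
Lie algebra of this type. -/
theorem IsG2System.nonempty_lieEquiv [CharZero K] {h e f : Fin 2 → L} (hs : IsG2System h e f)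
    (hli : LinearIndependent K (g2Words h e f))
    (hsp : Submodule.span K (range (g2Words h e f)) = ⊤) :
    Nonempty (L ≃ₗ⁅K⁆ LieAlgebra.g₂ K) := by
  obtain ⟨φ, hφ⟩ := hs.exists_lieHom (K := K)
  have hw : ∀ i, φ (g2Words (fun i => g2Gen K (.H i)) (fun i => g2Gen K (.E i))
      (fun i => g2Gen K (.F i)) i) = g2Words h e f i := by
    intro i
    rw [map_g2Words]
    simp only [hφ]
  have htop := (isG2System_g2Gen K).span_g2Words_eq_top (lieSpan_g2Gen K)
  have hb : Function.Bijective φ := by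
    constructor
    · rw [← LieHom.coe_toLinearMap, ← LinearMap.ker_eq_bot, LinearMap.ker_eq_bot']
      intro x hx
      have hx' : x ∈ Submodule.span K (range (g2Words (fun i => g2Gen K (.H i))
          (fun i => g2Gen K (.E i)) (fun i => g2Gen K (.F i)))) := by rw [htop]; trivial
      -- No dimension of the presented algebra is needed: it is spanned by the words, and their
      -- images are independent.
      obtain ⟨c, rfl⟩ := (Submodule.mem_span_range_iff_exists_fun K).1 hx'
      have h1 : ∑ i, c i • g2Words h e f i = 0 := by
        rw [map_sum] at hx
        simpa only [map_smul, LieHom.coe_toLinearMap, hw] using hx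
      have h2 := Fintype.linearIndependent_iff.1 hli c h1
      exact Finset.sum_eq_zero fun i _ => by rw [h2 i, zero_smul]
    · intro y
      have hy : y ∈ Submodule.span K (range (g2Words h e f)) := by rw [hsp]; trivial
      obtain ⟨c, rfl⟩ := (Submodule.mem_span_range_iff_exists_fun K).1 hy
      refine ⟨∑ i, c i • g2Words (fun i => g2Gen K (.H i)) (fun i => g2Gen K (.E i))
        (fun i => g2Gen K (.F i)) i, ?_⟩
      rw [← LieHom.coe_toLinearMap, map_sum]
      simp only [map_smul, LieHom.coe_toLinearMap, hw]
  exact ⟨(LieEquiv.ofBijective φ hb).symm⟩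

end G2Presentation

end

noncomputable section

/-! ### Linear independence of the fourteen fields. -/

section Independence

variable {𝕜 : Type*} [RCLike 𝕜]

theorem sqrt_three_half_ne_zero : ((√3 / 2 : ℝ) : 𝕜) ≠ 0 := by
  rw [Ne, RCLike.ofReal_eq_zero]
  positivity

-- Already the generating functions are independent: each coefficient is a combination of values of
-- the relation at integer points. Only c ≠ 0 matters about √3 / 2.
set_option maxHeartbeats 1000000 in
theorem linearIndependent_contactField_first : LinearIndependent 𝕜 (contactField 𝕜 0) := by
  obtain ⟨c, hc, hc₀⟩ : ∃ c : 𝕜, c = ((√3 / 2 : ℝ) : 𝕜) ∧ c ≠ 0 := ⟨_, rfl, sqrt_three_half_ne_zero⟩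
  rw [Fintype.linearIndependent_iff]
  intro g hg
  -- The relation is evaluated with the contact form, so the multiplier of each g i is the
  -- generating function of the i-th field.
  have E : ∀ x y z p q : 𝕜,
      g 0 * (-3 * p * q * x - 6 * p * y ^ 2 + 9 / 8 * p ^ 2 * q + 3 * q * z - 2 * q ^ 2 * y + 8 *
        x * y ^ 2) + g 1 * (2 * p * x ^ 2 + 3 / 2 * p * z - 9 / 4 * p ^ 2 * x + 9 / 16 * p ^ 3
        + 1 / 12 * q ^ 3 - 2 * x * z) + g 2 * (3 / 2 * p * y + 1 / 4 * q ^ 2 - 2 * x * y) + g 3 *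
        (-(3 / 4 * p) + x) + g 4 * (-q) + g 5 * (1) + g 6 * (y) + g 7 * (-p) + g 8 * (-(3 / 4 * p
        * q) + 2 * y ^ 2) + g 9 * (-(3 / 4 * p * q * y) + 3 / 4 * p * z - 9 / 32 * p ^ 3 + 2 / 3 *
        y ^ 3) + g 10 * (-(3 / 8 * p * q ^ 2) - 9 / 8 * p ^ 2 * y - q * y ^ 2 + 3 * y * z) + g 11
        * (3 * p * q * x * y - 1 / 8 * p * q ^ 3 - 3 * p * x * z + 2 * p * y ^ 3 - 9 / 8 * p ^ 2 *
        q * y + 9 / 8 * p ^ 3 * x - 27 / 64 * p ^ 4 - 3 * q * y * z + q ^ 2 * y ^ 2 - 8 / 3 * x *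
        y ^ 3 + 3 * z ^ 2) + g 12 * (-(3 / 2 * p * x) + 9 / 8 * p ^ 2 + 1 / 2 * q * y) + g 13 * (c
        * (-p * x - q * y + 2 * z)) = 0 := by
    intro x y z p q
    have h := congrFun (congrArg Subtype.val hg) ![x, y, z, p, q]
    rw [Submodule.coe_sum, Finset.sum_apply] at h
    have h0 := congrFun h 0
    have h1 := congrFun h 1
    have h2 := congrFun h 2
    simp [Fin.sum_univ_succ, contactField, SmoothVF.ofContDiff, contactFieldFun,
      contactFieldCoeff₁, -map_div₀, ← hc] at h0 h1 h2
    linear_combination h2 - p * h0 - q * h1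
  intro i
  fin_cases i
  · change g 0 = 0
    linear_combination 71 / 72 * E 0 0 0 0 0 + 1 / 8 * E (-1) 0 0 0 0 + 1 / 8 * E 0 (-1) 0 0 0
      - 1 / 18 * E 0 0 (-1) 0 0 - 1 / 2 * E 0 0 0 0 (-1) - 1 / 2 * E 0 0 0 0 1 - 1 / 18 * E 0 0 1
      0 0 - 1 / 8 * E (-1) (-1) 0 0 0
  · change g 1 = 0
    linear_combination 6 * E 0 0 0 0 0 - 2 * E 0 0 0 0 (-1) - 6 * E 0 0 0 0 1 + 2 * E 0 0 0 0 2
  · change g 2 = 0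
    linear_combination -(4 * E 0 0 0 0 0) + 2 * E 0 0 0 0 (-1) + 2 * E 0 0 0 0 1
  · change g 3 = 0
    linear_combination E 0 0 0 0 0 - E (-1) 0 0 0 0
  · change g 4 = 0
    linear_combination 1 / 2 * E 0 0 0 0 0 + 1 / 3 * E 0 0 0 0 (-1) - E 0 0 0 0 1 + 1 / 6 * E 0 0
      0 0 2
  · change g 5 = 0
    linear_combination E 0 0 0 0 0
  · change g 6 = 0
    linear_combination -(202 / 27 * E 0 0 0 0 0) - 1 / 2 * E 0 (-1) 0 0 0 + 1 / 3 * E 0 0 (-1) 0 0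
      - 32 / 81 * E 0 0 0 (-1) 0 + 8 / 3 * E 0 0 0 0 (-1) + 8 * E 0 0 0 0 1 - 32 / 27 * E 0 0 0 1
      0 + 1 / 3 * E 0 0 1 0 0 + 1 / 2 * E 0 1 0 0 0 - 8 / 3 * E 0 0 0 0 2 + 32 / 81 * E 0 0 0 2 0
  · change g 7 = 0
    linear_combination -(17 / 32 * E 0 0 0 0 0) + 3 / 4 * E (-1) 0 0 0 0 + 9 / 64 * E 0 0 (-1) 0 0
      + 1 / 3 * E 0 0 0 (-1) 0 - E 0 0 0 1 0 + 9 / 64 * E 0 0 1 0 0 + 1 / 6 * E 0 0 0 2 0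
  · change g 8 = 0
    linear_combination -(1 / 2 * E 0 0 0 0 0) + 1 / 4 * E 0 (-1) 0 0 0 + 1 / 4 * E 0 1 0 0 0
  · change g 9 = 0
    linear_combination 101 / 9 * E 0 0 0 0 0 - 1 / 2 * E 0 0 (-1) 0 0 + 16 / 27 * E 0 0 0 (-1) 0
      - 4 * E 0 0 0 0 (-1) - 12 * E 0 0 0 0 1 + 16 / 9 * E 0 0 0 1 0 - 1 / 2 * E 0 0 1 0 0 + 4 *
      E 0 0 0 0 2 - 16 / 27 * E 0 0 0 2 0
  · change g 10 = 0
    linear_combination 1 / 3 * E 0 0 0 0 0 - 1 / 3 * E 0 (-1) 0 0 0 - 1 / 3 * E 0 0 (-1) 0 0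
      + 1 / 3 * E 0 (-1) (-1) 0 0
  · change g 11 = 0
    linear_combination -(1 / 3 * E 0 0 0 0 0) + 1 / 6 * E 0 0 (-1) 0 0 + 1 / 6 * E 0 0 1 0 0
  · change g 12 = 0
    linear_combination -(73 / 72 * E 0 0 0 0 0) + 1 / 16 * E 0 0 (-1) 0 0 + 4 / 9 * E 0 0 0 (-1) 0
      + 4 / 9 * E 0 0 0 1 0 + 1 / 16 * E 0 0 1 0 0
  · change g 13 = 0
    refine (mul_eq_zero.1 ?_).resolve_right hc₀
    linear_combination -(1 / 4 * E 0 0 (-1) 0 0) + 1 / 4 * E 0 0 1 0 0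

set_option maxHeartbeats 1000000 in
theorem linearIndependent_contactField_second : LinearIndependent 𝕜 (contactField 𝕜 1) := by
  obtain ⟨c, hc, hc₀⟩ : ∃ c : 𝕜, c = ((√3 / 2 : ℝ) : 𝕜) ∧ c ≠ 0 := ⟨_, rfl, sqrt_three_half_ne_zero⟩
  rw [Fintype.linearIndependent_iff]
  intro g hg
  have E : ∀ x y z p q : 𝕜,
      g 0 * (3 / 16 * p * q ^ 2 + 3 / 2 * p * x * y + 9 / 16 * p ^ 2 * y + 1 / 2 * q * y ^ 2
        + 1 / 4 * q ^ 2 * x - 3 / 2 * y * z) + g 1 * (3 / 4 * p * q * y + p * x ^ 2 - 3 / 4 * p *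
        z + 9 / 8 * p ^ 2 * x + 9 / 32 * p ^ 3 + q * x * y - x * z - 2 / 3 * y ^ 3) + g 2 * (3 / 8
        * p * q + 1 / 2 * q * x - y ^ 2) + g 3 * (3 / 4 * p + x) + g 4 * (y) + g 5 * (1) + g 6 *
        (-q) + g 7 * (-p) + g 8 * (-3 * p * y - 1 / 2 * q ^ 2) + g 9 * (-3 * p * z - 9 / 8 * p ^ 3
        - 1 / 6 * q ^ 3) + g 10 * (6 * p * y ^ 2 - 9 / 8 * p ^ 2 * q - 3 * q * z + 2 * q ^ 2 * y)
        + g 11 * (1 / 8 * p * q ^ 3 + 3 * p * x * z - 2 * p * y ^ 3 + 9 / 8 * p ^ 2 * q * y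
        + 9 / 8 * p ^ 3 * x + 27 / 64 * p ^ 4 + 3 * q * y * z - q ^ 2 * y ^ 2 + 1 / 6 * q ^ 3 * x
        - 3 * z ^ 2) + g 12 * (-(3 / 2 * p * x) - 9 / 8 * p ^ 2 - 1 / 2 * q * y) + g 13 * (c * (-p
        * x - q * y + 2 * z)) = 0 := by
    intro x y z p q
    have h := congrFun (congrArg Subtype.val hg) ![x, y, z, p, q]
    rw [Submodule.coe_sum, Finset.sum_apply] at h
    have h0 := congrFun h 0
    have h1 := congrFun h 1
    have h2 := congrFun h 2
    simp [Fin.sum_univ_succ, contactField, SmoothVF.ofContDiff, contactFieldFun,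
      contactFieldCoeff₂, -map_div₀, ← hc] at h0 h1 h2
    linear_combination h2 - p * h0 - q * h1
  intro i
  fin_cases i
  · change g 0 = 0
    linear_combination -(16 / 9 * E 0 0 0 0 0) + 4 * E (-1) 0 0 0 0 - E 0 (-1) 0 0 0 - 1 / 9 * E 0
      0 (-1) 0 0 + 4 * E 0 0 0 0 (-1) - 1 / 9 * E 0 0 1 0 0 - E 0 1 0 0 0 - 4 * E (-1) 0 0 0 (-1)
  · change g 1 = 0
    linear_combination -(101 / 9 * E 0 0 0 0 0) + 1 / 2 * E 0 0 (-1) 0 0 - 16 / 27 * E 0 0 0 (-1)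
      0 + 4 * E 0 0 0 0 (-1) + 12 * E 0 0 0 0 1 - 16 / 9 * E 0 0 0 1 0 + 1 / 2 * E 0 0 1 0 0 - 4 *
      E 0 0 0 0 2 + 16 / 27 * E 0 0 0 2 0
  · change g 2 = 0
    linear_combination E 0 0 0 0 0 - 1 / 2 * E 0 (-1) 0 0 0 - 1 / 2 * E 0 1 0 0 0
  · change g 3 = 0
    linear_combination E 0 0 0 0 0 - E (-1) 0 0 0 0
  · change g 4 = 0
    linear_combination -(202 / 27 * E 0 0 0 0 0) - 1 / 2 * E 0 (-1) 0 0 0 + 1 / 3 * E 0 0 (-1) 0 0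
      - 32 / 81 * E 0 0 0 (-1) 0 + 8 / 3 * E 0 0 0 0 (-1) + 8 * E 0 0 0 0 1 - 32 / 27 * E 0 0 0 1
      0 + 1 / 3 * E 0 0 1 0 0 + 1 / 2 * E 0 1 0 0 0 - 8 / 3 * E 0 0 0 0 2 + 32 / 81 * E 0 0 0 2 0
  · change g 5 = 0
    linear_combination E 0 0 0 0 0
  · change g 6 = 0
    linear_combination 1 / 2 * E 0 0 0 0 0 + 1 / 3 * E 0 0 0 0 (-1) - E 0 0 0 0 1 + 1 / 6 * E 0 0
      0 0 2
  · change g 7 = 0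
    linear_combination 31 / 32 * E 0 0 0 0 0 - 3 / 4 * E (-1) 0 0 0 0 + 9 / 64 * E 0 0 (-1) 0 0
      + 1 / 3 * E 0 0 0 (-1) 0 - E 0 0 0 1 0 + 9 / 64 * E 0 0 1 0 0 + 1 / 6 * E 0 0 0 2 0
  · change g 8 = 0
    linear_combination 2 * E 0 0 0 0 0 - E 0 0 0 0 (-1) - E 0 0 0 0 1
  · change g 9 = 0
    linear_combination -(3 * E 0 0 0 0 0) + E 0 0 0 0 (-1) + 3 * E 0 0 0 0 1 - E 0 0 0 0 2
  · change g 10 = 0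
    linear_combination -(10 / 9 * E 0 0 0 0 0) - 3 / 8 * E (-1) 0 0 0 0 + 25 / 96 * E 0 (-1) 0 0 0
      + 19 / 288 * E 0 0 (-1) 0 0 + 1 / 6 * E 0 0 0 (-1) 0 + 1 / 8 * E 0 0 0 0 (-1) + 1 / 2 * E 0
      0 0 0 1 + 19 / 288 * E 0 0 1 0 0 + 3 / 32 * E 0 1 0 0 0 + 3 / 8 * E (-1) 0 0 0 (-1) - 1 / 6
      * E 0 (-1) 0 (-1) 0
  · change g 11 = 0
    linear_combination 1 / 3 * E 0 0 0 0 0 - 1 / 6 * E 0 0 (-1) 0 0 - 1 / 6 * E 0 0 1 0 0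
  · change g 12 = 0
    linear_combination 73 / 72 * E 0 0 0 0 0 - 1 / 16 * E 0 0 (-1) 0 0 - 4 / 9 * E 0 0 0 (-1) 0
      - 4 / 9 * E 0 0 0 1 0 - 1 / 16 * E 0 0 1 0 0
  · change g 13 = 0
    refine (mul_eq_zero.1 ?_).resolve_right hc₀
    linear_combination -(1 / 4 * E 0 0 (-1) 0 0) + 1 / 4 * E 0 0 1 0 0

theorem linearIndependent_contactField (k : Fin 2) : LinearIndependent 𝕜 (contactField 𝕜 k) := by
  match k with
  | 0 => exact linearIndependent_contactField_first
  | 1 => exact linearIndependent_contactField_second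

end Independence

end

noncomputable section

/-! ### Recognition of type G₂ from a bracket table. -/

section G2Recognition

variable {K L : Type*} [Field K] [CharZero K] [LieRing L] [LieAlgebra K L]

/-- Brackets which identify a Lie algebra with a basis of fourteen root vectors and coroots as the
split simple Lie algebra of type `G₂`. -/
theorem nonempty_lieEquiv_g2_of_lie {X : Fin 14 → L} (hli : LinearIndependent K X)
    (hsp : Submodule.span K (range X) = ⊤) {c ε : K} (hc : c ≠ 0) (hε : ε ≠ 0) {a b : Fin 4 → K}
    (ha : ∀ i, a i ≠ 0) (hb : ∀ i, b i ≠ 0)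
    (a0 : ⁅X 2, X 9⁆ = a 0 • X 10) (a1 : ⁅X 2, X 10⁆ = a 1 • X 0) (a2 : ⁅X 2, X 0⁆ = a 2 • X 1)
    (a3 : ⁅X 9, X 1⁆ = a 3 • X 11) (a4 : ⁅X 2, X 1⁆ = 0) (a5 : ⁅X 9, X 10⁆ = 0)
    (b0 : ⁅X 8, X 3⁆ = b 0 • X 4) (b1 : ⁅X 8, X 4⁆ = b 1 • X 6) (b2 : ⁅X 8, X 6⁆ = b 2 • X 7)
    (b3 : ⁅X 3, X 7⁆ = b 3 • X 5) (b4 : ⁅X 8, X 7⁆ = 0) (b5 : ⁅X 3, X 4⁆ = 0)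
    (d0 : ⁅X 2, X 8⁆ = -X 12) (d1 : ⁅X 2, X 3⁆ = 0) (d2 : ⁅X 9, X 8⁆ = 0)
    (d3 : ⁅X 9, X 3⁆ = ε • X 12 - (ε / 2 * c⁻¹) • X 13)
    (e0 : ⁅X 12, X 2⁆ = X 2) (e1 : ⁅X 12, X 9⁆ = (-3 / 2 : K) • X 9) (e2 : ⁅X 12, X 8⁆ = -X 8)
    (e3 : ⁅X 12, X 3⁆ = (3 / 2 : K) • X 3) (f0 : ⁅X 13, X 2⁆ = 0) (f1 : ⁅X 13, X 9⁆ = c • X 9)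
    (f2 : ⁅X 13, X 8⁆ = 0) (f3 : ⁅X 13, X 3⁆ = -(c • X 3)) (hh : ⁅X 12, X 13⁆ = 0) :
    Nonempty (L ≃ₗ⁅K⁆ LieAlgebra.g₂ K) := by
  obtain ⟨μ, hμ⟩ : ∃ μ : K, μ = -ε⁻¹ := ⟨_, rfl⟩
  have hμ₀ : μ ≠ 0 := by rw [hμ]; exact neg_ne_zero.2 (inv_ne_zero hε)
  have hμε : μ * ε = -1 := by rw [hμ]; field_simp
  have hh' : ⁅X 13, X 12⁆ = 0 := by rw [← lie_skew, hh, neg_zero]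
  -- The indices start at 0, so the simple root vectors X 2 and X 9 are S³ and L¹⁰. The scalars -2
  -- and μ = -1/ε make ⁅e i, f i⁆ equal to h i, and these h i act on e 0 and e 1 with the entries 2,
  -- -3, -1, 2 of the Cartan matrix.
  let h : Fin 2 → L := ![(2 : K) • X 12, -X 12 + (1 / 2 * c⁻¹) • X 13]
  let e : Fin 2 → L := ![X 2, X 9]
  let f : Fin 2 → L := ![(-2 : K) • X 8, μ • X 3]
  have b0' : ⁅X 3, X 8⁆ = -(b 0 • X 4) := by rw [← lie_skew, b0]
  have hs : IsG2System h e f := by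
    refine ⟨?_, ?_, ?_, ?_, ?_, ?_, ?_, ?_, ?_⟩
    · intro i j
      fin_cases i <;> fin_cases j <;> simp [h, hh, hh']
    · intro i
      fin_cases i
      · simp [h, e, f, d0]
      · simp only [h, e, f, Fin.mk_one, Matrix.cons_val, lie_smul, d3]
        rw [smul_sub, smul_smul, smul_smul, hμε, show μ * (ε / 2 * c⁻¹) = μ * ε * (1 / 2 * c⁻¹) by
          ring, hμε]
        module
    · intro i j hij
      fin_cases i <;> fin_cases j <;> first | exact absurd rfl hij | simp [e, f, d1, d2]
    · intro i j
      fin_cases i <;> fin_cases j <;>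
        simp [h, e, e0, e1, f0, f1, CartanMatrix.G₂, smul_smul, hc] <;> module
    · intro i j
      fin_cases i <;> fin_cases j <;>
        simp [h, f, e2, e3, f2, f3, CartanMatrix.G₂, smul_smul, hc] <;> module
    · simp [e, a0, a1, a2, a4]
    · simp only [e, Matrix.cons_val]
      rw [← lie_skew (X 9) (X 2), a0]
      simp [a5]
    · simp [f, b0, b1, b2, b4]
    · simp [f, b0', b5]
  set U := Submodule.span K (range (g2Words h e f)) with hU
  have mem : ∀ (i : Fin 2 ⊕ (Fin 6 ⊕ Fin 6)) (j : Fin 14) (s : K), s ≠ 0 →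
      g2Words h e f i = s • X j → X j ∈ U := by
    intro i j s hs hij
    refine (Submodule.smul_mem_iff U hs).1 ?_
    rw [← hij]
    exact Submodule.subset_span (mem_range_self i)
  have two : (-2 : K) ≠ 0 := by norm_num
  have m12 : X 12 ∈ U := mem (.inl 0) 12 2 two_ne_zero rfl
  have m13 : X 13 ∈ U := by
    have h1 : h 1 ∈ U := Submodule.subset_span (mem_range_self (Sum.inl 1))
    have h2 := U.add_mem h1 m12
    have h3 : h 1 + X 12 = (1 / 2 * c⁻¹) • X 13 := by
      simp only [h, Matrix.cons_val]
      module
    rw [h3] at h2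
    exact (Submodule.smul_mem_iff U (mul_ne_zero (by norm_num) (inv_ne_zero hc))).1 h2
  have all : ∀ i, X i ∈ U := by
    have m2 : X 2 ∈ U := mem (.inr (.inl 0)) 2 1 one_ne_zero (one_smul K _).symm
    have m9 : X 9 ∈ U := mem (.inr (.inl 1)) 9 1 one_ne_zero (one_smul K _).symm
    have m10 : X 10 ∈ U := mem (.inr (.inl 2)) 10 (a 0) (ha 0) (by
      simp [g2Words, g2RootWords, e, a0])
    have m0 : X 0 ∈ U := mem (.inr (.inl 3)) 0 (a 0 * a 1) (mul_ne_zero (ha 0) (ha 1)) (by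
      simp [g2Words, g2RootWords, e, a0, a1, smul_smul])
    have m1 : X 1 ∈ U := mem (.inr (.inl 4)) 1 (a 0 * a 1 * a 2)
      (mul_ne_zero (mul_ne_zero (ha 0) (ha 1)) (ha 2)) (by
      simp [g2Words, g2RootWords, e, a0, a1, a2, smul_smul])
    have m11 : X 11 ∈ U := mem (.inr (.inl 5)) 11 (a 0 * a 1 * a 2 * a 3)
      (mul_ne_zero (mul_ne_zero (mul_ne_zero (ha 0) (ha 1)) (ha 2)) (ha 3)) (by
      simp [g2Words, g2RootWords, e, a0, a1, a2, a3, smul_smul])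
    have m8 : X 8 ∈ U := mem (.inr (.inr 0)) 8 (-2) two rfl
    have m3 : X 3 ∈ U := mem (.inr (.inr 1)) 3 μ hμ₀ rfl
    have n4 : ⁅f 0, f 1⁆ = (-2 * μ * b 0) • X 4 := by
      simp only [f, Matrix.cons_val, smul_lie, lie_smul, b0, smul_smul]
      ring_nf
    have n6 : ⁅f 0, ⁅f 0, f 1⁆⁆ = (4 * μ * b 0 * b 1) • X 6 := by
      rw [n4]
      simp only [f, Matrix.cons_val, smul_lie, lie_smul, b1, smul_smul]
      ring_nf
    have n7 : ⁅f 0, ⁅f 0, ⁅f 0, f 1⁆⁆⁆ = (-8 * μ * b 0 * b 1 * b 2) • X 7 := by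
      rw [n6]
      simp only [f, Matrix.cons_val, smul_lie, lie_smul, b2, smul_smul]
      ring_nf
    have n5 : ⁅f 1, ⁅f 0, ⁅f 0, ⁅f 0, f 1⁆⁆⁆⁆ = (-8 * μ ^ 2 * b 0 * b 1 * b 2 * b 3) • X 5 := by
      rw [n7]
      simp only [f, Matrix.cons_val, smul_lie, lie_smul, b3, smul_smul]
      ring_nf
    have m4 : X 4 ∈ U := mem (.inr (.inr 2)) 4 _ (by simp [hμ₀, hb]) n4
    have m6 : X 6 ∈ U := mem (.inr (.inr 3)) 6 _ (by simp [hμ₀, hb]) n6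
    have m7 : X 7 ∈ U := mem (.inr (.inr 4)) 7 _ (by simp [hμ₀, hb]) n7
    have m5 : X 5 ∈ U := mem (.inr (.inr 5)) 5 _ (by simp [hμ₀, hb]) n5
    intro i
    fin_cases i <;> assumption
  have htop : U = ⊤ := by
    rw [eq_top_iff, ← hsp, Submodule.span_le]
    rintro _ ⟨i, rfl⟩
    exact all i
  -- Fourteen words that span a fourteen-dimensional space are independent.
  have hrank : Module.finrank K L = 14 := by
    rw [Module.finrank_eq_card_basis (Module.Basis.mk hli hsp.ge), Fintype.card_fin]
  refine hs.nonempty_lieEquiv (linearIndependent_of_top_le_span_of_card_eq_finrank htop.ge ?_) htop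
  rw [hrank]
  rfl

end G2Recognition

end

noncomputable section

/-! ### The algebra generated by the fourteen fields is split of type G₂. -/

section ContactG2

variable {𝕜 : Type*} [RCLike 𝕜]

/-- The fourteen vector fields as elements of the Lie algebra which they generate. -/
def contactGen (𝕜 : Type*) [RCLike 𝕜] (k : Fin 2) (i : Fin 14) : contactAlgebra 𝕜 k :=
  ⟨contactField 𝕜 k i, LieSubalgebra.subset_lieSpan (mem_range_self i)⟩

theorem contactAlgebra_le_contactFields {k : Fin 2}
    (hk : (contactAlgebra 𝕜 k).toSubmodule = Submodule.span 𝕜 (range (contactField 𝕜 k)))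
    {ξ : SmoothVF 𝕜 (⊤ : Opens (Fin 5 → 𝕜))} (hξ : ξ ∈ contactAlgebra 𝕜 k) :
    ξ ∈ contactFields 𝕜 := by
  have h1 : ξ ∈ Submodule.span 𝕜 (range (contactField 𝕜 k)) := by
    rw [← hk]
    exact hξ
  refine Submodule.span_le.2 ?_ h1
  rintro _ ⟨i, rfl⟩
  exact contactField_mem_contactFields k i

/-- Both sides lie in the span of the fourteen fields, hence are contact fields, so it suffices to
compare generating functions. -/
theorem lie_contactGen {k : Fin 2}
    (hk : (contactAlgebra 𝕜 k).toSubmodule = Submodule.span 𝕜 (range (contactField 𝕜 k)))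
    {i j : Fin 14} {ζ : contactAlgebra 𝕜 k}
    (h : ∀ m, lagrangeBracket (contactFieldFun 𝕜 k i) (contactFieldFun 𝕜 k j) m =
      generatingFunction ζ.1.1 m) : ⁅contactGen 𝕜 k i, contactGen 𝕜 k j⁆ = ζ := by
  refine Subtype.ext (eq_of_generatingFunction_eq
    (contactAlgebra_le_contactFields hk ⁅contactGen 𝕜 k i, contactGen 𝕜 k j⁆.2)
    (contactAlgebra_le_contactFields hk ζ.2) fun m => ?_)
  rw [← h m]
  exact generatingFunction_lie (contactField_mem_contactFields k i)
    (contactField_mem_contactFields k j) m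

theorem generatingFunction_contactGen (k : Fin 2) (i : Fin 14) (m : Fin 5 → 𝕜) :
    generatingFunction (contactGen 𝕜 k i).1.1 m =
      generatingFunction (contactFieldFun 𝕜 k i) m := rfl

theorem generatingFunction_smul {k : Fin 2} (a : 𝕜) (ζ : contactAlgebra 𝕜 k) (m : Fin 5 → 𝕜) :
    generatingFunction (a • ζ).1.1 m = a * generatingFunction ζ.1.1 m := by
  change a * _ - _ * (a * _) - _ * (a * _) = _
  rw [generatingFunction]
  ring

theorem generatingFunction_neg {k : Fin 2} (ζ : contactAlgebra 𝕜 k) (m : Fin 5 → 𝕜) :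
    generatingFunction (-ζ).1.1 m = -generatingFunction ζ.1.1 m := by
  change -_ - _ * (-_) - _ * (-_) = _
  rw [generatingFunction]
  ring

theorem generatingFunction_sub {k : Fin 2} (ζ ζ' : contactAlgebra 𝕜 k) (m : Fin 5 → 𝕜) :
    generatingFunction (ζ - ζ').1.1 m =
      generatingFunction ζ.1.1 m - generatingFunction ζ'.1.1 m := by
  change (ζ.1.1 m 2 - ζ'.1.1 m 2) - m 3 * (ζ.1.1 m 0 - ζ'.1.1 m 0)
    - m 4 * (ζ.1.1 m 1 - ζ'.1.1 m 1) = _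
  rw [generatingFunction, generatingFunction]
  ring

theorem generatingFunction_zero {k : Fin 2} (m : Fin 5 → 𝕜) :
    generatingFunction (0 : contactAlgebra 𝕜 k).1.1 m = 0 := by
  change (0 : 𝕜) - _ * 0 - _ * 0 = 0
  ring

theorem linearIndependent_contactGen (k : Fin 2) : LinearIndependent 𝕜 (contactGen 𝕜 k) :=
  LinearIndependent.of_comp (contactAlgebra 𝕜 k).toSubmodule.subtype
    (linearIndependent_contactField k)

theorem span_contactGen {k : Fin 2}
    (hk : (contactAlgebra 𝕜 k).toSubmodule = Submodule.span 𝕜 (range (contactField 𝕜 k))) :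
    Submodule.span 𝕜 (range (contactGen 𝕜 k)) = ⊤ := by
  rw [eq_top_iff]
  rintro ⟨ξ, hξ⟩ -
  have h1 : ξ ∈ Submodule.span 𝕜 (range (contactField 𝕜 k)) := by
    rw [← hk]
    exact hξ
  obtain ⟨c, hc⟩ := (Submodule.mem_span_range_iff_exists_fun 𝕜).1 h1
  refine (Submodule.mem_span_range_iff_exists_fun 𝕜).2 ⟨c, Subtype.ext ?_⟩
  exact (map_sum (contactAlgebra 𝕜 k).toSubmodule.subtype
    (fun i => c i • contactGen 𝕜 k i) _).trans hc

theorem nonempty_lieEquiv_g2_first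
    (hk : (contactAlgebra 𝕜 0).toSubmodule = Submodule.span 𝕜 (range (contactField 𝕜 0))) :
    Nonempty (contactAlgebra 𝕜 0 ≃ₗ⁅𝕜⁆ LieAlgebra.g₂ 𝕜) := by
  obtain ⟨c, hc, hc₀⟩ : ∃ c : 𝕜, c = ((√3 / 2 : ℝ) : 𝕜) ∧ c ≠ 0 :=
    ⟨_, rfl, sqrt_three_half_ne_zero⟩
  have hci : c⁻¹ * c = 1 := inv_mul_cancel₀ hc₀
  refine nonempty_lieEquiv_g2_of_lie (linearIndependent_contactGen 0) (span_contactGen hk)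
    (c := c) (ε := 3 / 4) (a := ![-1 / 2, -1 / 2, 3, 1 / 2]) (b := ![-3 / 4, -4, -3 / 4, -1]) hc₀
    (by norm_num) ?_ ?_ ?_ ?_ ?_ ?_ ?_ ?_ ?_ ?_ ?_ ?_ ?_ ?_ ?_ ?_ ?_ ?_ ?_ ?_ ?_ ?_ ?_ ?_ ?_ ?_ ?_
  · intro i
    fin_cases i <;> simp
  · intro i
    fin_cases i <;> simp
  all_goals
    refine lie_contactGen hk fun m => ?_
    simp only [generatingFunction_contactGen, generatingFunction_smul, generatingFunction_neg,
      generatingFunction_sub, generatingFunction_zero]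
    simp only [lagrangeBracket, reebSlope, reebFlow, generatingFunction, contactFieldFun,
      contactFieldCoeff₁, Matrix.cons_val, ← hc]
    generalize m 0 = x, m 1 = y, m 2 = z, m 3 = p, m 4 = q
    -- Only the relation `d3` contains c⁻¹, and it needs c⁻¹ c = 1; the other relations are
    -- polynomial identities.
    first
    | (ring; done)
    | linear_combination (3 / 8 * (2 * z - p * x - q * y)) * hci

theorem nonempty_lieEquiv_g2_second
    (hk : (contactAlgebra 𝕜 1).toSubmodule = Submodule.span 𝕜 (range (contactField 𝕜 1))) :
    Nonempty (contactAlgebra 𝕜 1 ≃ₗ⁅𝕜⁆ LieAlgebra.g₂ 𝕜) := by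
  obtain ⟨c, hc, hc₀⟩ : ∃ c : 𝕜, c = ((√3 / 2 : ℝ) : 𝕜) ∧ c ≠ 0 :=
    ⟨_, rfl, sqrt_three_half_ne_zero⟩
  have hci : c⁻¹ * c = 1 := inv_mul_cancel₀ hc₀
  refine nonempty_lieEquiv_g2_of_lie (linearIndependent_contactGen 1) (span_contactGen hk)
    (c := c) (ε := -3) (a := ![1 / 2, -4, -3 / 4, 1]) (b := ![3, -1, -3, -1]) hc₀
    (by norm_num) ?_ ?_ ?_ ?_ ?_ ?_ ?_ ?_ ?_ ?_ ?_ ?_ ?_ ?_ ?_ ?_ ?_ ?_ ?_ ?_ ?_ ?_ ?_ ?_ ?_ ?_ ?_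
  · intro i
    fin_cases i <;> simp
  · intro i
    fin_cases i <;> simp
  all_goals
    refine lie_contactGen hk fun m => ?_
    simp only [generatingFunction_contactGen, generatingFunction_smul, generatingFunction_neg,
      generatingFunction_sub, generatingFunction_zero]
    simp only [lagrangeBracket, reebSlope, reebFlow, generatingFunction, contactFieldFun,
      contactFieldCoeff₂, Matrix.cons_val, ← hc]
    generalize m 0 = x, m 1 = y, m 2 = z, m 3 = p, m 4 = q
    first
    | (ring; done)
    | linear_combination (-(3 / 2) * (2 * z - p * x - q * y)) * hci

theorem nonempty_lieEquiv_g2 : ∀ k : Fin 2,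
    (contactAlgebra 𝕜 k).toSubmodule = Submodule.span 𝕜 (range (contactField 𝕜 k)) →
      Nonempty (contactAlgebra 𝕜 k ≃ₗ⁅𝕜⁆ LieAlgebra.g₂ 𝕜)
  | 0 => nonempty_lieEquiv_g2_first
  | 1 => nonempty_lieEquiv_g2_second

end ContactG2

end

/-! ### Assembly of the main theorem. -/

theorem isCubicBranch_nothCurve {𝕜 : Type*} [RCLike 𝕜] {W : Set 𝕜} {T : Opens 𝕜} {H F : 𝕜 → 𝕜} :
    ∀ k : Fin 2, IsBranch (nothCurve 𝕜 k) W T H F →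
      ∃ κ, IsCubicBranch (nothFrame 𝕜 k) κ W T H F
  | 0, h => ⟨_, isCubicBranch_first h⟩
  | 1, h => ⟨_, isCubicBranch_second h⟩

theorem mainTheorem4 {𝕜 : Type*} [RCLike 𝕜] (k : Fin 2) (W : Set 𝕜) (T : TopologicalSpace.Opens 𝕜)
    (H F : 𝕜 → 𝕜) (hH : IsBranch (nothCurve 𝕜 k) W T H F) :
    -- the double fibration transform is a coordinate change taking `D̃₂` to `D̃₁`
    (ContDiffOn 𝕜 ∞ (doubleFibrationMap H F) (contactDomain T) ∧
      Set.MapsTo (doubleFibrationMap H F) (contactDomain T) (prolongedDomain235 T) ∧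
      (∃ Ψ : (Fin 6 → 𝕜) → (Fin 6 → 𝕜),
        ContDiffOn 𝕜 ∞ Ψ (prolongedDomain235 T) ∧
        Set.MapsTo Ψ (prolongedDomain235 T) (contactDomain T) ∧
        Set.InvOn Ψ (doubleFibrationMap H F) (contactDomain T) (prolongedDomain235 T)) ∧
      ∀ u ∈ contactDomain T,
        (contactSystem H F u).map
            (fderiv 𝕜 (doubleFibrationMap H F) u : (Fin 6 → 𝕜) →ₗ[𝕜] (Fin 6 → 𝕜)) =
          prolongedDistribution235 H (doubleFibrationMap H F u)) ∧
    -- the fourteen vector fields are a basis of a Lie algebra of vector fields, split `𝔤₂`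
    LinearIndependent 𝕜 (contactField 𝕜 k) ∧
    (contactAlgebra 𝕜 k).toSubmodule = Submodule.span 𝕜 (Set.range (contactField 𝕜 k)) ∧
    Nonempty (contactAlgebra 𝕜 k ≃ₗ⁅𝕜⁆ LieAlgebra.g₂ 𝕜) ∧
    -- it is identified with the symmetry algebra of `D₁`
    ∃ e : contactAlgebra 𝕜 k ≃ₗ⁅𝕜⁆ symmetryAlgebra (distribution235 H) (domain235 T),
      ∀ ξ : contactAlgebra 𝕜 k,
        (∃! ζ : SmoothVF 𝕜 (contactDomain T), IsProlongation (contactSystem H F) ξ.1 ζ) ∧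
        (∃! ζ' : SmoothVF 𝕜 (prolongedDomain235 T),
          IsProlongation (prolongedDistribution235 H) (e ξ).1 ζ') ∧
        ∀ (ζ : SmoothVF 𝕜 (contactDomain T)) (ζ' : SmoothVF 𝕜 (prolongedDomain235 T)),
          IsProlongation (contactSystem H F) ξ.1 ζ →
          IsProlongation (prolongedDistribution235 H) (e ξ).1 ζ' →
          ∀ u ∈ contactDomain T,
            fderiv 𝕜 (doubleFibrationMap H F) u (ζ.1 u) = ζ'.1 (doubleFibrationMap H F u) := by
  obtain ⟨κ, hB⟩ := isCubicBranch_nothCurve k hH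
  have h := hB.admissible
  obtain ⟨t₀, ht₀⟩ := hB.nonempty
  -- The fourteen-jet of the generator supplies the injection that bounds the dimension of the
  -- symmetry algebra by fourteen.
  obtain ⟨hk, e, he⟩ := exists_lieEquiv_of_isTransform h hB.nonempty
    (linearIndependent_contactField k)
    (fun i => IsTransform.exists_of_isLineCompatible h
      ((isCubicCompatible_contactField k i).isLineCompatible hB)) _
    (injective_cubicJet_generatorMap h hB.isPreconnected ht₀ hB.frame hB.infinite hB.exists_mem)
  refine ⟨⟨contDiffOn_doubleFibrationMap h, mapsTo_doubleFibrationMap,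
    ⟨doubleFibrationInv H F, contDiffOn_doubleFibrationInv h, mapsTo_doubleFibrationInv,
      invOn_doubleFibrationInv h⟩, fun u hu => map_contactSystem h hu⟩,
    linearIndependent_contactField k, hk, nonempty_lieEquiv_g2 k hk, e, fun ξ => ?_⟩
  obtain ⟨ζ, ζ', hζ, hζ', hr⟩ := he ξ
  refine ⟨⟨ζ, hζ, fun _ h₁ => isProlongation_contactSystem_unique h h₁ hζ⟩,
    ⟨ζ', hζ', fun _ h₁ => isProlongation_prolongedDistribution235_unique h h₁ hζ'⟩,
    fun ζ₁ ζ₁' h₁ h₁' => ?_⟩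
  rw [isProlongation_contactSystem_unique h h₁ hζ,
    isProlongation_prolongedDistribution235_unique h h₁' hζ']
  exact hr
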